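/- Write $\mathbb{R}^7=\mathbb{C}^3\times\mathbb{R}$ with points $(z,t)$, $z_j=x_j+iy_j$, oriented by $(x_1,y_1,x_2,y_2,x_3,y_3,t)$, and let $\phi_0=\omega_0\wedge dt+\mathrm{Re}(dz_1\wedge dz_2\wedge dz_3)$, $\omega_0=\sum_j dx_j\wedge dy_j$, be the flat $G_2$-form. Let $B^7\subset\mathbb{R}^7$ be the closed unit ball and $S^6=\partial B^7$. A $3$-form $\phi$ on an oriented $7$-dimensional vector space is positive if $(i_u\phi)^2\wedge\phi>0$ for all $u\neq0$; it then defines the Euclidean structure $g_\phi$ in the conformal class of $u\mapsto(i_u\phi)^2\wedge\phi$ for which $|\phi|^2=7$, with Hodge star $*_\phi$. A closed $G_2$-structure on $B^7$ is a $3$-form $\phi$, smooth up to the boundary and positive at every point, with $d\phi=0$; it is torsion-free if also $d(*_\phi\phi)=0$. The boundary value of $\phi$ is its pull-back to $S^6$. A pinching family consists of $\Lambda>0$, open sets $\Omega_\lambda\subset\mathbb{R}^7$ for $0<\lambda<\Lambda$, and maps $\iota_\lambda:S^6\to\mathbb{R}^7$ for $0\le\lambda<\Lambda$, such that: (i) there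 is $r>0$ with $\Omega_\lambda\cap\{|x|<r\}=\{(z,t):0<t<|z|^2+\lambda\}\cap\{|x|<r\}$ for all $\lambda\in(0,\Lambda)$; (ii) for each $\lambda\in(0,\Lambda)$ there is an orientation-preserving diffeomorphism $F:B^7\to\overline{\Omega_\lambda}$, smooth up to the boundary in both directions and mapping the open ball onto $\Omega_\lambda$, with $F|_{S^6}=\iota_\lambda$ (so $\Omega_\lambda$ is a bounded domain with smooth boundary, diffeomorphic to a ball, and $\iota_\lambda$ is an embedding of its boundary); (iii) $\iota_0$ is a smooth immersion, $\iota_\lambda\to\iota_0$ in $C^\infty(S^6,\mathbb{R}^7)$ as $\lambda\to0^+$, and $\iota_0(x)=\iota_0(y)$ implies $x=y$ or $\iota_0(x)=0$. Put $\rho^{(\lambda)}=\iota_\lambda^*\phi_0$ for $0\le\lambda<\Lambda$. Then pinching families exist, and for every pinching family: (a) there are two distinct points $p,q\in S^6$ with $\iota_0(p)=\iota_0(q)=0$, so that in the limit two parts of the boundary touch; (b) for every $\lambda\in(0,\Lambda)$ there are diffeomorphisms $F$ as in (ii), and for each of them $F^*\phi_0$ is a torsion-free $G_2$-structure on $B^7$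 with boundary value $\rho^{(\lambda)}$; (c) these flat fillings have no smooth limit as $\lambda\to0$: if $\lambda_n\in(0,\Lambda)$, $\lambda_n\to0$, and $F_n$ is a diffeomorphism as in (ii) for $\lambda_n$, then $F_n^*\phi_0$ does not converge to a positive $3$-form on $B^7$, not even uniformly on $B^7$; (d) $\rho^{(0)}$ is the boundary value of a closed $G_2$-structure on $B^7$. -/

import Mathlib

open Set Filter Topology Metric Module
open scoped Manifold ContDiff

noncomputable section

namespace G2Ball

/-- `ℝ⁷ = ℂ³ × ℝ` with its Euclidean metric. The coordinates are ordered as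
`(x₁, y₁, x₂, y₂, x₃, y₃, t)`, where `z_j = x_j + i y_j`; this order also fixes the orientation. -/
abbrev R7 : Type := EuclideanSpace ℝ (Fin 7)

/-- The unit sphere `S⁶` in `ℝ⁷`, with Mathlib's smooth structure. -/
abbrev S6 : Type := sphere (0 : EuclideanSpace ℝ (Fin (6 + 1))) 1

/-- The closed unit ball `B⁷`, a compact manifold with boundary `S⁶`. -/
abbrev B7 : Set R7 := closedBall 0 1

/-- Exterior forms of degree `k` on `ℝ⁷`. -/
abbrev Form (k : ℕ) : Type := R7 [⋀^Fin k]→L[ℝ] ℝ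

/-- The function `|z|²` of the point `(z, t)` of `ℂ³ × ℝ`. -/
def zNormSq (x : R7) : ℝ := ∑ i : Fin 6, x (Fin.castSucc i) ^ 2

/-- The coordinate `t` of the point `(z, t)` of `ℂ³ × ℝ`. -/
def tCoord (x : R7) : ℝ := x (Fin.last 6)

/-- The standard basis of `ℝ⁷`. -/
def stdVec (i : Fin 7) : R7 := EuclideanSpace.single i 1

/-! ### Linear algebra of 3-forms on oriented `ℝ⁷` -/

/-- The linear map `v ↦ (v_{I 0}, …, v_{I (k-1)})`. -/
def coordMap {k : ℕ} (I : Fin k → Fin 7) : R7 →ₗ[ℝ] (Fin k → ℝ) where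
  toFun v := fun b => v (I b)
  map_add' _ _ := rfl
  map_smul' _ _ := rfl

/-- The constant form `dx_{I 0} ∧ ⋯ ∧ dx_{I (k-1)}`. -/
def coordForm {k : ℕ} (I : Fin k → Fin 7) : Form k where
  toAlternatingMap := (Matrix.detRowAlternating (n := Fin k) (R := ℝ)).compLinearMap (coordMap I)
  cont := by
    change Continuous fun v : Fin k → R7 => Matrix.det (Matrix.of fun a b => v a (I b))
    refine Continuous.matrix_det (continuous_matrix fun a b => ?_)
    simp only [Matrix.of_apply]
    fun_prop

theorem coordForm_apply {k : ℕ} (I : Fin k → Fin 7) (v : Fin k → R7) :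
    coordForm I v = Matrix.det (Matrix.of fun a b => v a (I b)) := rfl

/-- The standard flat `G₂` 3-form `ω₀ ∧ dt + Re (dz₁ ∧ dz₂ ∧ dz₃)` on `ℂ³ × ℝ`, with
`ω₀ = ∑ dx_j ∧ dy_j`. -/
def phi0 : Form 3 :=
  coordForm ![0, 1, 6] + coordForm ![2, 3, 6] + coordForm ![4, 5, 6]
    + coordForm ![0, 2, 4] - coordForm ![0, 3, 5] - coordForm ![1, 2, 5] - coordForm ![1, 3, 4]

/-- The coefficient of the 7-form `i_u φ ∧ i_v φ ∧ φ` with respect to the standard oriented basis: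
with the convention `(dx ∧ dy) (e₁, e₂) = 1`, a wedge product of forms of degrees 2, 2, 3 is the
antisymmetrized sum over all permutations divided by `2! 2! 3! = 24`. -/
def conformalForm (φ : Form 3) (u v : R7) : ℝ :=
  (∑ σ : Equiv.Perm (Fin 7), ((Equiv.Perm.sign σ : ℤ) : ℝ) *
    (φ ![u, stdVec (σ 0), stdVec (σ 1)] * φ ![v, stdVec (σ 2), stdVec (σ 3)] *
      φ ![stdVec (σ 4), stdVec (σ 5), stdVec (σ 6)])) / 24

/-- A 3-form on the oriented vector space `ℝ⁷` is positive if `(i_u φ)² ∧ φ > 0` for all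
non-zero `u`. -/
def IsPositive (φ : Form 3) : Prop :=
  ∀ u : R7, u ≠ 0 → 0 < conformalForm φ u u

/-- The Gram matrix of the bilinear form `(i_u φ) ∧ (i_v φ) ∧ φ`. -/
def conformalMatrix (φ : Form 3) : Matrix (Fin 7) (Fin 7) ℝ :=
  Matrix.of fun i j => conformalForm φ (stdVec i) (stdVec j)

/-- `|φ|²` for the inner product with Gram matrix `g` (the 3-forms `e^i ∧ e^j ∧ e^k`, `i < j < k`,
built from an orthonormal coframe are orthonormal). -/
def normSq (g : Matrix (Fin 7) (Fin 7) ℝ) (φ : Form 3) : ℝ :=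
  (∑ i, ∑ j, ∑ k, ∑ a, ∑ b, ∑ c, g⁻¹ i a * g⁻¹ j b * g⁻¹ k c *
    φ ![stdVec i, stdVec j, stdVec k] * φ ![stdVec a, stdVec b, stdVec c]) / 6

/-- The Gram matrix of the Euclidean structure `g_φ` of a positive form `φ`: the multiple of the
conformal form with respect to which `|φ|² = 7`. (Replacing `g` by `c g` multiplies `|φ|²` by
`c⁻³`.) -/
def g2Metric (φ : Form 3) : Matrix (Fin 7) (Fin 7) ℝ :=
  (normSq (conformalMatrix φ) φ / 7) ^ (1 / 3 : ℝ) • conformalMatrix φ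

/-- The vector metrically dual to the coordinate covector `dx_i`. -/
def dualVec (g : Matrix (Fin 7) (Fin 7) ℝ) (i : Fin 7) : R7 := ∑ a, g⁻¹ i a • stdVec a

/-- The volume form of the inner product with Gram matrix `g` and the standard orientation. -/
def volForm (g : Matrix (Fin 7) (Fin 7) ℝ) : Form 7 := √g.det • coordForm id

/-- The 4-form `*_φ φ`, with `*` the Hodge star operator of `g_φ` and the standard orientation:
`*α = (1/3!) ∑ α_{ijk} i_{e_k^♯} i_{e_j^♯} i_{e_i^♯} vol`. -/
def starPhi (φ : Form 3) : Form 4 :=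
  (1 / 6 : ℝ) • ∑ i, ∑ j, ∑ k, φ ![stdVec i, stdVec j, stdVec k] •
    ((((volForm (g2Metric φ)).curryLeft (dualVec (g2Metric φ) i)).curryLeft
      (dualVec (g2Metric φ) j)).curryLeft (dualVec (g2Metric φ) k))

/-! ### `G₂`-structures on the closed ball -/

/-- A closed `G₂`-structure on the closed ball: a 3-form, smooth up to the boundary, positive at
every point, with `dφ = 0`. -/
structure IsClosedG2 (φ : R7 → Form 3) : Prop where
  smooth : ContDiffOn ℝ ∞ φ B7
  positive : ∀ x ∈ B7, IsPositive (φ x)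
  closed : ∀ x ∈ B7, extDerivWithin φ B7 x = 0

/-- A torsion-free `G₂`-structure on the closed ball: `dφ = 0` and `d (*_φ φ) = 0`. -/
structure IsTorsionFreeG2 (φ : R7 → Form 3) : Prop extends IsClosedG2 φ where
  coclosed : ∀ x ∈ B7, extDerivWithin (fun y => starPhi (φ y)) B7 x = 0

/-- The 3-form `ι^* φ₀` on `S⁶`, at the point `x`. -/
def boundaryForm (ι : S6 → R7) (x : S6) : TangentSpace (𝓡 6) x [⋀^Fin 3]→L[ℝ] ℝ :=
  phi0.compContinuousLinearMap (mvfderiv (𝓡 6) ι x)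

/-- The 3-form `ρ` on `S⁶` is the boundary value of the form `φ` on the ball: its pull-back under
the inclusion of `S⁶`. -/
def IsBoundaryValue (ρ : (x : S6) → TangentSpace (𝓡 6) x [⋀^Fin 3]→L[ℝ] ℝ)
    (φ : R7 → Form 3) : Prop :=
  ∀ x : S6, ρ x = (φ (x : R7)).compContinuousLinearMap
    (mvfderiv (𝓡 6) (Subtype.val : S6 → R7) x)

/-! ### Domains, diffeomorphisms from the ball and the degenerating family -/

/-- `F` restricts to an orientation-preserving diffeomorphism, smooth up to the boundary in both
directions, from the closed ball onto the closure of `Ω` which maps the open ball onto `Ω`.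
If there is such an `F`, then `Ω` is a bounded domain with smooth boundary `F (S⁶)`. -/
structure IsBallDiffeo (F : R7 → R7) (Ω : Set R7) : Prop where
  smooth : ContDiffOn ℝ ∞ F B7
  image_ball : F '' ball 0 1 = Ω
  image_closedBall : F '' B7 = closure Ω
  smooth_inverse : ∃ G : R7 → R7, ContDiffOn ℝ ∞ G (closure Ω) ∧ LeftInvOn G F B7
  orientation : ∀ x ∈ B7, 0 < (fderivWithin ℝ F B7 x).det

/-- The pull-back `F^* φ₀` of the flat `G₂`-structure to the closed ball. -/
def flatPullback (F : R7 → R7) (x : R7) : Form 3 :=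
  phi0.compContinuousLinearMap (fderivWithin ℝ F B7 x)

/-- The extension of a map on `S⁶`, constant on rays, to `ℝ⁷ ∖ {0}` (with value `0` at `0`). -/
def radialExt (f : S6 → R7) (x : R7) : R7 :=
  if h : x ≠ 0 then
    f ⟨‖x‖⁻¹ • x, by
      rw [mem_sphere_zero_iff_norm, norm_smul, norm_inv, norm_norm,
        inv_mul_cancel₀ (norm_ne_zero_iff.mpr h)]⟩
  else 0

/-- `f λ → g` in the `C^∞` topology of maps `S⁶ → ℝ⁷` as `λ` decreases to `0`: all derivatives (of
the extensions which are constant on rays) converge uniformly on `S⁶`. -/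
def TendstoSmoothly (f : ℝ → S6 → R7) (g : S6 → R7) : Prop :=
  ∀ k : ℕ, TendstoUniformlyOn (fun l x => iteratedFDeriv ℝ k (radialExt (f l)) x)
    (iteratedFDeriv ℝ k (radialExt g)) (𝓝[>] 0) (sphere 0 1)

/-- The family of domains `Ω_λ`, `0 < λ < Λ`, and of maps `ι_λ : S⁶ → ℝ⁷`, `0 ≤ λ < Λ`:
* `Ω_λ` is given by `0 < t < |z|² + λ` in a ball around the origin that does not depend on `λ`;
* `Ω_λ` is a bounded domain with smooth boundary, diffeomorphic to the ball, and `ι_λ` is the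
  embedding of its boundary given by such a diffeomorphism;
* the `ι_λ` have a smooth limit `ι_0`, which is an immersion and has no self-intersection away from
  the origin. -/
structure IsPinchingFamily (Λ : ℝ) (Ω : ℝ → Set R7) (ι : ℝ → S6 → R7) : Prop where
  pos : 0 < Λ
  near_origin : ∃ r > 0, ∀ l ∈ Ioo 0 Λ, ∀ x ∈ ball (0 : R7) r,
    x ∈ Ω l ↔ 0 < tCoord x ∧ tCoord x < zNormSq x + l
  boundary : ∀ l ∈ Ioo 0 Λ, ∃ F : R7 → R7, IsBallDiffeo F (Ω l) ∧ ∀ x : S6, F (x : R7) = ι l x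
  limit_smooth : ContMDiff (𝓡 6) 𝓘(ℝ, R7) ∞ (ι 0)
  limit_immersion : ∀ x : S6, Function.Injective (mvfderiv (𝓡 6) (ι 0) x)
  tendsto : TendstoSmoothly ι (ι 0)
  limit_injective : ∀ x y : S6, ι 0 x = ι 0 y → x = y ∨ ι 0 x = 0

end G2Ball

end

open Set Filter Topology Metric Module
open scoped Manifold ContDiff

noncomputable section

namespace G2Ball

/-! ### Linear algebra of the conformal form -/

/-! The flat fillings (b). The coefficient of `i_u φ ∧ i_v φ ∧ φ` is natural: pulling `φ` back by
`A` multiplies it by `det A` and replaces `u, v` by `A u, A v` (`conformalForm_comp`). For `phi0` it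
is six times the inner product (`conformalForm_phi0`). So for `det A > 0` the form `A^* φ₀` is
positive, its metric is `Aᵀ A`, and its dual 4-form is `A^* (*φ₀)` (`starPhi_comp_phi0`). Hence `F^*
φ₀` and its dual are pull-backs of constant forms, and both are closed.

The double point (a). For small `l` both `0` and `l ∂_t` lie on the boundary of `Ω_l`. Their
preimages in the sphere accumulate at points `p`, `q` over the origin. A point over the origin has a
neighbourhood which each `ι_l` with `l` small maps into only one of the disjoint sheets `t = 0` and
`t = |z|² + l` (`exists_sheet`), so `p ≠ q` (`ne_of_tendsto`).

No limit (c). If `F_n^* φ₀` converged uniformly to a positive form, compactness would bound the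
conformal forms below and their determinants above, so that `|u| ≤ C |dF_n u|` with one `C`. The
inverses of `F_n` are then `C`-Lipschitz along the segment from `0` to `l ∂_t`, so the two preimages
have distance at most `C l` and a common limit, against `p ≠ q`.

The closed filling (d). The limit domain is pinched, but the ball can be mapped into `ℝ⁷ × ℝ`, the
extra coordinate being the relative height `s = t / (|z|² + l)` between the sheets, cut off away
from the origin. On `ℝ⁷ × ℝ` the form `φ₀ + ε m^* (ω₀ ∧ dt)`, with `m (y, s) = (χ x + i y, s)` in
terms of the real and imaginary parts of `z`, is closed. Near the origin `m` has differential `(z,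
s)`, and in the coordinates `(z, s)` adding `ε ω₀ ∧ ds` replaces the thickness `|z|² + l` of the
slab by `|z|² + l + ε` (`thickForm_slabShear`): positivity there is uniform in `l`. Far from the
origin `ds` is bounded uniformly in `l`, and a small `ε` does no harm.

The extra term does not change the boundary value. Near the origin `s` is constant on each sheet, so
`ds` pulls back to zero; farther out `χ = 0` kills all `dx_j`, and every term of `ω₀` has a factor
`dx_j`. The height also separates the two points over the origin, so `(ι_0, s)` is an injective
immersion of the sphere. It has a smooth left inverse, and therefore for small `l` a diffeomorphism
of `ℝ⁷ × ℝ` close to the identity carries the boundary data of `ι_l` to those of `ι_0`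
(`exists_correction`). Pulling the form back by this diffeomorphism after the graph of `s` and after
`F` gives the filling of `ρ^(0)`.

Pinching families exist: flatten the polar caps of the ball and rescale `t` onto the slab
(`slabMap`). -/

theorem map_fin3_add0 {E : Type*} [AddCommGroup E] [Module ℝ E] [TopologicalSpace E]
    (φ : E [⋀^Fin 3]→L[ℝ] ℝ) (a a' b c : E) :
    φ ![a + a', b, c] = φ ![a, b, c] + φ ![a', b, c] := by
  have e : ∀ z, Function.update ![a, b, c] 0 z = ![z, b, c] := by
    intro z; ext i; fin_cases i <;> rfl
  simpa only [e] using φ.map_update_add ![a, b, c] 0 a a'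

theorem map_fin3_smul0 {E : Type*} [AddCommGroup E] [Module ℝ E] [TopologicalSpace E]
    (φ : E [⋀^Fin 3]→L[ℝ] ℝ) (r : ℝ) (a b c : E) :
    φ ![r • a, b, c] = r * φ ![a, b, c] := by
  have e : ∀ z, Function.update ![a, b, c] 0 z = ![z, b, c] := by
    intro z; ext i; fin_cases i <;> rfl
  simpa only [e, smul_eq_mul] using φ.map_update_smul ![a, b, c] 0 r a

theorem map_fin3_rot {E : Type*} [AddCommGroup E] [Module ℝ E] [TopologicalSpace E]
    (φ : E [⋀^Fin 3]→L[ℝ] ℝ) (a b c : E) : φ ![a, b, c] = φ ![b, c, a] := by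
  have := φ.toAlternatingMap.map_perm ![a, b, c] (finRotate 3)
  have h : (![a, b, c] ∘ (finRotate 3 : Fin 3 → Fin 3)) = ![b, c, a] := by
    ext i; fin_cases i <;> rfl
  rw [h] at this
  simpa [sign_finRotate] using this.symm

theorem map_fin3_add1 {E : Type*} [AddCommGroup E] [Module ℝ E] [TopologicalSpace E]
    (φ : E [⋀^Fin 3]→L[ℝ] ℝ) (a b b' c : E) :
    φ ![a, b + b', c] = φ ![a, b, c] + φ ![a, b', c] := by
  rw [map_fin3_rot, map_fin3_add0, ← map_fin3_rot φ a b c, ← map_fin3_rot φ a b' c]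

theorem map_fin3_smul1 {E : Type*} [AddCommGroup E] [Module ℝ E] [TopologicalSpace E]
    (φ : E [⋀^Fin 3]→L[ℝ] ℝ) (r : ℝ) (a b c : E) :
    φ ![a, r • b, c] = r * φ ![a, b, c] := by
  rw [map_fin3_rot, map_fin3_smul0, ← map_fin3_rot]

theorem map_fin3_add2 {E : Type*} [AddCommGroup E] [Module ℝ E] [TopologicalSpace E]
    (φ : E [⋀^Fin 3]→L[ℝ] ℝ) (a b c c' : E) :
    φ ![a, b, c + c'] = φ ![a, b, c] + φ ![a, b, c'] := by
  rw [map_fin3_rot, map_fin3_add1, ← map_fin3_rot φ a b c, ← map_fin3_rot φ a b c']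

theorem map_fin3_smul2 {E : Type*} [AddCommGroup E] [Module ℝ E] [TopologicalSpace E]
    (φ : E [⋀^Fin 3]→L[ℝ] ℝ) (r : ℝ) (a b c : E) :
    φ ![a, b, r • c] = r * φ ![a, b, c] := by
  rw [map_fin3_rot, map_fin3_smul1, ← map_fin3_rot]

/-- The 7-linear map whose alternatization is `i_u φ ∧ i_v φ ∧ φ`, up to normalization. -/
def conformalMultilinear (φ : Form 3) (u v : R7) : MultilinearMap ℝ (fun _ : Fin 7 => R7) ℝ where
  toFun w := φ ![u, w 0, w 1] * φ ![v, w 2, w 3] * φ ![w 4, w 5, w 6]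
  map_update_add' := by
    intro inst m i x y
    have : inst = instDecidableEqFin 7 := Subsingleton.elim _ _
    subst this
    fin_cases i <;> simp [Function.update, map_fin3_add0, map_fin3_add1, map_fin3_add2] <;> ring
  map_update_smul' := by
    intro inst m i x y
    have : inst = instDecidableEqFin 7 := Subsingleton.elim _ _
    subst this
    fin_cases i <;> simp [Function.update, map_fin3_smul0, map_fin3_smul1, map_fin3_smul2] <;> ring

/-- An alternating form of top degree is a multiple of the determinant. Seeing the coefficient as
such a form evaluated on the standard basis is what produces the factor `A.det` in
`conformalForm_comp`. -/
theorem conformalForm_eq_alternatization (φ : Form 3) (u v : R7) :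
    conformalForm φ u v =
      MultilinearMap.alternatization (conformalMultilinear φ u v) stdVec / 24 := by
  rw [conformalForm, MultilinearMap.alternatization_apply]
  congr 1
  refine Finset.sum_congr rfl fun σ _ => ?_
  simp [conformalMultilinear, Units.smul_def]

/-- The standard basis of `ℝ⁷`. -/
def stdBasis : Basis (Fin 7) ℝ R7 := (EuclideanSpace.basisFun (Fin 7) ℝ).toBasis

theorem coe_stdBasis : (stdBasis : Fin 7 → R7) = stdVec := by
  ext i : 1
  simp [stdBasis, stdVec]

theorem alternating_comp_stdVec (f : R7 [⋀^Fin 7]→ₗ[ℝ] ℝ) (A : R7 →L[ℝ] R7) :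
    f (fun i => A (stdVec i)) = A.det * f stdVec := by
  have h := f.eq_smul_basis_det stdBasis
  have h2 : f (fun i => A (stdVec i)) = f stdBasis * stdBasis.det (fun i => A (stdVec i)) := by
    conv_lhs => rw [h]
    simp
  have h3 : stdBasis.det (fun i => A (stdVec i)) = A.det := by
    have := stdBasis.det_comp (A : R7 →ₗ[ℝ] R7) stdBasis
    rw [Basis.det_self, mul_one, coe_stdBasis] at this
    exact this
  rw [h2, h3, coe_stdBasis, mul_comm]

theorem comp_fin3 {E F : Type*} [AddCommGroup E] [Module ℝ E] [TopologicalSpace E]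
    [AddCommGroup F] [Module ℝ F] [TopologicalSpace F]
    (φ : F [⋀^Fin 3]→L[ℝ] ℝ) (A : E →L[ℝ] F) (a b c : E) :
    φ.compContinuousLinearMap A ![a, b, c] = φ ![A a, A b, A c] := by
  rw [ContinuousAlternatingMap.compContinuousLinearMap_apply]
  congr 1
  ext i; fin_cases i <;> rfl

theorem conformalForm_comp (φ : Form 3) (A : R7 →L[ℝ] R7) (u v : R7) :
    conformalForm (φ.compContinuousLinearMap A) u v = A.det * conformalForm φ (A u) (A v) := by
  rw [conformalForm_eq_alternatization φ, ← mul_div_assoc, ← alternating_comp_stdVec,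
    conformalForm, MultilinearMap.alternatization_apply]
  congr 1
  refine Finset.sum_congr rfl fun σ _ => ?_
  simp only [comp_fin3]
  simp [conformalMultilinear, Units.smul_def]

theorem conformalForm_add_left (φ : Form 3) (u u' v : R7) :
    conformalForm φ (u + u') v = conformalForm φ u v + conformalForm φ u' v := by
  simp only [conformalForm, map_fin3_add0, ← add_div, ← Finset.sum_add_distrib]
  congr 1
  exact Finset.sum_congr rfl fun σ _ => by ring

theorem conformalForm_add_right (φ : Form 3) (u v v' : R7) :
    conformalForm φ u (v + v') = conformalForm φ u v + conformalForm φ u v' := by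
  simp only [conformalForm, map_fin3_add0, ← add_div, ← Finset.sum_add_distrib]
  congr 1
  exact Finset.sum_congr rfl fun σ _ => by ring

theorem conformalForm_smul_left (φ : Form 3) (r : ℝ) (u v : R7) :
    conformalForm φ (r • u) v = r * conformalForm φ u v := by
  simp only [conformalForm, map_fin3_smul0, mul_div_assoc', Finset.mul_sum]
  congr 1
  exact Finset.sum_congr rfl fun σ _ => by ring

theorem conformalForm_smul_right (φ : Form 3) (r : ℝ) (u v : R7) :
    conformalForm φ u (r • v) = r * conformalForm φ u v := by
  simp only [conformalForm, map_fin3_smul0, mul_div_assoc', Finset.mul_sum]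
  congr 1
  exact Finset.sum_congr rfl fun σ _ => by ring

/-- The conformal form as a bilinear map. -/
def conformalBilin (φ : Form 3) : R7 →ₗ[ℝ] R7 →ₗ[ℝ] ℝ :=
  LinearMap.mk₂ ℝ (conformalForm φ) (conformalForm_add_left φ) (conformalForm_smul_left φ)
    (conformalForm_add_right φ) (conformalForm_smul_right φ)

/-! ### The conformal form of the flat `G₂` form -/

/-- The values of `phi0` on the standard basis. -/
def phi0Coeff (a b c : Fin 7) : ℤ :=
  let d (i j k : Fin 7) : ℤ :=
    (if a = i then if b = j then if c = k then 1 else 0 else 0 else 0)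
    + (if a = j then if b = k then if c = i then 1 else 0 else 0 else 0)
    + (if a = k then if b = i then if c = j then 1 else 0 else 0 else 0)
    - (if a = i then if b = k then if c = j then 1 else 0 else 0 else 0)
    - (if a = k then if b = j then if c = i then 1 else 0 else 0 else 0)
    - (if a = j then if b = i then if c = k then 1 else 0 else 0 else 0)
  d 0 1 6 + d 2 3 6 + d 4 5 6 + d 0 2 4 - d 0 3 5 - d 1 2 5 - d 1 3 4

theorem coordForm_fin3 (i j k : Fin 7) (u v w : R7) :
    coordForm ![i, j, k] ![u, v, w] = u i * v j * w k - u i * v k * w j - u j * v i * w k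
      + u j * v k * w i + u k * v i * w j - u k * v j * w i := by
  rw [coordForm_apply, Matrix.det_fin_three]
  simp

theorem stdVec_apply (a i : Fin 7) : stdVec a i = if a = i then 1 else 0 := by
  simp [stdVec, PiLp.single_apply, eq_comm]

theorem phi0_stdVec (a b c : Fin 7) :
    phi0 ![stdVec a, stdVec b, stdVec c] = phi0Coeff a b c := by
  have h : ∀ i j k : Fin 7, coordForm ![i, j, k] ![stdVec a, stdVec b, stdVec c] =
      (((if a = i then if b = j then if c = k then 1 else 0 else 0 else 0)
    + (if a = j then if b = k then if c = i then 1 else 0 else 0 else 0)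
    + (if a = k then if b = i then if c = j then 1 else 0 else 0 else 0)
    - (if a = i then if b = k then if c = j then 1 else 0 else 0 else 0)
    - (if a = k then if b = j then if c = i then 1 else 0 else 0 else 0)
    - (if a = j then if b = i then if c = k then 1 else 0 else 0 else 0) : ℤ) : ℝ) := by
    intro i j k
    rw [coordForm_fin3]
    push_cast
    simp only [stdVec_apply, mul_ite, mul_one, mul_zero]
    split_ifs <;> simp_all
  simp only [phi0, ContinuousAlternatingMap.add_apply, ContinuousAlternatingMap.sub_apply, h,
    phi0Coeff]
  push_cast
  ring

/-! ### Signed sums over permutations as nested finite sums -/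

/-- The sign of `b - a`. -/
def orderSign (a b : Fin 7) : ℤ := if a.val < b.val then 1 else if b.val < a.val then -1 else 0

theorem orderSign_eq_zero_iff {a b : Fin 7} : orderSign a b = 0 ↔ a = b := by
  unfold orderSign
  split_ifs <;> simp [Fin.ext_iff] <;> omega

/-- The Levi-Civita symbol. -/
def leviCivita (f : Fin 7 → Fin 7) : ℤ := ∏ j, ∏ i ∈ Finset.Iio j, orderSign (f i) (f j)

theorem leviCivita_perm (σ : Equiv.Perm (Fin 7)) : leviCivita σ = Equiv.Perm.sign σ := by
  rw [Equiv.Perm.sign_eq_prod_prod_Iio, leviCivita]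
  push_cast
  refine Finset.prod_congr rfl fun j _ => Finset.prod_congr rfl fun i hi => ?_
  have hij : σ i ≠ σ j := fun h => (Finset.mem_Iio.1 hi).ne (σ.injective h)
  rw [orderSign]
  have : (σ i).val ≠ (σ j).val := fun h => hij (Fin.ext h)
  split_ifs with h1 h2 h3 h3 <;> first | rfl | (exfalso; simp only [Fin.lt_def] at *; omega)

theorem leviCivita_eq_zero {f : Fin 7 → Fin 7} (hf : ¬ Function.Injective f) :
    leviCivita f = 0 := by
  simp only [Function.Injective, not_forall] at hf
  obtain ⟨i, j, hij, hne⟩ := hf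
  wlog h : i < j generalizing i j
  · exact this j i hij.symm (Ne.symm hne) (lt_of_le_of_ne (not_lt.1 h) (Ne.symm hne))
  refine Finset.prod_eq_zero (Finset.mem_univ j) (Finset.prod_eq_zero (Finset.mem_Iio.2 h) ?_)
  exact orderSign_eq_zero_iff.2 hij

/-- The Levi-Civita symbol vanishes on non-injective maps, so the sum may run over all maps. Their
seven values vary independently, which allows nesting and pruning. -/
theorem sum_perm_eq_sum_leviCivita (g : (Fin 7 → Fin 7) → ℤ) :
    ∑ σ : Equiv.Perm (Fin 7), (Equiv.Perm.sign σ : ℤ) * g σ = ∑ f, leviCivita f * g f := by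
  classical
  rw [← Finset.sum_filter_of_ne (p := Function.Bijective) (s := Finset.univ)]
  · symm
    refine Finset.sum_bij' (fun f hf => Equiv.ofBijective f (Finset.mem_filter.1 hf).2)
      (fun σ _ => σ) ?_ ?_ ?_ ?_ ?_
    · simp
    · exact fun σ _ => Finset.mem_filter.2 ⟨Finset.mem_univ _, σ.bijective⟩
    · intros; rfl
    · intros; ext; rfl
    · intro f hf
      rw [← leviCivita_perm]; rfl
  · intro f _ h
    rw [← Finite.injective_iff_bijective]
    by_contra hf
    simp [leviCivita_eq_zero hf] at h

theorem sum_fin_succ_fun {n : ℕ} (g : (Fin (n + 1) → Fin 7) → ℤ) :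
    ∑ f, g f = ∑ a, ∑ f : Fin n → Fin 7, g (Matrix.vecCons a f) := by
  rw [← Fintype.sum_prod_type', ← (Fin.consEquiv fun _ => Fin 7).sum_comp]
  rfl

theorem sum_fin_zero_fun (g : (Fin 0 → Fin 7) → ℤ) : ∑ f, g f = g ![] := by
  rw [Fintype.sum_eq_single ![] fun f hf => absurd (Subsingleton.elim f ![]) hf]

theorem mul_if_eq_zero (x y : ℤ) : (if x = 0 then 0 else x * y) = x * y := by
  split_ifs with h <;> simp [h]

theorem sum_perm_fin_seven (g : (Fin 7 → Fin 7) → ℤ) :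
    ∑ σ : Equiv.Perm (Fin 7), (Equiv.Perm.sign σ : ℤ) * g σ =
      ∑ a, ∑ b, ∑ c, ∑ d, ∑ e, ∑ f, ∑ h, orderSign a b * (orderSign a c * orderSign b c) *
        (orderSign a d * orderSign b d * orderSign c d) *
        (orderSign a e * orderSign b e * orderSign c e * orderSign d e) *
        (orderSign a f * orderSign b f * orderSign c f * orderSign d f * orderSign e f) *
        (orderSign a h * orderSign b h * orderSign c h * orderSign d h * orderSign e h *
          orderSign f h) * g ![a, b, c, d, e, f, h] := by
  rw [sum_perm_eq_sum_leviCivita]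
  simp only [sum_fin_succ_fun, sum_fin_zero_fun]
  refine Finset.sum_congr rfl fun a _ => Finset.sum_congr rfl fun b _ =>
    Finset.sum_congr rfl fun c _ => Finset.sum_congr rfl fun d _ => Finset.sum_congr rfl fun e _ =>
    Finset.sum_congr rfl fun f _ => Finset.sum_congr rfl fun h _ => ?_
  congr 1
  have hI : ∀ j : Fin 7, Finset.Iio j = Finset.univ.filter (· < j) := by
    intro j; ext; simp
  simp only [leviCivita, hI, Finset.prod_filter, Fin.prod_univ_succ]
  simp [Fin.lt_def]
  ring

/-- Factors stand as far out as their indices allow, and the tests for zero cut off inner sums,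
which keeps the kernel evaluation small. The value is `144 = 24 · 6`, with `24` the normalization of
`conformalForm`. -/
theorem sum_sign_phi0Coeff : ∀ i j : Fin 7,
    (∑ a, ∑ b, if phi0Coeff i a b = 0 then 0 else phi0Coeff i a b *
      (orderSign a b * ∑ c, if orderSign a c * orderSign b c = 0 then 0 else
        orderSign a c * orderSign b c *
      ∑ d, if phi0Coeff j c d = 0 then 0 else phi0Coeff j c d *
      (orderSign a d * orderSign b d * orderSign c d *
      ∑ e, if orderSign a e * orderSign b e * orderSign c e * orderSign d e = 0 then 0 else
        orderSign a e * orderSign b e * orderSign c e * orderSign d e *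
      ∑ f, if orderSign a f * orderSign b f * orderSign c f * orderSign d f * orderSign e f = 0
        then 0 else
        orderSign a f * orderSign b f * orderSign c f * orderSign d f * orderSign e f *
      ∑ h, if orderSign a h * orderSign b h * orderSign c h * orderSign d h * orderSign e h *
          orderSign f h = 0 then 0 else
        orderSign a h * orderSign b h * orderSign c h * orderSign d h * orderSign e h *
          orderSign f h * phi0Coeff e f h))) = if i = j then 144 else 0 := by
  decide +kernel

theorem conformalForm_phi0_stdVec (i j : Fin 7) :
    conformalForm phi0 (stdVec i) (stdVec j) = if i = j then 6 else 0 := by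
  have h := sum_sign_phi0Coeff i j
  simp only [mul_if_eq_zero] at h
  simp only [Finset.mul_sum] at h
  have h2 := sum_perm_fin_seven fun f =>
    phi0Coeff i (f 0) (f 1) * phi0Coeff j (f 2) (f 3) * phi0Coeff (f 4) (f 5) (f 6)
  have h3 : ∑ σ : Equiv.Perm (Fin 7), (Equiv.Perm.sign σ : ℤ) * (phi0Coeff i (σ 0) (σ 1) *
      phi0Coeff j (σ 2) (σ 3) * phi0Coeff (σ 4) (σ 5) (σ 6)) = if i = j then 144 else 0 := by
    rw [h2, ← h]
    refine Finset.sum_congr rfl fun a _ => Finset.sum_congr rfl fun b _ =>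
      Finset.sum_congr rfl fun c _ => Finset.sum_congr rfl fun d _ =>
      Finset.sum_congr rfl fun e _ => Finset.sum_congr rfl fun f _ =>
      Finset.sum_congr rfl fun h _ => ?_
    simp only [Matrix.cons_val]
    ring
  simp only [conformalForm, phi0_stdVec]
  have h4 := congrArg (fun z : ℤ => (z : ℝ)) h3
  push_cast at h4
  rw [h4]
  split_ifs <;> norm_num

theorem sum_smul_stdVec (u : R7) : ∑ i, u i • stdVec i = u := by
  conv_rhs => rw [← stdBasis.sum_repr u]
  simp [stdBasis, stdVec]

theorem conformalForm_phi0 (u v : R7) : conformalForm phi0 u v = 6 * inner ℝ u v := by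
  have h : conformalBilin phi0 = (6 : ℝ) • (innerₗ R7) := by
    refine stdBasis.ext fun i => stdBasis.ext fun j => ?_
    rw [coe_stdBasis]
    change conformalForm phi0 (stdVec i) (stdVec j) = 6 * inner ℝ (stdVec i) (stdVec j)
    rw [conformalForm_phi0_stdVec]
    rw [stdVec, EuclideanSpace.inner_single_left, stdVec_apply]
    simp [eq_comm]
  exact congrArg (fun B => B u v) h

theorem isPositive_comp {φ : Form 3} (hφ : IsPositive φ) {A : R7 →L[ℝ] R7} (hA : 0 < A.det) :
    IsPositive (φ.compContinuousLinearMap A) := by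
  intro u hu
  rw [conformalForm_comp]
  refine mul_pos hA (hφ _ fun h => hu ?_)
  have h0 : LinearMap.ker (A : R7 →ₗ[ℝ] R7) = ⊥ := by
    by_contra hb
    exact hA.ne' (LinearMap.det_eq_zero_iff_ker_ne_bot.2 hb)
  exact LinearMap.ker_eq_bot'.1 h0 u h

theorem isPositive_phi0 : IsPositive phi0 := by
  intro u hu
  rw [conformalForm_phi0, real_inner_self_eq_norm_sq]
  positivity

/-! ### The Hodge dual of a form in the orbit of `phi0` -/

/-- A 3-form as a curried trilinear map. -/
def trilin (φ : Form 3) : R7 →ₗ[ℝ] R7 →ₗ[ℝ] R7 →ₗ[ℝ] ℝ :=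
  LinearMap.mk₂ ℝ
    (fun x y => { toFun := fun z => φ ![x, y, z]
                  map_add' := map_fin3_add2 φ x y
                  map_smul' := fun r z => map_fin3_smul2 φ r x y z })
    (fun x x' y => by ext1 z; exact map_fin3_add0 φ x x' y z)
    (fun r x y => by ext1 z; exact map_fin3_smul0 φ r x y z)
    (fun x y y' => by ext1 z; exact map_fin3_add1 φ x y y' z)
    (fun r x y => by ext1 z; exact map_fin3_smul1 φ r x y z)

theorem trilin_apply (φ : Form 3) (x y z : R7) : trilin φ x y z = φ ![x, y, z] := rfl

/-- Contraction of a 7-form with three vectors, as a curried trilinear map. -/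
def curryTrilin (V : Form 7) (w : Fin 4 → R7) : R7 →ₗ[ℝ] R7 →ₗ[ℝ] R7 →ₗ[ℝ] ℝ :=
  LinearMap.mk₂ ℝ
    (fun x y => { toFun := fun z => ((V.curryLeft x).curryLeft y).curryLeft z w
                  map_add' := fun z z' => by simp
                  map_smul' := fun r z => by simp })
    (fun x x' y => by ext1 z; simp)
    (fun r x y => by ext1 z; simp)
    (fun x y y' => by ext1 z; simp)
    (fun r x y => by ext1 z; simp)

section Contraction

variable {b v : Fin 7 → R7} {c : ℝ}

/-- The hypothesis says `∑ e_i ⊗ v_i = c ∑ b_m ⊗ b_m`, so a contraction with raised indices can be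
computed in the frame `b`. -/
theorem sum_mul_of_dual (hv : ∀ i, v i = c • ∑ m, b m i • b m) (f g : R7 →ₗ[ℝ] ℝ) :
    ∑ i, f (stdVec i) * g (v i) = c * ∑ m, f (b m) * g (b m) := by
  have h1 : ∀ m, f (b m) = ∑ i, b m i * f (stdVec i) := by
    intro m
    conv_lhs => rw [← sum_smul_stdVec (b m)]
    simp
  simp only [hv, map_smul, map_sum, smul_eq_mul, Finset.mul_sum]
  rw [Finset.sum_comm]
  refine Finset.sum_congr rfl fun m _ => ?_
  rw [h1, Finset.sum_mul, Finset.mul_sum]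
  exact Finset.sum_congr rfl fun i _ => by ring

theorem sum_trilin_mul_of_dual (hv : ∀ i, v i = c • ∑ m, b m i • b m)
    (T S : R7 →ₗ[ℝ] R7 →ₗ[ℝ] R7 →ₗ[ℝ] ℝ) :
    ∑ i, ∑ j, ∑ k, T (stdVec i) (stdVec j) (stdVec k) * S (v i) (v j) (v k) =
      c ^ 3 * ∑ i, ∑ j, ∑ k, T (b i) (b j) (b k) * S (b i) (b j) (b k) := by
  have h3 : ∀ i j, ∑ k, T (stdVec i) (stdVec j) (stdVec k) * S (v i) (v j) (v k) =
      c * ∑ k, T (stdVec i) (stdVec j) (b k) * S (v i) (v j) (b k) := fun i j =>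
    sum_mul_of_dual hv (T (stdVec i) (stdVec j)) (S (v i) (v j))
  have h2 : ∀ i k, ∑ j, T (stdVec i) (stdVec j) (b k) * S (v i) (v j) (b k) =
      c * ∑ j, T (stdVec i) (b j) (b k) * S (v i) (b j) (b k) := fun i k =>
    sum_mul_of_dual hv ((T (stdVec i)).flip (b k)) ((S (v i)).flip (b k))
  have h1 : ∀ j k, ∑ i, T (stdVec i) (b j) (b k) * S (v i) (b j) (b k) =
      c * ∑ i, T (b i) (b j) (b k) * S (b i) (b j) (b k) := fun j k =>
    sum_mul_of_dual hv ((T.flip (b j)).flip (b k)) ((S.flip (b j)).flip (b k))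
  calc _ = ∑ i, ∑ k, c * ∑ j, T (stdVec i) (stdVec j) (b k) * S (v i) (v j) (b k) := by
        refine Finset.sum_congr rfl fun i _ => ?_
        simp only [h3, Finset.mul_sum]
        rw [Finset.sum_comm]
    _ = ∑ k, ∑ j, c * (c * ∑ i, T (stdVec i) (b j) (b k) * S (v i) (b j) (b k)) := by
        simp only [h2, Finset.mul_sum]
        rw [Finset.sum_comm]
        refine Finset.sum_congr rfl fun k _ => ?_
        rw [Finset.sum_comm]
    _ = ∑ k, ∑ j, ∑ i, c ^ 3 * (T (b i) (b j) (b k) * S (b i) (b j) (b k)) := by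
        simp only [h1, Finset.mul_sum]
        refine Finset.sum_congr rfl fun k _ => Finset.sum_congr rfl fun j _ =>
          Finset.sum_congr rfl fun i _ => by ring
    _ = _ := by
        simp only [Finset.mul_sum]
        rw [Finset.sum_comm, Finset.sum_congr rfl fun j _ => Finset.sum_comm, Finset.sum_comm]

end Contraction

theorem normSq_eq_sum_dualVec (g : Matrix (Fin 7) (Fin 7) ℝ) (φ : Form 3) :
    normSq g φ = (∑ i, ∑ j, ∑ k, trilin φ (stdVec i) (stdVec j) (stdVec k) *
      trilin φ (dualVec g i) (dualVec g j) (dualVec g k)) / 6 := by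
  rw [normSq]
  congr 1
  refine Finset.sum_congr rfl fun i _ => Finset.sum_congr rfl fun j _ =>
    Finset.sum_congr rfl fun k _ => ?_
  have hd : ∀ (f : R7 →ₗ[ℝ] ℝ) (i : Fin 7), f (dualVec g i) = ∑ a, g⁻¹ i a * f (stdVec a) := by
    intro f i
    simp [dualVec]
  have h1 : trilin φ (dualVec g i) (dualVec g j) (dualVec g k) = ∑ a, g⁻¹ i a *
      ∑ b, g⁻¹ j b * ∑ c, g⁻¹ k c * trilin φ (stdVec a) (stdVec b) (stdVec c) := by
    refine (hd (((trilin φ).flip (dualVec g j)).flip (dualVec g k)) i).trans ?_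
    refine Finset.sum_congr rfl fun a _ => congrArg _ ?_
    refine (hd ((trilin φ (stdVec a)).flip (dualVec g k)) j).trans ?_
    exact Finset.sum_congr rfl fun b _ => congrArg _ (hd (trilin φ (stdVec a) (stdVec b)) k)
  rw [h1, Finset.mul_sum]
  refine Finset.sum_congr rfl fun a _ => ?_
  rw [Finset.mul_sum, Finset.mul_sum]
  refine Finset.sum_congr rfl fun b _ => ?_
  rw [Finset.mul_sum, Finset.mul_sum, Finset.mul_sum]
  refine Finset.sum_congr rfl fun c _ => ?_
  rw [trilin_apply, trilin_apply]
  ring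

theorem starPhi_apply (φ : Form 3) (w : Fin 4 → R7) :
    starPhi φ w = (1 / 6) * ∑ i, ∑ j, ∑ k, trilin φ (stdVec i) (stdVec j) (stdVec k) *
      curryTrilin (volForm (g2Metric φ)) w (dualVec (g2Metric φ) i) (dualVec (g2Metric φ) j)
        (dualVec (g2Metric φ) k) := by
  simp only [starPhi, ContinuousAlternatingMap.smul_apply, ContinuousAlternatingMap.sum_apply,
    smul_eq_mul]
  rfl

/-- The form `*φ₀` dual to `phi0` in the Euclidean metric. -/
def starPhi0 : Form 4 :=
  (1 / 6 : ℝ) • ∑ i, ∑ j, ∑ k, phi0 ![stdVec i, stdVec j, stdVec k] •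
    ((((coordForm id : Form 7).curryLeft (stdVec i)).curryLeft (stdVec j)).curryLeft (stdVec k))

theorem starPhi0_apply (w : Fin 4 → R7) :
    starPhi0 w = (1 / 6) * ∑ i, ∑ j, ∑ k, trilin phi0 (stdVec i) (stdVec j) (stdVec k) *
      curryTrilin (coordForm id) w (stdVec i) (stdVec j) (stdVec k) := by
  simp only [starPhi0, ContinuousAlternatingMap.smul_apply, ContinuousAlternatingMap.sum_apply,
    smul_eq_mul]
  rfl

theorem sum_sq_phi0Coeff : ∑ i, ∑ j, ∑ k, phi0Coeff i j k * phi0Coeff i j k = 42 := by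
  decide +kernel

theorem sum_sq_phi0 : ∑ i, ∑ j, ∑ k, trilin phi0 (stdVec i) (stdVec j) (stdVec k) *
    trilin phi0 (stdVec i) (stdVec j) (stdVec k) = 42 := by
  simp only [trilin_apply, phi0_stdVec]
  exact_mod_cast sum_sq_phi0Coeff

/-- The matrix of a linear map in the standard basis. -/
def stdMatrix (A : R7 →L[ℝ] R7) : Matrix (Fin 7) (Fin 7) ℝ := Matrix.of fun i j => A (stdVec j) i

theorem stdMatrix_eq_toMatrix (A : R7 →L[ℝ] R7) :
    stdMatrix A = LinearMap.toMatrix stdBasis stdBasis (A : R7 →ₗ[ℝ] R7) := by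
  ext i j
  rw [LinearMap.toMatrix_apply, coe_stdBasis]
  simp [stdMatrix, stdBasis]

theorem det_stdMatrix (A : R7 →L[ℝ] R7) : (stdMatrix A).det = A.det := by
  rw [stdMatrix_eq_toMatrix, LinearMap.det_toMatrix]

theorem coordForm_id_comp (A : R7 →L[ℝ] R7) (v : Fin 7 → R7) :
    coordForm id (fun i => A (v i)) = A.det * coordForm id v := by
  have h : ∀ v : Fin 7 → R7, coordForm id v = stdBasis.det v := by
    intro v
    rw [coordForm_apply, Basis.det_apply, ← Matrix.det_transpose]
    congr 1
  rw [h, h]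
  exact stdBasis.det_comp (A : R7 →ₗ[ℝ] R7) v

theorem exists_inverse_of_det_pos {A : R7 →L[ℝ] R7} (hA : 0 < A.det) :
    ∃ B : R7 →L[ℝ] R7, (∀ x, A (B x) = x) ∧ ∀ x, B (A x) = x := by
  have hu : IsUnit (LinearMap.det (A : R7 →ₗ[ℝ] R7)) := isUnit_iff_ne_zero.2 hA.ne'
  let e : R7 ≃L[ℝ] R7 := (LinearEquiv.ofIsUnitDet
    (v := stdBasis) (v' := stdBasis) (f := (A : R7 →ₗ[ℝ] R7))
    (by rw [LinearMap.det_toMatrix]; exact hu)).toContinuousLinearEquiv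
  exact ⟨e.symm, fun x => e.apply_symm_apply x, fun x => e.symm_apply_apply x⟩

theorem comp_vecCons_three {E F : Type*} {n : ℕ} (f : E → F) (x y z : E) (w : Fin n → E) :
    (fun l => f (Matrix.vecCons x (Matrix.vecCons y (Matrix.vecCons z w)) l)) =
      Matrix.vecCons (f x) (Matrix.vecCons (f y) (Matrix.vecCons (f z) (fun l => f (w l)))) := by
  ext1 l
  exact Fin.cases rfl (fun l => Fin.cases rfl (fun l => Fin.cases rfl (fun l => rfl) l) l) l

theorem curryTrilin_smul_of_comp (V : Form 7) (A : R7 →L[ℝ] R7) (d : ℝ)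
    (hV : ∀ v : Fin 7 → R7, V (fun i => A (v i)) = d * V v) (w : Fin 4 → R7) (x y z : R7) :
    curryTrilin (d • V) w x y z = curryTrilin V (fun l => A (w l)) (A x) (A y) (A z) := by
  have h := hV (Matrix.vecCons x (Matrix.vecCons y (Matrix.vecCons z w)))
  rw [comp_vecCons_three] at h
  exact h.symm

theorem compForm_apply {k : ℕ} (φ : Form k) (A : R7 →L[ℝ] R7) (w : Fin k → R7) :
    φ.compContinuousLinearMap A w = φ (fun l => A (w l)) := rfl

section Gram

variable {A B : R7 →L[ℝ] R7}

theorem inv_smul_gram (hAB : ∀ x, A (B x) = x) {c : ℝ} (hc : c ≠ 0) (i a : Fin 7) :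
    (c • ((stdMatrix A).transpose * stdMatrix A))⁻¹ i a =
      c⁻¹ * ∑ m, B (stdVec m) i * B (stdVec m) a := by
  have h1 : stdMatrix A * stdMatrix B = 1 := by
    rw [stdMatrix_eq_toMatrix, stdMatrix_eq_toMatrix, ← LinearMap.toMatrix_comp]
    have : (A : R7 →ₗ[ℝ] R7) ∘ₗ (B : R7 →ₗ[ℝ] R7) = LinearMap.id := by
      ext1 x; exact hAB x
    rw [this, LinearMap.toMatrix_id]
  have h2 := mul_eq_one_comm.1 h1
  have h : (c • ((stdMatrix A).transpose * stdMatrix A))⁻¹ =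
      c⁻¹ • (stdMatrix B * (stdMatrix B).transpose) := by
    refine Matrix.inv_eq_right_inv ?_
    rw [Matrix.smul_mul, Matrix.mul_smul, smul_smul, mul_inv_cancel₀ hc, one_smul,
      Matrix.mul_assoc, ← Matrix.mul_assoc (stdMatrix A), h1, Matrix.one_mul,
      ← Matrix.transpose_mul, h2, Matrix.transpose_one]
  rw [h]
  simp [Matrix.mul_apply, stdMatrix]

theorem dualVec_smul_gram (hAB : ∀ x, A (B x) = x) {c : ℝ} (hc : c ≠ 0) (i : Fin 7) :
    dualVec (c • ((stdMatrix A).transpose * stdMatrix A)) i =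
      c⁻¹ • ∑ m, B (stdVec m) i • B (stdVec m) := by
  simp only [dualVec, inv_smul_gram hAB hc]
  have : ∀ m, B (stdVec m) = ∑ a, B (stdVec m) a • stdVec a := fun m => (sum_smul_stdVec _).symm
  conv_rhs =>
    enter [2, 2, m, 2]
    rw [this]
  simp only [Finset.smul_sum, smul_smul, Finset.mul_sum, Finset.sum_smul]
  rw [Finset.sum_comm]

theorem trilin_comp (φ : Form 3) (x y z : R7) :
    trilin (φ.compContinuousLinearMap A) x y z = trilin φ (A x) (A y) (A z) := by
  simp only [trilin_apply, comp_fin3]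

/-- In the frame `B e_m`, orthonormal for `Aᵀ A`, the form has the coefficients of `phi0`: seven
monomials, each counted in `6` orders, give the sum of squares `42`. -/
theorem normSq_smul_gram (hAB : ∀ x, A (B x) = x) {c : ℝ} (hc : c ≠ 0) :
    normSq (c • ((stdMatrix A).transpose * stdMatrix A)) (phi0.compContinuousLinearMap A) =
      7 * c⁻¹ ^ 3 := by
  rw [normSq_eq_sum_dualVec, sum_trilin_mul_of_dual (dualVec_smul_gram hAB hc)]
  simp only [trilin_comp, hAB, sum_sq_phi0]
  ring

theorem inner_eq_sum (u v : R7) : inner ℝ u v = ∑ k, u k * v k := by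
  rw [PiLp.inner_apply]
  exact Finset.sum_congr rfl fun k _ => by simp [mul_comm]

theorem conformalMatrix_comp_phi0 :
    conformalMatrix (phi0.compContinuousLinearMap A) =
      (6 * A.det) • ((stdMatrix A).transpose * stdMatrix A) := by
  ext i j
  simp only [conformalMatrix, Matrix.of_apply, conformalForm_comp, conformalForm_phi0,
    inner_eq_sum, Matrix.smul_apply, Matrix.mul_apply, Matrix.transpose_apply, stdMatrix,
    smul_eq_mul]
  ring

theorem g2Metric_comp_phi0 (hAB : ∀ x, A (B x) = x) (hA : 0 < A.det) :
    g2Metric (phi0.compContinuousLinearMap A) = (stdMatrix A).transpose * stdMatrix A := by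
  have hc : 0 < 6 * A.det := by positivity
  rw [g2Metric, conformalMatrix_comp_phi0, normSq_smul_gram hAB hc.ne', smul_smul]
  -- The squared norm scales by the inverse cube of the metric, so the cube root removes exactly the
  -- factor `6 det A` of the conformal matrix.
  have : (7 * (6 * A.det)⁻¹ ^ 3 / 7) ^ (1 / 3 : ℝ) = (6 * A.det)⁻¹ := by
    rw [mul_div_cancel_left₀ _ (by norm_num : (7 : ℝ) ≠ 0), ← Real.rpow_natCast,
      ← Real.rpow_mul (by positivity)]
    norm_num
  rw [this, inv_mul_cancel₀ hc.ne', one_smul]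

theorem volForm_gram (hA : 0 < A.det) :
    volForm ((stdMatrix A).transpose * stdMatrix A) = A.det • coordForm id := by
  rw [volForm, Matrix.det_mul, Matrix.det_transpose, det_stdMatrix, Real.sqrt_mul_self hA.le]

theorem starPhi_comp_phi0_apply {g : Matrix (Fin 7) (Fin 7) ℝ} {V : Form 7}
    (hg : g2Metric (phi0.compContinuousLinearMap A) = g) (hV : volForm g = A.det • V)
    (hVA : ∀ v : Fin 7 → R7, V (fun i => A (v i)) = A.det * V v)
    (hAB : ∀ x, A (B x) = x) (hd : ∀ i, dualVec g i = (1 : ℝ) • ∑ m, B (stdVec m) i • B (stdVec m))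
    (w : Fin 4 → R7) :
    starPhi (phi0.compContinuousLinearMap A) w =
      (1 / 6) * ∑ i, ∑ j, ∑ k, trilin phi0 (stdVec i) (stdVec j) (stdVec k) *
        curryTrilin V (fun l => A (w l)) (stdVec i) (stdVec j) (stdVec k) := by
  rw [starPhi_apply, hg, hV, sum_trilin_mul_of_dual hd, one_pow, one_mul]
  simp only [trilin_comp, curryTrilin_smul_of_comp V A _ hVA, hAB]

/-- The metric `Aᵀ A` and the volume form `det A · dx` are themselves pulled back by `A`, hence the
Hodge star commutes with the pull-back. -/
theorem starPhi_comp_phi0 (hA : 0 < A.det) :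
    starPhi (phi0.compContinuousLinearMap A) = starPhi0.compContinuousLinearMap A := by
  obtain ⟨B, hAB, -⟩ := exists_inverse_of_det_pos hA
  have h := dualVec_smul_gram hAB one_ne_zero
  simp only [one_smul, inv_one] at h
  ext w
  rw [starPhi_comp_phi0_apply (g2Metric_comp_phi0 hAB hA) (volForm_gram hA)
    (coordForm_id_comp A) hAB (by simpa only [one_smul] using h) w, compForm_apply,
    starPhi0_apply]

end Gram

/-! ### Pull-backs of constant forms -/

theorem uniqueDiffOn_B7 : UniqueDiffOn ℝ B7 :=
  uniqueDiffOn_convex (convex_closedBall _ _)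
    (by rw [interior_closedBall _ one_ne_zero]; exact ⟨0, mem_ball_self one_pos⟩)

theorem mem_closure_interior_B7 {x : R7} (hx : x ∈ B7) : x ∈ closure (interior B7) := by
  rw [interior_closedBall _ one_ne_zero, closure_ball _ one_ne_zero]
  exact hx

section Evaluation

variable {k : ℕ}

/-- The coefficients of a form. -/
def formCoeffs (k : ℕ) : Form k →ₗ[ℝ] ((Fin k → Fin 7) → ℝ) where
  toFun φ I := φ fun j => stdVec (I j)
  map_add' _ _ := rfl
  map_smul' _ _ := rfl

theorem formCoeffs_injective (k : ℕ) : Function.Injective (formCoeffs k) := by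
  intro φ ψ h
  apply ContinuousAlternatingMap.toContinuousMultilinearMap_injective
  apply ContinuousMultilinearMap.toMultilinearMap_injective
  refine Basis.ext_multilinear (fun _ => stdBasis) fun I => ?_
  rw [coe_stdBasis]
  exact congrFun h I

/-- Reconstruction of a form from its coefficients. -/
theorem exists_formCoeffs_leftInverse (k : ℕ) :
    ∃ g : ((Fin k → Fin 7) → ℝ) →L[ℝ] Form k, ∀ φ, g (formCoeffs k φ) = φ := by
  obtain ⟨g, hg⟩ := (formCoeffs k).exists_leftInverse_of_injective
    (LinearMap.ker_eq_bot.2 (formCoeffs_injective k))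
  exact ⟨LinearMap.toContinuousLinearMap g, fun φ => LinearMap.congr_fun hg φ⟩

theorem contDiffOn_form {f : R7 → Form k} {s : Set R7} {n : ℕ∞ω}
    (h : ∀ I : Fin k → Fin 7, ContDiffOn ℝ n (fun x => f x fun j => stdVec (I j)) s) :
    ContDiffOn ℝ n f s := by
  obtain ⟨g, hg⟩ := exists_formCoeffs_leftInverse k
  have h1 : ContDiffOn ℝ n (fun x => formCoeffs k (f x)) s := contDiffOn_pi.2 h
  refine (g.contDiff.comp_contDiffOn h1).congr fun x _ => ?_
  exact (hg (f x)).symm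

theorem continuous_form {X : Type*} [TopologicalSpace X] {f : X → Form k}
    (h : ∀ I : Fin k → Fin 7, Continuous fun x => f x fun j => stdVec (I j)) :
    Continuous f := by
  obtain ⟨g, hg⟩ := exists_formCoeffs_leftInverse k
  have h1 : Continuous (fun x => formCoeffs k (f x)) := continuous_pi h
  refine (g.continuous.comp h1).congr fun x => ?_
  exact hg (f x)

end Evaluation

section Pullback

variable {E : Type*} [NormedAddCommGroup E] [NormedSpace ℝ E] {k : ℕ}

/-- The pull-back of a constant form on `E` to the closed ball. -/
def pullback (C : E [⋀^Fin k]→L[ℝ] ℝ) (H : R7 → E) (x : R7) : Form k :=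
  C.compContinuousLinearMap (fderivWithin ℝ H B7 x)

theorem contDiffOn_pullback (C : E [⋀^Fin k]→L[ℝ] ℝ) {H : R7 → E} (hH : ContDiffOn ℝ ∞ H B7) :
    ContDiffOn ℝ ∞ (pullback C H) B7 := by
  refine contDiffOn_form fun I => ?_
  have h1 : ContDiffOn ℝ ∞ (fderivWithin ℝ H B7) B7 :=
    hH.fderivWithin uniqueDiffOn_B7 (by simp)
  have h2 : ContDiffOn ℝ ∞ (fun x => fun j => fderivWithin ℝ H B7 x (stdVec (I j))) B7 :=
    contDiffOn_pi.2 fun j => h1.clm_apply contDiffOn_const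
  exact C.toContinuousMultilinearMap.contDiff.comp_contDiffOn h2

/-- The exterior derivative commutes with pull-back, and a constant form is closed. -/
theorem extDerivWithin_pullback_const (C : E [⋀^Fin k]→L[ℝ] ℝ) {H : R7 → E}
    (hH : ContDiffOn ℝ ∞ H B7) {x : R7} (hx : x ∈ B7) :
    extDerivWithin (pullback C H) B7 x = 0 := by
  have h := extDerivWithin_pullback (f := H) (s := B7) (t := univ) (x := x) (r := ∞)
    (differentiableWithinAt_const C) (hH x hx) (by simpa using! ENat.LEInfty.out) uniqueDiffOn_B7
    (mem_closure_interior_B7 hx) hx (mapsTo_univ _ _)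
  refine h.trans ?_
  have h0 : extDerivWithin (fun _ : E => C) univ (H x) = 0 := by
    rw [extDerivWithin, fderivWithin_fun_const]
    exact map_zero (ContinuousAlternatingMap.alternatizeUncurryFinCLM ℝ E ℝ)
  rw [h0]
  rfl

theorem fact_finrank : Fact (finrank ℝ (EuclideanSpace ℝ (Fin (6 + 1))) = 6 + 1) :=
  ⟨finrank_euclideanSpace_fin⟩

theorem mvfderiv_comp_coe_sphere {H : R7 → E} (hH : ContDiffOn ℝ ∞ H B7) {h : S6 → E}
    (hh : ∀ x : S6, H x = h x) (x : S6) :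
    mvfderiv (𝓡 6) h x =
      (fderivWithin ℝ H B7 x).comp (mvfderiv (𝓡 6) (Subtype.val : S6 → R7) x) := by
  have hx : ∀ x : S6, (x : R7) ∈ B7 := fun x => sphere_subset_closedBall x.2
  have e : h = H ∘ (Subtype.val : S6 → R7) := funext fun x => (hh x).symm
  have := fact_finrank
  have h1 : MDifferentiableWithinAt 𝓘(ℝ, R7) 𝓘(ℝ, E) H B7 (x : R7) :=
    ((hH x (hx x)).differentiableWithinAt (by simp)).mdifferentiableWithinAt
  have h2 : MDifferentiableWithinAt (𝓡 6) 𝓘(ℝ, R7) (Subtype.val : S6 → R7) univ x :=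
    ((contMDiff_coe_sphere (E := EuclideanSpace ℝ (Fin (6 + 1))) (m := ∞) (n := 6)
      x).mdifferentiableAt (by simp)).mdifferentiableWithinAt
  have h3 := mfderivWithin_comp x h1 h2 (fun y _ => hx y) (uniqueMDiffWithinAt_univ _)
  rw [mfderivWithin_univ, mfderivWithin_univ, ← e, mfderivWithin_eq_fderivWithin] at h3
  rw [mvfderiv, h3]
  rfl

theorem isBoundaryValue_pullback_phi0 {F : R7 → R7} (hF : ContDiffOn ℝ ∞ F B7) {i : S6 → R7}
    (hi : ∀ x : S6, F x = i x) : IsBoundaryValue (boundaryForm i) (flatPullback F) := by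
  intro x
  rw [boundaryForm, mvfderiv_comp_coe_sphere hF hi]
  rfl

end Pullback

theorem isTorsionFreeG2_flatPullback {F : R7 → R7} {U : Set R7} (hF : IsBallDiffeo F U) :
    IsTorsionFreeG2 (flatPullback F) where
  smooth := contDiffOn_pullback phi0 hF.smooth
  positive x hx := isPositive_comp isPositive_phi0 (hF.orientation x hx)
  closed x hx := extDerivWithin_pullback_const phi0 hF.smooth hx
  coclosed x hx := by
    have h : EqOn (fun y => starPhi (flatPullback F y)) (pullback starPhi0 F) B7 := fun y hy =>
      starPhi_comp_phi0 (hF.orientation y hy)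
    rw [extDerivWithin_congr' h hx]
    exact extDerivWithin_pullback_const starPhi0 hF.smooth hx

/-! ### The boundary of the domains of a pinching family near the origin -/

theorem injOn_of_isBallDiffeo {F : R7 → R7} {U : Set R7} (hF : IsBallDiffeo F U) :
    InjOn F B7 := by
  obtain ⟨G, -, hG⟩ := hF.smooth_inverse
  exact hG.injOn

theorem image_sphere_of_isBallDiffeo {F : R7 → R7} {U : Set R7} (hF : IsBallDiffeo F U) :
    F '' sphere 0 1 = closure U \ U := by
  rw [← hF.image_closedBall, ← hF.image_ball,
    ← (injOn_of_isBallDiffeo hF).image_sdiff_subset ball_subset_closedBall, closedBall_sdiff_ball]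

theorem continuous_tCoord : Continuous tCoord := by
  unfold tCoord; fun_prop

theorem continuous_zNormSq : Continuous zNormSq := by
  unfold zNormSq; fun_prop

theorem zNormSq_nonneg (x : R7) : 0 ≤ zNormSq x := Finset.sum_nonneg fun _ _ => sq_nonneg _

/-- The unit vector in the direction of `t`. -/
def tVec : R7 := stdVec (Fin.last 6)

theorem tCoord_add_smul_tVec (x : R7) (c : ℝ) : tCoord (x + c • tVec) = tCoord x + c := by
  simp [tCoord, tVec, stdVec]

theorem zNormSq_add_smul_tVec (x : R7) (c : ℝ) : zNormSq (x + c • tVec) = zNormSq x := by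
  simp only [zNormSq, tVec, stdVec]
  refine Finset.sum_congr rfl fun i _ => ?_
  have : Fin.castSucc i ≠ 6 := (Fin.castSucc_lt_last i).ne
  simp [this]

theorem tCoord_smul_tVec (c : ℝ) : tCoord (c • tVec) = c := by
  simp [tCoord, tVec, stdVec]

theorem zNormSq_smul_tVec (c : ℝ) : zNormSq (c • tVec) = 0 := by
  have := zNormSq_add_smul_tVec 0 c
  rw [zero_add] at this
  rw [this]
  simp [zNormSq]

theorem norm_tVec : ‖tVec‖ = 1 := by simp [tVec, stdVec]

theorem norm_sq_eq (x : R7) : ‖x‖ ^ 2 = zNormSq x + tCoord x ^ 2 := by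
  rw [EuclideanSpace.norm_sq_eq, Fin.sum_univ_castSucc]
  simp [zNormSq, tCoord]

/-- The description of `U` near the origin in a pinching family. -/
def IsSlabNear (r l : ℝ) (U : Set R7) : Prop :=
  ∀ x ∈ ball (0 : R7) r, x ∈ U ↔ 0 < tCoord x ∧ tCoord x < zNormSq x + l

section Slab

variable {r l : ℝ} {U : Set R7}

theorem IsSlabNear.of_mem_closure (h : IsSlabNear r l U) {x : R7} (hx : ‖x‖ < r)
    (hxU : x ∈ closure U) : 0 ≤ tCoord x ∧ tCoord x ≤ zNormSq x + l := by
  have hx' : x ∈ ball (0 : R7) r := by simpa using hx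
  have h1 : x ∈ closure (ball (0 : R7) r ∩ U) := isOpen_ball.inter_closure ⟨hx', hxU⟩
  have hc : IsClosed {y : R7 | 0 ≤ tCoord y ∧ tCoord y ≤ zNormSq y + l} :=
    (isClosed_le continuous_const continuous_tCoord).inter
      (isClosed_le continuous_tCoord (continuous_zNormSq.add continuous_const))
  refine closure_minimal ?_ hc h1
  rintro y ⟨hy, hyU⟩
  exact ⟨((h y hy).1 hyU).1.le, ((h y hy).1 hyU).2.le⟩

theorem IsSlabNear.of_mem_closure_diff (h : IsSlabNear r l U) {x : R7} (hx : ‖x‖ < r)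
    (hxU : x ∈ closure U \ U) : tCoord x = 0 ∨ tCoord x = zNormSq x + l := by
  have h1 := h.of_mem_closure hx hxU.1
  by_contra hne
  rw [not_or] at hne
  exact hxU.2 ((h x (by simpa using hx)).2
    ⟨lt_of_le_of_ne h1.1 (Ne.symm hne.1), lt_of_le_of_ne h1.2 hne.2⟩)

theorem IsSlabNear.mem_closure (h : IsSlabNear r l U) (hl : 0 < l) {x : R7} (hx : ‖x‖ < r)
    (h1 : 0 ≤ tCoord x) (h2 : tCoord x ≤ zNormSq x + l) : x ∈ closure U := by
  have hz := zNormSq_nonneg x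
  set m := (zNormSq x + l) / 2 with hm
  have hm0 : 0 < m := by positivity
  -- The point is moved vertically towards the middle `m` of the slab; every position strictly on
  -- the way is inside.
  let f : ℝ → R7 := fun c => x + (c * (m - tCoord x)) • tVec
  have hf : Continuous f := by fun_prop
  have hf0 : f 0 = x := by simp [f]
  have ht : Tendsto f (𝓝[>] 0) (𝓝 x) := by
    have := hf.tendsto 0
    rw [hf0] at this
    exact this.mono_left nhdsWithin_le_nhds
  refine mem_closure_of_tendsto ht ?_
  have hb : ∀ᶠ c in 𝓝[>] (0 : ℝ), f c ∈ ball (0 : R7) r :=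
    ht.eventually (isOpen_ball.mem_nhds (by simpa using hx))
  have hc1 : ∀ᶠ c in 𝓝[>] (0 : ℝ), c < 1 :=
    (tendsto_id.mono_left nhdsWithin_le_nhds).eventually (gt_mem_nhds one_pos)
  filter_upwards [hb, hc1, self_mem_nhdsWithin] with c hc hc1 hc0
  have hc0 : 0 < c := hc0
  rw [h _ hc]
  simp only [f, tCoord_add_smul_tVec, zNormSq_add_smul_tVec]
  constructor
  · nlinarith
  · nlinarith

theorem IsSlabNear.mem_closure_diff (h : IsSlabNear r l U) (hl : 0 < l) {x : R7} (hx : ‖x‖ < r)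
    (h1 : tCoord x = 0 ∨ tCoord x = zNormSq x + l) : x ∈ closure U \ U := by
  have hz := zNormSq_nonneg x
  refine ⟨h.mem_closure hl hx ?_ ?_, fun hU => ?_⟩
  · rcases h1 with h1 | h1 <;> rw [h1]; positivity
  · rcases h1 with h1 | h1 <;> rw [h1]; positivity
  · have := (h x (by simpa using hx)).1 hU
    rcases h1 with h1 | h1 <;> linarith

end Slab

theorem radialExt_sphere (f : S6 → R7) (x : S6) : radialExt f x = f x := by
  have hx : ‖(x : R7)‖ = 1 := by simp
  have h0 : (x : R7) ≠ 0 := by rw [← norm_ne_zero_iff, hx]; exact one_ne_zero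
  rw [radialExt, dif_pos h0]
  congr 1
  ext1
  simp [hx]

theorem TendstoSmoothly.eventually_dist_lt {f : ℝ → S6 → R7} {g : S6 → R7}
    (h : TendstoSmoothly f g) {e : ℝ} (he : 0 < e) :
    ∀ᶠ l in 𝓝[>] (0 : ℝ), ∀ x : S6, dist (f l x) (g x) < e := by
  filter_upwards [Metric.tendstoUniformlyOn_iff.1 (h 0) e he] with l hl x
  have := hl x x.2
  simp only [iteratedFDeriv_zero_eq_comp, Function.comp_apply] at this
  rw [LinearIsometryEquiv.dist_map, radialExt_sphere, radialExt_sphere, dist_comm] at this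
  exact this

namespace IsPinchingFamily

variable {Λ : ℝ} {Ω : ℝ → Set R7} {ι : ℝ → S6 → R7}

theorem image_eq (h : IsPinchingFamily Λ Ω ι) {l : ℝ} (hl : l ∈ Ioo 0 Λ) :
    range (ι l) = closure (Ω l) \ Ω l := by
  obtain ⟨F, hF, hFi⟩ := h.boundary l hl
  rw [← image_sphere_of_isBallDiffeo hF]
  ext y
  constructor
  · rintro ⟨x, rfl⟩
    exact ⟨x, x.2, hFi x⟩
  · rintro ⟨x, hx, rfl⟩
    exact ⟨⟨x, hx⟩, (hFi ⟨x, hx⟩).symm⟩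

theorem continuous (h : IsPinchingFamily Λ Ω ι) {l : ℝ} (hl : l ∈ Ioo 0 Λ) :
    Continuous (ι l) := by
  obtain ⟨F, hF, hFi⟩ := h.boundary l hl
  have : ι l = F ∘ Subtype.val := funext fun x => (hFi x).symm
  rw [this]
  exact hF.smooth.continuousOn.comp_continuous continuous_subtype_val
    fun x => sphere_subset_closedBall x.2

theorem continuous_limit (h : IsPinchingFamily Λ Ω ι) : Continuous (ι 0) :=
  h.limit_smooth.continuous

theorem eventually_mem (h : IsPinchingFamily Λ Ω ι) : ∀ᶠ l in 𝓝[>] (0 : ℝ), l ∈ Ioo 0 Λ :=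
  Ioo_mem_nhdsGT h.pos

/-- The surface `t = (|z|² + l) / 2` separates the two sheets when `l > 0`, so a connected set
cannot meet both. The neighbourhood serves all small `l`; at this stage the sheet may still depend
on `l`. -/
theorem exists_sheet (h : IsPinchingFamily Λ Ω ι) {p : S6} (hp : ι 0 p = 0) :
    ∃ W ∈ 𝓝 p, ∀ᶠ l in 𝓝[>] (0 : ℝ), (∀ x ∈ W, tCoord (ι l x) = 0) ∨
      ∀ x ∈ W, tCoord (ι l x) = zNormSq (ι l x) + l := by
  obtain ⟨r, hr, hslab⟩ := h.near_origin
  have : LocallyConnectedSpace S6 :=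
    ChartedSpace.locallyConnectedSpace (EuclideanSpace ℝ (Fin 6)) S6
  have hV : {x : S6 | ‖ι 0 x‖ < r / 2} ∈ 𝓝 p :=
    (isOpen_lt h.continuous_limit.norm continuous_const).mem_nhds (by
      simp only [mem_ofPred_eq, hp, norm_zero]; positivity)
  obtain ⟨W, ⟨hWo, hWp, hWc⟩, hWV⟩ := (LocallyConnectedSpace.open_connected_basis p).mem_iff.1 hV
  refine ⟨W, hWo.mem_nhds hWp, ?_⟩
  filter_upwards [h.tendsto.eventually_dist_lt (half_pos hr), h.eventually_mem] with l hl hlm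
  have hd : ∀ x ∈ W, tCoord (ι l x) = 0 ∨ tCoord (ι l x) = zNormSq (ι l x) + l := by
    intro x hx
    have h1 : ‖ι l x‖ < r := by
      have h2 := hl x
      have h3 : ‖ι 0 x‖ < r / 2 := hWV hx
      have h4 := norm_le_norm_add_norm_sub' (ι l x) (ι 0 x)
      rw [dist_eq_norm] at h2
      linarith
    refine IsSlabNear.of_mem_closure_diff (hslab l hlm) h1 ?_
    rw [← h.image_eq hlm]
    exact mem_range_self x
  have hct := continuous_tCoord.comp (h.continuous hlm)
  have hcz := ((continuous_zNormSq.comp (h.continuous hlm)).add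
    (continuous_const (y := l))).div_const 2
  have hpos : ∀ x, 0 < zNormSq (ι l x) + l := fun x =>
    add_pos_of_nonneg_of_pos (zNormSq_nonneg _) hlm.1
  have hU := isOpen_lt hct hcz
  have hV := isOpen_lt hcz hct
  rcases hWc.isPreconnected.subset_or_subset hU hV
    (disjoint_left.2 fun x h1 h2 =>
      lt_asymm (show tCoord (ι l x) < (zNormSq (ι l x) + l) / 2 from h1) h2) (fun x hx => by
      have h0 := hpos x
      rcases hd x hx with h1 | h1
      · left
        change tCoord (ι l x) < (zNormSq (ι l x) + l) / 2
        rw [h1]; linarith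
      · right
        change (zNormSq (ι l x) + l) / 2 < tCoord (ι l x)
        rw [h1]; linarith) with h1 | h1
  · refine Or.inl fun x hx => (hd x hx).resolve_right fun h2 => ?_
    have h3 : tCoord (ι l x) < (zNormSq (ι l x) + l) / 2 := h1 hx
    have := hpos x
    linarith
  · refine Or.inr fun x hx => (hd x hx).resolve_left fun h2 => ?_
    have h3 : (zNormSq (ι l x) + l) / 2 < tCoord (ι l x) := h1 hx
    have := hpos x
    linarith

theorem tendsto_limit_apply (h : IsPinchingFamily Λ Ω ι) {s : ℕ → ℝ}
    (hs : Tendsto s atTop (𝓝[>] 0)) {x : ℕ → S6} {p : S6} (hx : Tendsto x atTop (𝓝 p)) :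
    Tendsto (fun n => ι (s n) (x n)) atTop (𝓝 (ι 0 p)) := by
  have h1 : Tendsto (fun n => ι 0 (x n)) atTop (𝓝 (ι 0 p)) :=
    (h.continuous_limit.tendsto p).comp hx
  refine tendsto_of_tendsto_of_dist h1 ?_
  rw [Metric.tendsto_atTop]
  intro e he
  obtain ⟨N, hN⟩ := eventually_atTop.1 (hs.eventually (h.tendsto.eventually_dist_lt he))
  refine ⟨N, fun n hn => ?_⟩
  rw [Real.dist_0_eq_abs, abs_of_nonneg dist_nonneg, dist_comm]
  exact hN n hn _

/-- If the limits agreed, both sequences would enter one neighbourhood lying on a single sheet. But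
`l ∂_t` is not on the lower sheet and `0` is not on the upper one. -/
theorem ne_of_tendsto (h : IsPinchingFamily Λ Ω ι) {s : ℕ → ℝ}
    (hs : Tendsto s atTop (𝓝[>] 0)) {x y : ℕ → S6} {p q : S6} (hx : Tendsto x atTop (𝓝 p))
    (hy : Tendsto y atTop (𝓝 q)) (hx0 : ∀ᶠ n in atTop, ι (s n) (x n) = 0)
    (hy0 : ∀ᶠ n in atTop, ι (s n) (y n) = s n • tVec) :
    ι 0 p = 0 ∧ ι 0 q = 0 ∧ p ≠ q := by
  have hp : ι 0 p = 0 := tendsto_nhds_unique (h.tendsto_limit_apply hs hx)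
    (tendsto_const_nhds.congr' (hx0.mono fun n hn => hn.symm))
  have hs0 : Tendsto (fun n => s n • tVec) atTop (𝓝 0) := by
    have := (hs.mono_right nhdsWithin_le_nhds).smul_const tVec
    rwa [zero_smul] at this
  have hq : ι 0 q = 0 := tendsto_nhds_unique (h.tendsto_limit_apply hs hy)
    (hs0.congr' (hy0.mono fun n hn => hn.symm))
  refine ⟨hp, hq, ?_⟩
  rintro rfl
  obtain ⟨W, hW, hl⟩ := h.exists_sheet hp
  obtain ⟨n, hn1, hn2, hn3, hn4, hn5, hn6⟩ := ((hs.eventually hl).and ((hx.eventually hW).and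
    ((hy.eventually hW).and (hx0.and (hy0.and (hs.eventually self_mem_nhdsWithin)))))).exists
  have hpos : 0 < s n := hn6
  rcases hn1 with h1 | h1
  · have := h1 _ hn3
    rw [hn5, tCoord_smul_tVec] at this
    exact hpos.ne' this
  · have := h1 _ hn2
    rw [hn4] at this
    simp [tCoord, zNormSq] at this
    exact hpos.ne this

theorem exists_preimages (h : IsPinchingFamily Λ Ω ι) :
    ∃ L > 0, L ≤ Λ ∧ ∀ l ∈ Ioo 0 L, (∃ x, ι l x = 0) ∧ ∃ y, ι l y = l • tVec := by
  obtain ⟨r, hr, hslab⟩ := h.near_origin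
  refine ⟨min r Λ, lt_min hr h.pos, min_le_right _ _, fun l hl => ?_⟩
  have hlm : l ∈ Ioo 0 Λ := ⟨hl.1, hl.2.trans_le (min_le_right _ _)⟩
  have hlr : l < r := hl.2.trans_le (min_le_left _ _)
  have hs : IsSlabNear r l (Ω l) := hslab l hlm
  constructor
  · have : (0 : R7) ∈ range (ι l) := by
      rw [h.image_eq hlm]
      exact hs.mem_closure_diff hl.1 (by simpa using hr) (Or.inl (by simp [tCoord]))
    exact this
  · have : l • tVec ∈ range (ι l) := by
      rw [h.image_eq hlm]
      refine hs.mem_closure_diff hl.1 ?_ (Or.inr ?_)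
      · rw [norm_smul, norm_tVec, mul_one, Real.norm_of_nonneg hl.1.le]; exact hlr
      · rw [tCoord_smul_tVec, zNormSq_smul_tVec, zero_add]
    exact this

theorem exists_double_point (h : IsPinchingFamily Λ Ω ι) :
    ∃ p q : S6, p ≠ q ∧ ι 0 p = 0 ∧ ι 0 q = 0 := by
  obtain ⟨L, hL, -, hpre⟩ := h.exists_preimages
  obtain ⟨s, -, hs, hs0⟩ := exists_seq_strictAnti_tendsto' hL
  choose x hx using fun n => (hpre (s n) (hs n)).1
  choose y hy using fun n => (hpre (s n) (hs n)).2
  obtain ⟨⟨p, q⟩, f, hf, hfl⟩ := CompactSpace.tendsto_subseq fun n => (x n, y n)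
  have hs' : Tendsto (s ∘ f) atTop (𝓝[>] 0) :=
    tendsto_nhdsWithin_iff.2 ⟨hs0.comp hf.tendsto_atTop, Eventually.of_forall fun n => (hs _).1⟩
  obtain ⟨h1, h2, h3⟩ := h.ne_of_tendsto hs' ((continuous_fst.tendsto _).comp hfl)
    ((continuous_snd.tendsto _).comp hfl) (Eventually.of_forall fun n => hx _)
    (Eventually.of_forall fun n => hy _)
  exact ⟨p, q, h3, h1, h2⟩

end IsPinchingFamily

/-! ### Uniform estimates for positive forms -/

theorem continuous_form_apply {k : ℕ} : Continuous fun p : Form k × (Fin k → R7) => p.1 p.2 := by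
  have h1 : Continuous fun p : Form k × (Fin k → R7) =>
      (p.1.toContinuousMultilinearMap, p.2) :=
    (ContinuousAlternatingMap.toContinuousMultilinearMapCLM (E := R7) (F := ℝ) (ι := Fin k)
      (𝕜 := ℝ) ℝ).continuous.prodMap continuous_id
  exact h1.fst.eval h1.snd

theorem continuous_form_fin3 {X : Type*} [TopologicalSpace X] {φ : X → Form 3} {a b c : X → R7}
    (hφ : Continuous φ) (ha : Continuous a) (hb : Continuous b) (hc : Continuous c) :
    Continuous fun x => φ x ![a x, b x, c x] := by
  refine continuous_form_apply.comp (hφ.prodMk (continuous_pi fun i => ?_))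
  fin_cases i
  · exact ha
  · exact hb
  · exact hc

theorem continuous_conformalForm {X : Type*} [TopologicalSpace X] {φ : X → Form 3} {u v : X → R7}
    (hφ : Continuous φ) (hu : Continuous u) (hv : Continuous v) :
    Continuous fun x => conformalForm (φ x) (u x) (v x) := by
  unfold conformalForm
  refine (continuous_finsetSum _ fun σ _ => continuous_const.mul
    (((continuous_form_fin3 hφ hu continuous_const continuous_const).mul
    (continuous_form_fin3 hφ hv continuous_const continuous_const)).mul
    (continuous_form_fin3 hφ continuous_const continuous_const continuous_const))).div_const _

theorem continuous_det_conformalMatrix : Continuous fun φ : Form 3 => (conformalMatrix φ).det :=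
  Continuous.matrix_det (continuous_matrix fun _ _ =>
    continuous_conformalForm continuous_id continuous_const continuous_const)

/-- A compact set of positive forms has a neighbourhood on which the conformal form is uniformly
positive and the conformal volume is bounded. -/
theorem exists_uniform_positive {K : Set (Form 3)} (hK : IsCompact K)
    (hpos : ∀ φ ∈ K, IsPositive φ) :
    ∃ δ > 0, ∃ c > 0, ∃ D : ℝ, ∀ φ ∈ Metric.thickening δ K,
      (∀ u : R7, c * ‖u‖ ^ 2 ≤ conformalForm φ u u) ∧ (conformalMatrix φ).det ≤ D := by
  have hcont : Continuous fun p : Form 3 × R7 => conformalForm p.1 p.2 p.2 :=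
    continuous_conformalForm continuous_fst continuous_snd continuous_snd
  have hKS : IsCompact (K ×ˢ sphere (0 : R7) 1) := hK.prod (isCompact_sphere 0 1)
  obtain ⟨c, hc, hcK⟩ : ∃ c > 0, ∀ p ∈ K ×ˢ sphere (0 : R7) 1, c < conformalForm p.1 p.2 p.2 := by
    rcases (K ×ˢ sphere (0 : R7) 1).eq_empty_or_nonempty with he | hne
    · exact ⟨1, one_pos, by simp [he]⟩
    obtain ⟨p, hp, hmin⟩ := hKS.exists_isMinOn hne hcont.continuousOn
    have h0 : 0 < conformalForm p.1 p.2 p.2 := hpos _ hp.1 _ (by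
      rw [← norm_ne_zero_iff, mem_sphere_zero_iff_norm.1 hp.2]; exact one_ne_zero)
    exact ⟨_, half_pos h0, fun q hq => (half_lt_self h0).trans_le (hmin hq)⟩
  obtain ⟨D, hD⟩ := (hK.image continuous_det_conformalMatrix).bddAbove
  obtain ⟨δ1, hδ1, h1⟩ := hKS.exists_thickening_subset_open
    (isOpen_lt continuous_const hcont) hcK
  obtain ⟨δ2, hδ2, h2⟩ := hK.exists_thickening_subset_open
    (isOpen_lt continuous_det_conformalMatrix (continuous_const (y := D + 1)))
    (fun φ hφ => (hD (mem_image_of_mem _ hφ)).trans_lt (lt_add_one D))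
  refine ⟨min δ1 δ2, lt_min hδ1 hδ2, c, hc, D + 1, fun φ hφ => ⟨fun u => ?_, ?_⟩⟩
  · rcases eq_or_ne u 0 with rfl | hu
    · have := conformalForm_smul_left φ 0 0 0
      simp only [zero_smul, zero_mul] at this
      simp [this]
    · obtain ⟨φ0, hφ0, hd⟩ := Metric.mem_thickening_iff.1 hφ
      have hun : ‖u‖ ≠ 0 := norm_ne_zero_iff.2 hu
      have hmem : (φ, ‖u‖⁻¹ • u) ∈ Metric.thickening δ1 (K ×ˢ sphere (0 : R7) 1) := by
        refine Metric.mem_thickening_iff.2 ⟨(φ0, ‖u‖⁻¹ • u), ⟨hφ0, ?_⟩, ?_⟩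
        · simp [norm_smul, hun]
        · rw [Prod.dist_eq, dist_self, max_eq_left dist_nonneg]
          exact hd.trans_le (min_le_left _ _)
      have h3 : c < conformalForm φ (‖u‖⁻¹ • u) (‖u‖⁻¹ • u) := h1 hmem
      rw [conformalForm_smul_left, conformalForm_smul_right] at h3
      have h4 : 0 < ‖u‖ ^ 2 := by positivity
      have h5 := mul_lt_mul_of_pos_right h3 h4
      have h6 : ‖u‖⁻¹ * (‖u‖⁻¹ * conformalForm φ u u) * ‖u‖ ^ 2 = conformalForm φ u u := by
        field_simp
      rw [h6] at h5
      exact h5.le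
  · exact (h2 (Metric.thickening_mono (min_le_right _ _) _ hφ)).le

/-! ### Uniform expansion and the absence of a limit -/

theorem norm_le_of_conformalForm_bound {A : R7 →L[ℝ] R7} (hA : 0 < A.det) {c D : ℝ} (hc : 0 < c)
    (h1 : ∀ u : R7, c * ‖u‖ ^ 2 ≤ conformalForm (phi0.compContinuousLinearMap A) u u)
    (h2 : (conformalMatrix (phi0.compContinuousLinearMap A)).det ≤ D) (u : R7) :
    ‖u‖ ≤ √(6 * max 1 D / c) * ‖A u‖ := by
  -- The conformal matrix is `6 det A · Aᵀ A`, of determinant `(6 det A)⁷ (det A)²`. An upper bound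
  -- for it bounds `det A`, after which the lower bound on `6 det A |A u|²` becomes one on `|A u|`.
  have hdet : (conformalMatrix (phi0.compContinuousLinearMap A)).det = 6 ^ 7 * A.det ^ 9 := by
    rw [conformalMatrix_comp_phi0, Matrix.det_smul, Matrix.det_mul, Matrix.det_transpose,
      det_stdMatrix]
    simp only [Fintype.card_fin]
    ring
  have hM : A.det ≤ max 1 D := by
    rcases le_total A.det 1 with h | h
    · exact h.trans (le_max_left _ _)
    · refine le_trans ?_ (le_max_right _ _)
      rw [hdet] at h2
      have h3 : A.det ≤ A.det ^ 9 := le_self_pow₀ h (by norm_num)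
      nlinarith
  have h3 := h1 u
  rw [conformalForm_comp, conformalForm_phi0, real_inner_self_eq_norm_sq] at h3
  have hM0 : 0 < max 1 D := lt_max_of_lt_left one_pos
  rw [← Real.sqrt_sq (norm_nonneg (A u)), ← Real.sqrt_mul (by positivity)]
  refine Real.le_sqrt_of_sq_le ?_
  rw [div_mul_eq_mul_div, le_div_iff₀ hc]
  have h4 : A.det * ‖A u‖ ^ 2 ≤ max 1 D * ‖A u‖ ^ 2 :=
    mul_le_mul_of_nonneg_right hM (sq_nonneg _)
  linarith

/-- The segment is lifted by the inverse `G`. Since `F ∘ G` is the identity on it, the lifted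
velocity is sent by the differential of `F` to a unit vector, so its length is at most `C`. -/
theorem dist_le_of_segment {F : R7 → R7} {U : Set R7} (hF : IsBallDiffeo F U) {C : ℝ}
    (hC : ∀ x ∈ B7, ∀ u, ‖u‖ ≤ C * ‖fderivWithin ℝ F B7 x u‖) {l : ℝ} (hl : 0 < l)
    (hseg : ∀ s ∈ Icc 0 l, s • tVec ∈ closure U) {x y : R7} (hx : x ∈ B7) (hy : y ∈ B7)
    (hFx : F x = 0) (hFy : F y = l • tVec) : dist x y ≤ C * l := by
  obtain ⟨G, hG, hGF⟩ := hF.smooth_inverse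
  have hGm : ∀ w ∈ closure U, G w ∈ B7 ∧ F (G w) = w := by
    intro w hw
    rw [← hF.image_closedBall] at hw
    obtain ⟨b, hb, rfl⟩ := hw
    rw [hGF hb]
    exact ⟨hb, rfl⟩
  have hγ : ∀ s ∈ Icc 0 l, DifferentiableWithinAt ℝ (fun s : ℝ => G (s • tVec)) (Icc 0 l) s := by
    intro s hs
    have h1 : DifferentiableWithinAt ℝ G (closure U) (s • tVec) :=
      (hG _ (hseg s hs)).differentiableWithinAt (by simp)
    have h2 : DifferentiableWithinAt ℝ (fun s : ℝ => s • tVec) (Icc 0 l) s :=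
      (differentiable_id.smul_const tVec).differentiableAt.differentiableWithinAt
    exact h1.comp s h2 hseg
  have hu : UniqueDiffOn ℝ (Icc 0 l) := uniqueDiffOn_Icc hl
  have hb : ∀ s ∈ Icc 0 l, ‖derivWithin (fun s : ℝ => G (s • tVec)) (Icc 0 l) s‖ ≤ C := by
    intro s hs
    have h1 := (hγ s hs).hasDerivWithinAt
    have h2 : HasFDerivWithinAt F (fderivWithin ℝ F B7 (G (s • tVec))) B7 (G (s • tVec)) :=
      ((hF.smooth _ (hGm _ (hseg s hs)).1).differentiableWithinAt (by simp)).hasFDerivWithinAt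
    have h3 := h2.comp_hasDerivWithinAt s h1 fun s hs => (hGm _ (hseg s hs)).1
    have h4 : HasDerivWithinAt (fun s : ℝ => s • tVec) ((1 : ℝ) • tVec) (Icc 0 l) s :=
      ((hasDerivAt_id s).smul_const tVec).hasDerivWithinAt
    have h5 : HasDerivWithinAt (fun s : ℝ => s • tVec) (fderivWithin ℝ F B7 (G (s • tVec))
        (derivWithin (fun s : ℝ => G (s • tVec)) (Icc 0 l) s)) (Icc 0 l) s :=
      h3.congr (fun s hs => ((hGm _ (hseg s hs)).2).symm) ((hGm _ (hseg s hs)).2).symm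
    have h6 := (hu s hs).eq_deriv _ h5 h4
    have h7 := hC _ (hGm _ (hseg s hs)).1
      (derivWithin (fun s : ℝ => G (s • tVec)) (Icc 0 l) s)
    rwa [h6, one_smul, norm_tVec, mul_one] at h7
  have h := norm_image_sub_le_of_norm_deriv_le_segment'
    (fun s hs => (hγ s hs).hasDerivWithinAt) (fun s hs => hb s (Ico_subset_Icc_self hs)) l
    (right_mem_Icc.2 hl.le)
  have h0 : G ((0 : ℝ) • tVec) = x := by rw [zero_smul, ← hFx, hGF hx]
  have h1 : G (l • tVec) = y := by rw [← hFy, hGF hy]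
  simp only [h0, h1, sub_zero] at h
  rwa [dist_comm, dist_eq_norm]

theorem IsPinchingFamily.not_exists_limit {Λ : ℝ} {Ω : ℝ → Set R7} {ι : ℝ → S6 → R7}
    (h : IsPinchingFamily Λ Ω ι) {s : ℕ → ℝ} {F : ℕ → R7 → R7} (hs : ∀ n, s n ∈ Ioo 0 Λ)
    (hs0 : Tendsto s atTop (𝓝 0))
    (hF : ∀ n, IsBallDiffeo (F n) (Ω (s n)) ∧ ∀ x : S6, F n (x : R7) = ι (s n) x) :
    ¬ ∃ ψ : R7 → Form 3, (∀ x ∈ B7, IsPositive (ψ x)) ∧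
      TendstoUniformlyOn (fun n => flatPullback (F n)) ψ atTop B7 := by
  rintro ⟨ψ, hψ, hlim⟩
  -- A uniform limit of continuous forms is continuous, so its values on the ball form a compact set
  -- of positive forms, and the fillings eventually enter any thickening of it.
  have hψc : ContinuousOn ψ B7 := hlim.continuousOn (Frequently.of_forall fun n =>
    (contDiffOn_pullback phi0 (hF n).1.smooth).continuousOn)
  obtain ⟨δ, hδ, c, hc, D, hbound⟩ := exists_uniform_positive
    ((isCompact_closedBall (0 : R7) 1).image_of_continuousOn hψc)
    (by rintro _ ⟨x, hx, rfl⟩; exact hψ x hx)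
  have hC : ∀ᶠ n in atTop, ∀ x ∈ B7, ∀ u,
      ‖u‖ ≤ √(6 * max 1 D / c) * ‖fderivWithin ℝ (F n) B7 x u‖ := by
    filter_upwards [Metric.tendstoUniformlyOn_iff.1 hlim δ hδ] with n hn x hx u
    have hm := hbound (flatPullback (F n) x) (Metric.mem_thickening_iff.2
      ⟨ψ x, mem_image_of_mem _ hx, by rw [dist_comm]; exact hn x hx⟩)
    exact norm_le_of_conformalForm_bound ((hF n).1.orientation x hx) hc hm.1 hm.2 u
  obtain ⟨L, hL, -, hpre⟩ := h.exists_preimages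
  obtain ⟨r, hr, hslab⟩ := h.near_origin
  have hsm : ∀ᶠ n in atTop, s n < min L r := hs0.eventually (gt_mem_nhds (lt_min hL hr))
  obtain ⟨N, hN⟩ := eventually_atTop.1 (hC.and hsm)
  have hmem : ∀ n, s (n + N) ∈ Ioo 0 L := fun n =>
    ⟨(hs _).1, (hN _ (Nat.le_add_left _ _)).2.trans_le (min_le_left _ _)⟩
  choose x hx using fun n => (hpre _ (hmem n)).1
  choose y hy using fun n => (hpre _ (hmem n)).2
  have hd : ∀ n, dist (x n) (y n) ≤ √(6 * max 1 D / c) * s (n + N) := by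
    intro n
    have hsl := (hs (n + N)).1
    have hlt : s (n + N) < r := (hN _ (Nat.le_add_left _ _)).2.trans_le (min_le_right _ _)
    refine dist_le_of_segment (hF (n + N)).1 (hN _ (Nat.le_add_left _ _)).1 hsl
      (fun t ht => ?_) (sphere_subset_closedBall (x n).2) (sphere_subset_closedBall (y n).2)
      (((hF _).2 _).trans (hx n)) (((hF _).2 _).trans (hy n))
    refine IsSlabNear.mem_closure (hslab _ (hs _)) hsl ?_ ?_ ?_
    · rw [norm_smul, norm_tVec, mul_one, Real.norm_of_nonneg ht.1]
      exact ht.2.trans_lt hlt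
    · rw [tCoord_smul_tVec]; exact ht.1
    · rw [tCoord_smul_tVec, zNormSq_smul_tVec, zero_add]; exact ht.2
  obtain ⟨p, f, hf, hfl⟩ := CompactSpace.tendsto_subseq x
  have hsN : Tendsto (fun n => s (f n + N)) atTop (𝓝 0) :=
    hs0.comp ((tendsto_add_atTop_nat N).comp hf.tendsto_atTop)
  have hyl : Tendsto (y ∘ f) atTop (𝓝 p) := by
    refine tendsto_of_tendsto_of_dist hfl ?_
    refine squeeze_zero (fun _ => dist_nonneg) (fun n => hd (f n)) ?_
    simpa using hsN.const_mul (√(6 * max 1 D / c))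
  exact (h.ne_of_tendsto (tendsto_nhdsWithin_iff.2 ⟨hsN, Eventually.of_forall fun n => (hs _).1⟩)
    hfl hyl (Eventually.of_forall fun n => hx _) (Eventually.of_forall fun n => hy _)).2.2 rfl

/-! ### Extension of maps on the sphere along rays -/

/-- Off the origin the extension is `f` after the smooth normalization `x ↦ x / |x|` into the
sphere. -/
theorem contDiffAt_radialExt {f : S6 → R7} (hf : ContMDiff (𝓡 6) 𝓘(ℝ, R7) ∞ f) {x : R7}
    (hx : x ≠ 0) : ContDiffAt ℝ ∞ (radialExt f) x := by
  have := fact_finrank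
  let U : TopologicalSpace.Opens R7 := ⟨{0}ᶜ, isOpen_compl_singleton⟩
  let g : U → EuclideanSpace ℝ (Fin (6 + 1)) := fun y => ‖(y : R7)‖⁻¹ • (y : R7)
  have hU : ∀ y : U, (y : R7) ≠ 0 := fun y => y.2
  have hg : ContMDiff 𝓘(ℝ, R7) 𝓘(ℝ, EuclideanSpace ℝ (Fin (6 + 1))) ∞ g := by
    intro y
    have h1 : ContDiffAt ℝ ∞ (fun y : R7 => ‖y‖⁻¹ • y) (y : R7) :=
      ((contDiffAt_norm ℝ (hU y)).inv (norm_ne_zero_iff.2 (hU y))).smul contDiffAt_id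
    exact contMDiffAt_subtype_iff.2 h1.contMDiffAt
  have hg1 : ∀ y, g y ∈ sphere (0 : EuclideanSpace ℝ (Fin (6 + 1))) 1 := by
    intro y
    rw [mem_sphere_zero_iff_norm, norm_smul, norm_inv, norm_norm,
      inv_mul_cancel₀ (norm_ne_zero_iff.mpr (hU y))]
  have h2 := hf.comp (hg.codRestrict_sphere hg1)
  have h3 := h2 ⟨x, hx⟩
  have h4 : f ∘ (Set.codRestrict g _ hg1) = fun y : U => radialExt f y := by
    ext1 y
    rw [radialExt, dif_pos (hU y)]
    rfl
  rw [h4] at h3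
  exact contMDiffAt_iff_contDiffAt.1 (contMDiffAt_subtype_iff.1 h3)

theorem contMDiff_of_contDiffOn_B7 {E : Type*} [NormedAddCommGroup E] [NormedSpace ℝ E]
    {F : R7 → E} (hF : ContDiffOn ℝ ∞ F B7) :
    ContMDiff (𝓡 6) 𝓘(ℝ, E) ∞ (fun x : S6 => F x) := by
  have := fact_finrank
  exact hF.contMDiffOn.comp_contMDiff (contMDiff_coe_sphere (m := ∞) (n := 6))
    fun x => sphere_subset_closedBall x.2

theorem mem_orthogonal_of_tangent (x : S6) (v : TangentSpace (𝓡 6) x) :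
    inner ℝ (x : R7) (mvfderiv (𝓡 6) (Subtype.val : S6 → R7) x v) = 0 := by
  have := fact_finrank
  have h := range_mvfderiv_subtypeVal (E := EuclideanSpace ℝ (Fin (6 + 1))) (n := 6) x
  have h1 : mvfderiv (𝓡 6) (Subtype.val : S6 → R7) x v ∈
      (ℝ ∙ (x : EuclideanSpace ℝ (Fin (6 + 1))))ᗮ := by
    rw [← h]; exact ⟨v, rfl⟩
  exact Submodule.mem_orthogonal_singleton_iff_inner_right.1 h1

theorem exists_tangent_of_orthogonal (x : S6) {w : R7} (hw : inner ℝ (x : R7) w = 0) :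
    ∃ v : TangentSpace (𝓡 6) x, mvfderiv (𝓡 6) (Subtype.val : S6 → R7) x v = w := by
  have := fact_finrank
  have h := range_mvfderiv_subtypeVal (E := EuclideanSpace ℝ (Fin (6 + 1))) (n := 6) x
  have h1 : w ∈ (ℝ ∙ (x : EuclideanSpace ℝ (Fin (6 + 1))))ᗮ :=
    Submodule.mem_orthogonal_singleton_iff_inner_right.2 hw
  rw [← h] at h1
  exact h1

theorem mvfderiv_coe_sphere_injective (x : S6) :
    Function.Injective (mvfderiv (𝓡 6) (Subtype.val : S6 → R7) x) := by
  have := fact_finrank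
  exact injective_mvfderiv_subtypeVal_sphere (E := EuclideanSpace ℝ (Fin (6 + 1))) (n := 6) x

/-! ### Displacements in the direction of `t` -/

theorem fderiv_tVec {q : R7 → ℝ} {x : R7} (hq : DifferentiableAt ℝ q x) {a : ℝ}
    (ha : HasDerivAt (fun c : ℝ => q (x + c • tVec)) a 0) : fderiv ℝ q x tVec = a := by
  have h1 : HasDerivAt (fun c : ℝ => x + c • tVec) tVec 0 := by
    simpa using ((hasDerivAt_id (0 : ℝ)).smul_const tVec).const_add x
  have h2 : HasFDerivAt q (fderiv ℝ q x) (x + (0 : ℝ) • tVec) := by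
    simpa using hq.hasFDerivAt
  exact (h2.comp_hasDerivAt (0 : ℝ) h1).unique ha

theorem hasFDerivAt_add_smul_tVec {q : R7 → ℝ} {x : R7} (hq : DifferentiableAt ℝ q x) :
    HasFDerivAt (fun y => y + q y • tVec)
      (ContinuousLinearMap.id ℝ R7 + (fderiv ℝ q x).smulRight tVec) x :=
  (hasFDerivAt_id x).add (hq.hasFDerivAt.smul_const tVec)

theorem det_id_add_smulRight (f : R7 →L[ℝ] ℝ) (v : R7) :
    (ContinuousLinearMap.id ℝ R7 + f.smulRight v).det = 1 + f v := by
  exact LinearMap.transvection.det (f : Module.Dual ℝ R7) v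

theorem eq_add_smul_tVec_iff {x y : R7} {a b : ℝ} (h : x + a • tVec = y + b • tVec)
    (ht : tCoord x = tCoord y) : x = y := by
  have h1 := congrArg tCoord h
  rw [tCoord_add_smul_tVec, tCoord_add_smul_tVec, ht] at h1
  rw [add_left_cancel h1] at h
  exact add_right_cancel h

theorem contDiff_zNormSq : ContDiff ℝ ∞ zNormSq := by
  unfold zNormSq; fun_prop

theorem contDiff_tCoord : ContDiff ℝ ∞ tCoord := by
  unfold tCoord; fun_prop

/-! ### Existence of pinching families -/

/-- A bump function on the line. -/
def lineBump : ContDiffBump (0 : ℝ) := ⟨1 / 4, 1 / 2, by norm_num, by norm_num⟩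

/-- Keeps the radicand in `capFactor` away from zero on all of `ℝ⁷`, even where `1 - |z|²` is not
positive. -/
theorem half_le_one_sub_mul_lineBump (u : ℝ) : 1 / 2 ≤ 1 - u * lineBump u := by
  rcases le_or_gt (1 / 2) |u| with h | h
  · have : lineBump u = 0 := lineBump.zero_of_le_dist (by simpa [lineBump] using h)
    rw [this]; norm_num
  · have h1 := lineBump.le_one (x := u)
    have h2 := lineBump.nonneg (x := u)
    have h3 := abs_lt.1 h
    nlinarith

/-- The dilation factor in the direction of `t` that flattens the polar caps of the ball. -/
def capFactor (x : R7) : ℝ := (√(1 - zNormSq x * lineBump (zNormSq x)))⁻¹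

theorem capFactor_pos (x : R7) : 0 < capFactor x :=
  inv_pos.2 (Real.sqrt_pos.2 ((by norm_num : (0 : ℝ) < 1 / 2).trans_le
    (half_le_one_sub_mul_lineBump _)))

theorem contDiff_capFactor : ContDiff ℝ ∞ capFactor := by
  have h0 : ∀ x : R7, 0 < 1 - zNormSq x * lineBump (zNormSq x) := fun x =>
    (by norm_num : (0 : ℝ) < 1 / 2).trans_le (half_le_one_sub_mul_lineBump _)
  have h1 : ContDiff ℝ ∞ fun x : R7 => 1 - zNormSq x * lineBump (zNormSq x) :=
    contDiff_const.sub (contDiff_zNormSq.mul (lineBump.contDiff.comp contDiff_zNormSq))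
  exact (h1.sqrt fun x => (h0 x).ne').inv fun x => (Real.sqrt_pos.2 (h0 x)).ne'

theorem capFactor_add_smul_tVec (x : R7) (c : ℝ) : capFactor (x + c • tVec) = capFactor x := by
  rw [capFactor, capFactor, zNormSq_add_smul_tVec]

theorem capFactor_inv_sq {x : R7} (hx : zNormSq x < 1 / 4) :
    (capFactor x)⁻¹ ^ 2 = 1 - zNormSq x := by
  have h1 : lineBump (zNormSq x) = 1 := lineBump.one_of_mem_closedBall (by
    simp only [lineBump, mem_closedBall, Real.dist_0_eq_abs, abs_of_nonneg (zNormSq_nonneg x)]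
    exact hx.le)
  rw [capFactor, inv_inv, h1, mul_one, Real.sq_sqrt (by linarith)]

/-- The displacement defining `slabMap`. -/
def slabShift (l : ℝ) (x : R7) : ℝ :=
  (tCoord x * capFactor x + 1) / 2 * (zNormSq x + l) - tCoord x

/-- A map from the ball onto a domain which is pinched at the origin as `l → 0`. -/
def slabMap (l : ℝ) (x : R7) : R7 := x + slabShift l x • tVec

/-- The displacement defining `slabInv`. -/
def slabInvShift (l : ℝ) (y : R7) : ℝ :=
  (2 * tCoord y / (zNormSq y + l) - 1) * (capFactor y)⁻¹ - tCoord y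

/-- The inverse of `slabMap`. -/
def slabInv (l : ℝ) (y : R7) : R7 := y + slabInvShift l y • tVec

theorem contDiff_slabShift (l : ℝ) : ContDiff ℝ ∞ (slabShift l) :=
  ((((contDiff_tCoord.mul contDiff_capFactor).add contDiff_const).div_const 2).mul
    (contDiff_zNormSq.add contDiff_const)).sub contDiff_tCoord

theorem contDiff_slabMap (l : ℝ) : ContDiff ℝ ∞ (slabMap l) :=
  contDiff_id.add ((contDiff_slabShift l).smul contDiff_const)

theorem tCoord_slabMap (l : ℝ) (x : R7) :
    tCoord (slabMap l x) = (tCoord x * capFactor x + 1) / 2 * (zNormSq x + l) := by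
  rw [slabMap, tCoord_add_smul_tVec, slabShift]; ring

theorem zNormSq_slabMap (l : ℝ) (x : R7) : zNormSq (slabMap l x) = zNormSq x :=
  zNormSq_add_smul_tVec _ _

theorem capFactor_slabMap (l : ℝ) (x : R7) : capFactor (slabMap l x) = capFactor x :=
  capFactor_add_smul_tVec _ _

theorem tCoord_slabInv (l : ℝ) (x : R7) :
    tCoord (slabInv l x) = (2 * tCoord x / (zNormSq x + l) - 1) * (capFactor x)⁻¹ := by
  rw [slabInv, tCoord_add_smul_tVec, slabInvShift]; ring

theorem zNormSq_slabInv (l : ℝ) (x : R7) : zNormSq (slabInv l x) = zNormSq x :=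
  zNormSq_add_smul_tVec _ _

theorem capFactor_slabInv (l : ℝ) (x : R7) : capFactor (slabInv l x) = capFactor x :=
  capFactor_add_smul_tVec _ _

theorem slabInv_slabMap {l : ℝ} (hl : 0 < l) (x : R7) : slabInv l (slabMap l x) = x := by
  have h1 : tCoord (slabInv l (slabMap l x)) = tCoord x := by
    have h2 := capFactor_pos x
    have h3 : 0 < zNormSq x + l := add_pos_of_nonneg_of_pos (zNormSq_nonneg x) hl
    rw [tCoord_slabInv, tCoord_slabMap, zNormSq_slabMap, capFactor_slabMap]
    field_simp
    ring
  refine eq_add_smul_tVec_iff (a := 0) (b := slabShift l x + slabInvShift l (slabMap l x)) ?_ h1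
  rw [zero_smul, add_zero, add_smul, ← add_assoc]
  rfl

theorem slabMap_slabInv {l : ℝ} (hl : 0 < l) (x : R7) : slabMap l (slabInv l x) = x := by
  have h1 : tCoord (slabMap l (slabInv l x)) = tCoord x := by
    have h2 := capFactor_pos x
    have h3 : 0 < zNormSq x + l := add_pos_of_nonneg_of_pos (zNormSq_nonneg x) hl
    rw [tCoord_slabMap, tCoord_slabInv, zNormSq_slabInv, capFactor_slabInv]
    field_simp
    ring
  refine eq_add_smul_tVec_iff (a := 0) (b := slabInvShift l x + slabShift l (slabInv l x)) ?_ h1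
  rw [zero_smul, add_zero, add_smul, ← add_assoc]
  rfl

theorem contDiff_slabInv {l : ℝ} (hl : 0 < l) : ContDiff ℝ ∞ (slabInv l) := by
  have h3 : ∀ x, zNormSq x + l ≠ 0 := fun x =>
    (add_pos_of_nonneg_of_pos (zNormSq_nonneg x) hl).ne'
  exact contDiff_id.add (((((((contDiff_const.mul contDiff_tCoord).div
    (contDiff_zNormSq.add contDiff_const) h3)).sub contDiff_const).mul
    (contDiff_capFactor.inv fun x => (capFactor_pos x).ne')).sub contDiff_tCoord).smul
    contDiff_const)

theorem fderiv_slabShift_tVec (l : ℝ) (x : R7) :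
    fderiv ℝ (slabShift l) x tVec = capFactor x / 2 * (zNormSq x + l) - 1 := by
  refine fderiv_tVec ((contDiff_slabShift l).differentiable (by simp) x) ?_
  simp only [slabShift, tCoord_add_smul_tVec, zNormSq_add_smul_tVec, capFactor_add_smul_tVec]
  have h0 : HasDerivAt (fun c : ℝ => tCoord x + c) 1 0 := (hasDerivAt_id (0 : ℝ)).const_add _
  have h1 := ((((h0.mul_const (capFactor x)).add_const 1).div_const 2).mul_const
    (zNormSq x + l)).sub h0
  rw [one_mul] at h1
  convert! h1 using 1

theorem fderivWithin_slabMap (l : ℝ) {x : R7} (hx : x ∈ B7) :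
    fderivWithin ℝ (slabMap l) B7 x =
      ContinuousLinearMap.id ℝ R7 + (fderiv ℝ (slabShift l) x).smulRight tVec :=
  (hasFDerivAt_add_smul_tVec ((contDiff_slabShift l).differentiable (by simp) x)).hasFDerivWithinAt
    |>.fderivWithin (uniqueDiffOn_B7 x hx)

theorem isBallDiffeo_slabMap {l : ℝ} (hl : 0 < l) :
    IsBallDiffeo (slabMap l) (slabMap l '' ball 0 1) where
  smooth := (contDiff_slabMap l).contDiffOn
  image_ball := rfl
  image_closedBall := by
    let e : R7 ≃ₜ R7 :=
      { toFun := slabMap l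
        invFun := slabInv l
        left_inv := slabInv_slabMap hl
        right_inv := slabMap_slabInv hl
        continuous_toFun := (contDiff_slabMap l).continuous
        continuous_invFun := (contDiff_slabInv hl).continuous }
    have := e.image_closure (ball 0 1)
    rw [closure_ball _ one_ne_zero] at this
    exact this
  smooth_inverse := ⟨slabInv l, (contDiff_slabInv hl).contDiffOn, fun x _ => slabInv_slabMap hl x⟩
  orientation x hx := by
    rw [fderivWithin_slabMap l hx, det_id_add_smulRight, fderiv_slabShift_tVec]
    have h2 := capFactor_pos x
    have h3 : 0 < zNormSq x + l := add_pos_of_nonneg_of_pos (zNormSq_nonneg x) hl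
    have : 0 < capFactor x / 2 * (zNormSq x + l) := by positivity
    linarith

/-- For `|z| < 1/2` the ball is `|t| capFactor < 1`, and `(t capFactor + 1) / 2` runs over `(0, 1)`.
With `u = 2 t / (|z|² + l)` in the target this is the condition `|u - 1| < 1`. -/
theorem isSlabNear_slabMap {l : ℝ} (hl : 0 < l) :
    IsSlabNear (1 / 2) l (slabMap l '' ball 0 1) := by
  intro x hx
  have h1 : x ∈ slabMap l '' ball 0 1 ↔ slabInv l x ∈ ball (0 : R7) 1 := by
    constructor
    · rintro ⟨y, hy, rfl⟩
      rwa [slabInv_slabMap hl]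
    · intro h
      exact ⟨_, h, slabMap_slabInv hl x⟩
  have hxz : zNormSq x < 1 / 4 := by
    have h2 := norm_sq_eq x
    have h3 : ‖x‖ < 1 / 2 := by simpa using hx
    have h4 : ‖x‖ ^ 2 < 1 / 4 := by nlinarith [norm_nonneg x]
    nlinarith [sq_nonneg (tCoord x)]
  have h3 : 0 < zNormSq x + l := add_pos_of_nonneg_of_pos (zNormSq_nonneg x) hl
  rw [h1, mem_ball_zero_iff, ← sq_lt_one_iff₀ (norm_nonneg _), norm_sq_eq, zNormSq_slabInv,
    tCoord_slabInv, mul_pow, capFactor_inv_sq hxz]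
  set u := 2 * tCoord x / (zNormSq x + l) with hu
  have hu' : tCoord x = u * (zNormSq x + l) / 2 := by rw [hu]; field_simp
  have h5 : zNormSq x + (u - 1) ^ 2 * (1 - zNormSq x) < 1 ↔ (u - 1) ^ 2 < 1 := by
    have : 0 < 1 - zNormSq x := by linarith
    constructor <;> intro h <;> nlinarith
  rw [h5, sq_lt_one_iff_abs_lt_one, abs_lt, hu']
  constructor
  · rintro ⟨h6, h7⟩
    have h8 : 0 < u := by linarith
    have h9 : u < 2 := by linarith
    exact ⟨by positivity, by nlinarith⟩
  · rintro ⟨h6, h7⟩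
    have h8 : 0 < u := by
      by_contra h
      nlinarith [mul_nonneg (neg_nonneg.2 (not_lt.1 h)) h3.le]
    have h9 : u < 2 := by
      by_contra h
      nlinarith [mul_le_mul_of_nonneg_right (not_lt.1 h) h3.le]
    exact ⟨by linarith, by linarith⟩

theorem tendstoSmoothly_slabMap :
    TendstoSmoothly (fun l (x : S6) => slabMap l x) (fun x : S6 => slabMap 0 x) := by
  intro k
  let g : R7 → R7 := fun x => ((tCoord x * capFactor x + 1) / 2) • tVec
  have hg : ContDiff ℝ ∞ g :=
    (((contDiff_tCoord.mul contDiff_capFactor).add contDiff_const).div_const 2).smul contDiff_const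
  -- The map is affine in `l`, so every derivative differs from its limit by `l` times a function
  -- bounded on the sphere.
  have hdec : ∀ l, radialExt (fun x : S6 => slabMap l x) =
      radialExt (fun x : S6 => slabMap 0 x) + l • radialExt (fun x : S6 => g x) := by
    intro l
    ext1 x
    simp only [radialExt, Pi.add_apply, Pi.smul_apply]
    split_ifs with hx
    · simp only [slabMap, slabShift, g, add_assoc, smul_smul, ← add_smul]
      congr 2
      ring
    · simp
  have hF : ∀ l : ℝ, ContMDiff (𝓡 6) 𝓘(ℝ, R7) ∞ (fun x : S6 => slabMap l x) := fun l =>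
    contMDiff_of_contDiffOn_B7 (contDiff_slabMap l).contDiffOn
  have hG : ContMDiff (𝓡 6) 𝓘(ℝ, R7) ∞ (fun x : S6 => g x) :=
    contMDiff_of_contDiffOn_B7 hg.contDiffOn
  have hne : ∀ x ∈ sphere (0 : R7) 1, x ≠ 0 := fun x hx => ne_zero_of_mem_unit_sphere ⟨x, hx⟩
  have hcont : ContinuousOn (iteratedFDeriv ℝ k (radialExt fun x : S6 => g x)) (sphere 0 1) := by
    intro x hx
    refine ContinuousAt.continuousWithinAt ?_
    have h1 := contDiffAt_radialExt hG (hne x hx)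
    exact (h1.iteratedFDeriv_right (m := 0) (i := k)
      (by simpa using (by exact_mod_cast le_top : (k : ℕ∞ω) ≤ ∞))).continuousAt
  obtain ⟨C, hC⟩ := (isCompact_sphere (0 : R7) 1).exists_bound_of_continuousOn hcont
  rw [Metric.tendstoUniformlyOn_iff]
  intro e he
  have hsm : ∀ᶠ l in 𝓝[>] (0 : ℝ), |l| * (|C| + 1) < e := by
    have : Tendsto (fun l : ℝ => |l| * (|C| + 1)) (𝓝 0) (𝓝 (|0| * (|C| + 1))) :=
      (continuous_abs.mul continuous_const).tendsto _
    rw [abs_zero, zero_mul] at this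
    exact (this.mono_left nhdsWithin_le_nhds).eventually (gt_mem_nhds he)
  filter_upwards [hsm] with l hl x hx
  have hk : (k : ℕ∞ω) ≤ ∞ := by exact_mod_cast le_top
  have h0 := (contDiffAt_radialExt (hF 0) (hne x hx)).of_le hk
  have h1 := (contDiffAt_radialExt hG (hne x hx)).of_le hk
  have h2 : ContDiffAt ℝ k (l • radialExt fun x : S6 => g x) x := h1.const_smul l
  rw [hdec l, iteratedFDeriv_add_apply h0 h2, iteratedFDeriv_const_smul_apply h1,
    dist_self_add_right, norm_smul, Real.norm_eq_abs]
  refine lt_of_le_of_lt (mul_le_mul_of_nonneg_left ?_ (abs_nonneg l)) hl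
  exact (hC x hx).trans ((le_abs_self C).trans (by linarith))

/-- The map moves points only vertically, so a kernel vector is vertical, and it can be non-zero
only where `z = 0`. There the tangent space of the sphere is horizontal. -/
theorem slabMap_immersion (x : S6) :
    Function.Injective (mvfderiv (𝓡 6) (fun x : S6 => slabMap 0 x) x) := by
  rw [mvfderiv_comp_coe_sphere (contDiff_slabMap 0).contDiffOn (fun _ => rfl),
    fderivWithin_slabMap 0 (sphere_subset_closedBall x.2)]
  rw [injective_iff_map_eq_zero]
  intro v hv
  have hort := mem_orthogonal_of_tangent x v
  apply mvfderiv_coe_sphere_injective x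
  rw [map_zero]
  rw [ContinuousLinearMap.comp_apply] at hv
  set w := mvfderiv (𝓡 6) (Subtype.val : S6 → R7) x v with hw
  simp only [add_apply, ContinuousLinearMap.id_apply,
    ContinuousLinearMap.smulRight_apply] at hv
  obtain ⟨a, ha⟩ : ∃ a : ℝ, w = a • tVec :=
    ⟨-fderiv ℝ (slabShift 0) (x : R7) w, by rw [neg_smul]; exact eq_neg_of_add_eq_zero_left hv⟩
  rw [ha, map_smul, fderiv_slabShift_tVec, ← add_smul, smul_eq_mul] at hv
  have ht : tVec ≠ 0 := by rw [← norm_ne_zero_iff, norm_tVec]; exact one_ne_zero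
  have h1 : a * (capFactor (x : R7) / 2 * zNormSq (x : R7)) = 0 := by
    have := (smul_eq_zero.1 hv).resolve_right ht
    linear_combination this
  have h2 : a * tCoord (x : R7) = 0 := by
    rw [ha, inner_smul_right, tVec, stdVec, EuclideanSpace.inner_single_right] at hort
    simpa [tCoord] using hort
  have hx : zNormSq (x : R7) + tCoord (x : R7) ^ 2 = 1 := by
    rw [← norm_sq_eq, mem_sphere_zero_iff_norm.1 x.2, one_pow]
  have ha0 : a = 0 := by
    by_contra hne
    have h3 := (mul_eq_zero.1 h1).resolve_left hne
    have h4 := (mul_eq_zero.1 h2).resolve_left hne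
    have h5 := capFactor_pos (x : R7)
    rw [h4] at hx
    have h6 : zNormSq (x : R7) = 1 := by linarith
    rw [h6] at h3
    linarith
  rw [ha, ha0, zero_smul]

theorem exists_isPinchingFamily : ∃ (Λ : ℝ) (Ω : ℝ → Set R7) (ι : ℝ → S6 → R7),
    IsPinchingFamily Λ Ω ι := by
  refine ⟨1, fun l => slabMap l '' ball 0 1, fun l x => slabMap l x, ?_⟩
  exact
    { pos := one_pos
      near_origin := ⟨1 / 2, by norm_num, fun l hl => isSlabNear_slabMap hl.1⟩
      boundary := fun l hl => ⟨slabMap l, isBallDiffeo_slabMap hl.1, fun _ => rfl⟩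
      limit_smooth := contMDiff_of_contDiffOn_B7 (contDiff_slabMap 0).contDiffOn
      limit_immersion := slabMap_immersion
      tendsto := tendstoSmoothly_slabMap
      limit_injective := by
        intro x y hxy
        have hz : zNormSq (x : R7) = zNormSq (y : R7) := by
          rw [← zNormSq_slabMap 0 (x : R7), hxy, zNormSq_slabMap]
        have hc : capFactor (x : R7) = capFactor (y : R7) := by
          rw [← capFactor_slabMap 0 (x : R7), hxy, capFactor_slabMap]
        have ht := congrArg tCoord hxy
        rw [tCoord_slabMap, tCoord_slabMap, hz, hc, add_zero] at ht
        have h2 := capFactor_pos (y : R7)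
        -- The coordinate `z` is preserved. Over `z = 0` the limit map has value `0`; elsewhere the
        -- thickness `|z|²` is non-zero and `t` can be recovered.
        rcases (zNormSq_nonneg (y : R7)).eq_or_lt with h0 | h0
        · right
          have h3 := norm_sq_eq (slabMap 0 (x : R7))
          rw [tCoord_slabMap, zNormSq_slabMap, hz, ← h0] at h3
          simpa using h3
        · left
          refine Subtype.ext (eq_add_smul_tVec_iff hxy ?_)
          have h4 := mul_right_cancel₀ h0.ne' ht
          have h5 : tCoord (x : R7) * capFactor (y : R7) = tCoord (y : R7) * capFactor (y : R7) := by
            linarith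
          exact mul_right_cancel₀ h2.ne' h5 }

/-! ### Local structure of an immersion of the sphere -/

theorem radialExt_smul (f : S6 → R7) {c : ℝ} (hc : 0 < c) (x : R7) :
    radialExt f (c • x) = radialExt f x := by
  rcases eq_or_ne x 0 with rfl | hx
  · rw [smul_zero]
  · have hcx : c • x ≠ 0 := smul_ne_zero hc.ne' hx
    rw [radialExt, radialExt, dif_pos hx, dif_pos hcx]
    congr 1
    ext1
    change ‖c • x‖⁻¹ • c • x = ‖x‖⁻¹ • x
    rw [norm_smul, Real.norm_of_nonneg hc.le, smul_smul, mul_inv, mul_right_comm,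
      inv_mul_cancel₀ hc.ne', one_mul]

theorem fderiv_radialExt (f : S6 → R7) {x : R7} (hx : x ≠ 0) :
    fderiv ℝ (radialExt f) x = ‖x‖⁻¹ • fderiv ℝ (radialExt f) (‖x‖⁻¹ • x) := by
  have hc : 0 < ‖x‖⁻¹ := inv_pos.2 (norm_pos_iff.2 hx)
  have h : (fun y => radialExt f (‖x‖⁻¹ • y)) = radialExt f :=
    funext fun y => radialExt_smul f hc y
  rw [← fderiv_comp_smul, h]

theorem fderiv_radialExt_self {f : S6 → R7} (hf : ContMDiff (𝓡 6) 𝓘(ℝ, R7) ∞ f) {x : R7}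
    (hx : x ≠ 0) : fderiv ℝ (radialExt f) x x = 0 := by
  have h1 : HasDerivAt (fun c : ℝ => x + c • x) x 0 := by
    simpa using ((hasDerivAt_id (0 : ℝ)).smul_const x).const_add x
  have h2 : HasFDerivAt (radialExt f) (fderiv ℝ (radialExt f) x) (x + (0 : ℝ) • x) := by
    simpa using ((contDiffAt_radialExt hf hx).differentiableAt (by simp)).hasFDerivAt
  have h3 := h2.comp_hasDerivAt (0 : ℝ) h1
  have h4 : (radialExt f ∘ fun c : ℝ => x + c • x) =ᶠ[𝓝 0] fun _ => radialExt f x := by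
    filter_upwards [lt_mem_nhds (by norm_num : (-1 : ℝ) < 0)] with c hc
    have : x + c • x = (1 + c) • x := by rw [add_smul, one_smul]
    rw [Function.comp_apply, this, radialExt_smul f (by linarith)]
  exact h3.unique ((hasDerivAt_const (0 : ℝ) (radialExt f x)).congr_of_eventuallyEq h4)

theorem mvfderiv_eq_fderiv_comp {E : Type*} [NormedAddCommGroup E] [NormedSpace ℝ E]
    {H : R7 → E} {h : S6 → E} (hh : ∀ x : S6, H x = h x) {x : S6} (hH : DifferentiableAt ℝ H x) :
    mvfderiv (𝓡 6) h x =
      (fderiv ℝ H x).comp (mvfderiv (𝓡 6) (Subtype.val : S6 → R7) x) := by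
  have := fact_finrank
  have e : h = H ∘ (Subtype.val : S6 → R7) := funext fun x => (hh x).symm
  have h2 : MDifferentiableAt (𝓡 6) 𝓘(ℝ, R7) (Subtype.val : S6 → R7) x :=
    (contMDiff_coe_sphere (E := EuclideanSpace ℝ (Fin (6 + 1))) (m := ∞) (n := 6) x).mdifferentiableAt
      (by simp)
  have h3 := mfderiv_comp x hH.mdifferentiableAt h2
  rw [← e, mfderiv_eq_fderiv] at h3
  rw [mvfderiv, h3]
  rfl

theorem sphere_ne_zero (x : S6) : (x : R7) ≠ 0 := ne_zero_of_mem_unit_sphere x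

/-- Transfers local statements from the sphere to `ℝ⁷`; the same `w` serves every `f`. -/
theorem eventually_radialExt_eq {x : S6} {W : Set S6} (hW : W ∈ 𝓝 x) :
    ∀ᶠ y in 𝓝 (x : R7), ∃ w ∈ W, ∀ f : S6 → R7, radialExt f y = f w ∧ (‖y‖ = 1 → y = w) := by
  obtain ⟨V, hV, hVW⟩ := mem_nhds_subtype _ _ _ |>.1 hW
  have hc : ContinuousAt (fun y : R7 => ‖y‖⁻¹ • y) (x : R7) :=
    (continuous_norm.continuousAt.inv₀ (norm_ne_zero_iff.2 (sphere_ne_zero x))).smul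
      continuousAt_id
  have hx : ‖(x : R7)‖⁻¹ • (x : R7) = x := by
    rw [mem_sphere_zero_iff_norm.1 x.2, inv_one, one_smul]
  have h1 : ∀ᶠ y in 𝓝 (x : R7), ‖y‖⁻¹ • y ∈ V := hc (by
    change V ∈ 𝓝 (‖(x : R7)‖⁻¹ • (x : R7)); rw [hx]; exact hV)
  filter_upwards [h1, isOpen_compl_singleton.mem_nhds (sphere_ne_zero x)] with y hy hy0
  have hy0 : y ≠ 0 := hy0
  have hm : ‖y‖⁻¹ • y ∈ sphere (0 : R7) 1 := by
    rw [mem_sphere_zero_iff_norm, norm_smul, norm_inv, norm_norm,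
      inv_mul_cancel₀ (norm_ne_zero_iff.mpr hy0)]
  refine ⟨⟨_, hm⟩, hVW hy, fun f => ⟨?_, fun h => ?_⟩⟩
  · rw [radialExt, dif_pos hy0]
  · simp [h]

section Immersion

variable {i : S6 → R7}

/-- The extension of a map of the sphere to a neighbourhood, moving in the direction `n` along
rays. -/
def collarMap (i : S6 → R7) (n : R7) (y : R7) : R7 := radialExt i y + (‖y‖ ^ 2 - 1) • n

theorem collarMap_sphere (i : S6 → R7) (n : R7) (x : S6) : collarMap i n x = i x := by
  rw [collarMap, radialExt_sphere, mem_sphere_zero_iff_norm.1 x.2]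
  simp

theorem contDiffAt_collarMap (hi : ContMDiff (𝓡 6) 𝓘(ℝ, R7) ∞ i) (n : R7) {x : R7}
    (hx : x ≠ 0) : ContDiffAt ℝ ∞ (collarMap i n) x :=
  (contDiffAt_radialExt hi hx).add
    ((((contDiff_norm_sq ℝ).sub contDiff_const).smul contDiff_const).contDiffAt)

theorem fderiv_collarMap (hi : ContMDiff (𝓡 6) 𝓘(ℝ, R7) ∞ i) (n : R7) {x : R7}
    (hx : x ≠ 0) (v : R7) :
    fderiv ℝ (collarMap i n) x v = fderiv ℝ (radialExt i) x v + (2 * inner ℝ x v) • n := by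
  have h1 := ((contDiffAt_radialExt hi hx).differentiableAt (by simp)).hasFDerivAt
  have h2 := ((hasStrictFDerivAt_norm_sq x).hasFDerivAt.sub_const 1).smul_const n
  have h3 : HasFDerivAt (collarMap i n) _ x := h1.add h2
  rw [h3.fderiv]
  simp [two_mul]

/-- The collar adds to the image of `di` the transverse direction `n`, because `|y|² - 1` has
non-zero radial derivative. The inverse function theorem then applies. -/
theorem exists_collar_inverse (hi : ContMDiff (𝓡 6) 𝓘(ℝ, R7) ∞ i) {x : S6}
    (hinj : Function.Injective (mvfderiv (𝓡 6) i x)) {n : R7}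
    (hn : ∀ v, fderiv ℝ (radialExt i) x v ≠ n) :
    ∃ e : OpenPartialHomeomorph R7 R7, (x : R7) ∈ e.source ∧ (e : R7 → R7) = collarMap i n ∧
      ∀ᶠ y in 𝓝 (i x), ContDiffAt ℝ ∞ e.symm y := by
  have hx := sphere_ne_zero x
  have hker : Function.Injective (fderiv ℝ (collarMap i n) (x : R7) : R7 →ₗ[ℝ] R7) := by
    rw [injective_iff_map_eq_zero]
    intro v hv
    have hv : fderiv ℝ (collarMap i n) (x : R7) v = 0 := hv
    rw [fderiv_collarMap hi n hx] at hv
    have hort : inner ℝ (x : R7) v = 0 := by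
      by_contra hne
      refine hn (-(2 * inner ℝ (x : R7) v)⁻¹ • v) ?_
      rw [map_smul, eq_neg_of_add_eq_zero_left hv, neg_smul, smul_neg, neg_neg, smul_smul,
        inv_mul_cancel₀ (mul_ne_zero two_ne_zero hne), one_smul]
    obtain ⟨w, rfl⟩ := exists_tangent_of_orthogonal x hort
    rw [hort, mul_zero, zero_smul, add_zero] at hv
    have h1 := mvfderiv_eq_fderiv_comp (radialExt_sphere i)
      ((contDiffAt_radialExt hi hx).differentiableAt (by simp))
    have h2 : mvfderiv (𝓡 6) i x w = 0 := by rw [h1]; exact hv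
    have h3 : w = 0 := hinj (h2.trans (map_zero _).symm)
    rw [h3, map_zero]
  let f' : R7 ≃L[ℝ] R7 := (LinearEquiv.ofInjectiveEndo _ hker).toContinuousLinearEquiv
  have hf' : HasFDerivAt (collarMap i n) (f' : R7 →L[ℝ] R7) (x : R7) :=
    ((contDiffAt_collarMap hi n hx).differentiableAt (by simp)).hasFDerivAt
  set e := (contDiffAt_collarMap hi n hx).toOpenPartialHomeomorph _ hf' (by simp) with he
  have hes : (x : R7) ∈ e.source :=
    (contDiffAt_collarMap hi n hx).mem_toOpenPartialHomeomorph_source hf' (by simp)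
  have hee : (e : R7 → R7) = collarMap i n := rfl
  refine ⟨e, hes, hee, ?_⟩
  -- Smoothness of the inverse is wanted on a whole neighbourhood; the differential stays invertible
  -- near `x`, as isomorphisms form an open set.
  have h1 : ∀ᶠ y in 𝓝 (x : R7), y ∈ e.source ∧ y ≠ 0 ∧
      fderiv ℝ (collarMap i n) y ∈ range (ContinuousLinearEquiv.toContinuousLinearMap :
        (R7 ≃L[ℝ] R7) → R7 →L[ℝ] R7) := by
    refine (e.open_source.eventually_mem hes).and
      ((isOpen_compl_singleton.eventually_mem hx).and ?_)
    have h2 : ContinuousAt (fderiv ℝ (collarMap i n)) (x : R7) :=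
      ((contDiffAt_collarMap hi n hx).fderiv_right (m := 0) (by simp)).continuousAt
    refine h2 ?_
    rw [hf'.fderiv]
    exact ContinuousLinearEquiv.nhds f'
  rw [← collarMap_sphere i n x, ← hee, ← e.map_nhds_eq hes, eventually_map]
  filter_upwards [h1] with y hy
  obtain ⟨hy1, hy2, g', hg'⟩ := hy
  have hinv : e.symm (e y) = y := e.left_inv hy1
  refine e.contDiffAt_symm (f₀' := g') (e.map_source hy1) ?_ ?_
  · rw [hinv, hg', hee]
    exact ((contDiffAt_collarMap hi n hy2).differentiableAt (by simp)).hasFDerivAt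
  · rw [hinv, hee]
    exact contDiffAt_collarMap hi n hy2

/-- The differential of the radial extension kills `x`, so in equal dimensions it is not surjective.
-/
theorem exists_not_mem_range (hi : ContMDiff (𝓡 6) 𝓘(ℝ, R7) ∞ i) (x : S6) :
    ∃ n : R7, ∀ v, fderiv ℝ (radialExt i) x v ≠ n := by
  by_contra! h
  have hs : Function.Surjective (fderiv ℝ (radialExt i) (x : R7) : R7 →ₗ[ℝ] R7) := h
  have h2 := LinearMap.injective_iff_surjective.2 hs
  refine sphere_ne_zero x (h2 ?_)
  rw [map_zero]
  exact fderiv_radialExt_self hi (sphere_ne_zero x)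

/-- The coordinate `t` as a linear map. -/
def tCoordL : R7 →L[ℝ] ℝ := EuclideanSpace.proj 6

theorem tCoordL_apply (x : R7) : tCoordL x = tCoord x := rfl

/-- The image of any neighbourhood of `p` fills the sheet `t = c |z|²` near the origin. The function
`|z|² ∘ i` has a minimum at `p`, so the image of `di` is horizontal and `∂_t` serves as collar
direction. A collar point `i w + (|y|² - 1) ∂_t` lies on the sheet only if the displacement is zero.
-/
theorem eventually_exists_preimage (hi : ContMDiff (𝓡 6) 𝓘(ℝ, R7) ∞ i) {p : S6}
    (hinj : Function.Injective (mvfderiv (𝓡 6) i p)) (hp : i p = 0) {c : ℝ}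
    (hc : ∀ᶠ x in 𝓝 p, tCoord (i x) = c * zNormSq (i x)) {W : Set S6} (hW : W ∈ 𝓝 p) :
    ∀ᶠ y in 𝓝 (0 : R7), tCoord y = c * zNormSq y → ∃ w ∈ W, i w = y := by
  have hp0 := sphere_ne_zero p
  have hd : DifferentiableAt ℝ (radialExt i) (p : R7) :=
    (contDiffAt_radialExt hi hp0).differentiableAt (by simp)
  have hz : fderiv ℝ (fun y => zNormSq (radialExt i y)) (p : R7) = 0 := by
    refine IsLocalMin.fderiv_eq_zero (Eventually.of_forall fun y => ?_)
    change zNormSq (radialExt i p) ≤ _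
    rw [radialExt_sphere, hp]
    simpa [zNormSq] using zNormSq_nonneg (radialExt i y)
  have ht : ∀ v, tCoordL (fderiv ℝ (radialExt i) p v) = 0 := by
    intro v
    have h1 : fderiv ℝ (fun y => tCoord (radialExt i y)) (p : R7) =
        tCoordL.comp (fderiv ℝ (radialExt i) p) := (tCoordL.hasFDerivAt.comp _ hd.hasFDerivAt).fderiv
    have h2 : (fun y => tCoord (radialExt i y)) =ᶠ[𝓝 (p : R7)]
        fun y => c * zNormSq (radialExt i y) := by
      filter_upwards [eventually_radialExt_eq hc] with y hy
      obtain ⟨w, hw, hwf⟩ := hy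
      rw [(hwf i).1]; exact hw
    have hzd : DifferentiableAt ℝ (fun y => zNormSq (radialExt i y)) (p : R7) :=
      ((contDiff_zNormSq.differentiable (by simp)) _).comp _ hd
    rw [h2.fderiv_eq, fderiv_const_mul hzd, hz, smul_zero] at h1
    exact (congrArg (fun L : R7 →L[ℝ] ℝ => L v) h1).symm
  have hn : ∀ v, fderiv ℝ (radialExt i) p v ≠ tVec := by
    intro v hv
    have h1 := ht v
    rw [hv, tCoordL_apply] at h1
    have h2 := tCoord_smul_tVec 1
    rw [one_smul, h1] at h2
    exact zero_ne_one h2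
  obtain ⟨e, hes, he, -⟩ := exists_collar_inverse hi hinj hn
  have hgood := eventually_radialExt_eq (inter_mem hc hW)
  have hmap := e.map_nhds_eq hes
  rw [he, collarMap_sphere, hp] at hmap
  rw [← hmap, eventually_map]
  filter_upwards [hgood] with y hy hyt
  obtain ⟨w, ⟨hw1, hw2⟩, hwf⟩ := hy
  have h0 : radialExt i y = i w := (hwf i).1
  rw [collarMap, tCoord_add_smul_tVec, zNormSq_add_smul_tVec, h0, (hw1 : _ = _)] at hyt
  have h1 : ‖y‖ ^ 2 - 1 = 0 := by linarith
  refine ⟨w, hw2, ?_⟩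
  rw [collarMap, h1, zero_smul, add_zero, h0]

/-- Disjoint neighbourhoods of two such points would both cover the sheet near the origin, creating
double points other than the origin. -/
theorem eq_of_same_sheet (hi : ContMDiff (𝓡 6) 𝓘(ℝ, R7) ∞ i) {p q : S6}
    (hpi : Function.Injective (mvfderiv (𝓡 6) i p)) (hqi : Function.Injective (mvfderiv (𝓡 6) i q))
    (hp : i p = 0) (hq : i q = 0) {c : ℝ} (hcp : ∀ᶠ x in 𝓝 p, tCoord (i x) = c * zNormSq (i x))
    (hcq : ∀ᶠ x in 𝓝 q, tCoord (i x) = c * zNormSq (i x))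
    (hinj : ∀ x y : S6, i x = i y → x = y ∨ i x = 0) : p = q := by
  by_contra hne
  obtain ⟨U, V, hU, hV, hd⟩ := t2_separation_nhds hne
  have h := (eventually_exists_preimage hi hpi hp hcp hU).and
    (eventually_exists_preimage hi hqi hq hcq hV)
  -- A curve in the sheet that leaves the origin in the direction of `x₁`.
  let Y : ℝ → R7 := fun τ => τ • stdVec 0 + (c * τ ^ 2) • tVec
  have hY : Tendsto Y (𝓝[≠] 0) (𝓝 0) := by
    have h1 : Continuous Y := by fun_prop
    have h2 := h1.tendsto 0
    simp only [Y, zero_smul, ne_eq, OfNat.ofNat_ne_zero, not_false_eq_true, zero_pow, mul_zero,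
      add_zero] at h2
    exact h2.mono_left nhdsWithin_le_nhds
  obtain ⟨τ, ⟨h1, h2⟩, hτ⟩ := ((hY.eventually h).and self_mem_nhdsWithin).exists
  have hτ : τ ≠ 0 := hτ
  have hz : zNormSq (Y τ) = τ ^ 2 := by
    rw [zNormSq_add_smul_tVec, zNormSq, Fin.sum_univ_six]
    simp [stdVec]
  have ht : tCoord (Y τ) = c * zNormSq (Y τ) := by
    rw [hz, tCoord_add_smul_tVec]
    simp [tCoord, stdVec]
  obtain ⟨w, hw, hwY⟩ := h1 ht
  obtain ⟨w', hw', hwY'⟩ := h2 ht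
  rcases hinj w w' (hwY.trans hwY'.symm) with h3 | h3
  · exact disjoint_left.1 hd hw (h3 ▸ hw')
  · rw [hwY] at h3
    rw [h3] at hz
    exact hτ (by simpa [zNormSq] using hz.symm)

theorem not_eventually_eq_zero (hi : ContMDiff (𝓡 6) 𝓘(ℝ, R7) ∞ i) {p : S6}
    (hpi : Function.Injective (mvfderiv (𝓡 6) i p)) : ¬ ∀ᶠ x in 𝓝 p, i x = 0 := by
  intro h
  obtain ⟨n, hn⟩ := exists_not_mem_range hi p
  have h1 : radialExt i =ᶠ[𝓝 (p : R7)] fun _ => 0 := by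
    filter_upwards [eventually_radialExt_eq h] with y hy
    obtain ⟨w, hw, hwf⟩ := hy
    rw [(hwf i).1, hw]
  have h2 : mvfderiv (𝓡 6) i p = 0 := by
    rw [mvfderiv_eq_fderiv_comp (radialExt_sphere i)
      ((contDiffAt_radialExt hi (sphere_ne_zero p)).differentiableAt (by simp)), h1.fderiv_eq]
    simp
  obtain ⟨w, hw0, hw⟩ : ∃ w : R7, w ≠ 0 ∧ inner ℝ (p : R7) w = 0 := by
    have h3 : ¬ Function.Injective (innerSL ℝ (p : R7) : R7 →ₗ[ℝ] ℝ) := fun h4 => by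
      have := LinearMap.finrank_le_finrank_of_injective h4
      simp at this
    rw [injective_iff_map_eq_zero] at h3
    push Not at h3
    obtain ⟨w, h4, h5⟩ := h3
    exact ⟨w, h5, h4⟩
  obtain ⟨v, hv⟩ := exists_tangent_of_orthogonal p hw
  have h3 : v = 0 := hpi (by rw [h2]; rfl)
  exact hw0 (by rw [← hv, h3, map_zero])

end Immersion

/-! ### The two points over the origin and their sheets -/

namespace IsPinchingFamily

variable {Λ : ℝ} {Ω : ℝ → Set R7} {ι : ℝ → S6 → R7}

theorem tendsto_apply (h : IsPinchingFamily Λ Ω ι) (x : S6) :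
    Tendsto (fun l => ι l x) (𝓝[>] 0) (𝓝 (ι 0 x)) := by
  rw [Metric.tendsto_nhds]
  intro e he
  filter_upwards [h.tendsto.eventually_dist_lt he] with l hl
  exact hl x

/-- The sheet does not depend on `l`: if both occurred for arbitrarily small `l`, then `t = 0 =
|z|²` along the limit, and an immersion cannot be constant on an open set. -/
theorem exists_sheet_type (h : IsPinchingFamily Λ Ω ι) {p : S6} (hp : ι 0 p = 0) :
    ∃ W ∈ 𝓝 p, ((∀ x ∈ W, tCoord (ι 0 x) = 0) ∧
        ∀ᶠ l in 𝓝[>] (0 : ℝ), ∀ x ∈ W, tCoord (ι l x) = 0) ∨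
      ((∀ x ∈ W, tCoord (ι 0 x) = zNormSq (ι 0 x)) ∧
        ∀ᶠ l in 𝓝[>] (0 : ℝ), ∀ x ∈ W, tCoord (ι l x) = zNormSq (ι l x) + l) := by
  obtain ⟨W, hW, hl⟩ := h.exists_sheet hp
  refine ⟨W, hW, ?_⟩
  have ht : ∀ x, Tendsto (fun l => tCoord (ι l x)) (𝓝[>] 0) (𝓝 (tCoord (ι 0 x))) := fun x =>
    (continuous_tCoord.tendsto _).comp (h.tendsto_apply x)
  have hz : ∀ x, Tendsto (fun l => zNormSq (ι l x) + l) (𝓝[>] 0) (𝓝 (zNormSq (ι 0 x))) := by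
    intro x
    have h1 := ((continuous_zNormSq.tendsto _).comp (h.tendsto_apply x)).add
      (tendsto_id.mono_left nhdsWithin_le_nhds : Tendsto id (𝓝[>] (0 : ℝ)) (𝓝 0))
    rw [add_zero] at h1
    exact h1
  have hb : (∃ᶠ l in 𝓝[>] (0 : ℝ), ∀ x ∈ W, tCoord (ι l x) = 0) →
      ∀ x ∈ W, tCoord (ι 0 x) = 0 := fun hf x hx =>
    isClosed_singleton.mem_of_frequently_of_tendsto (hf.mono fun l hl => hl x hx) (ht x)
  have hu : (∃ᶠ l in 𝓝[>] (0 : ℝ), ∀ x ∈ W, tCoord (ι l x) = zNormSq (ι l x) + l) →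
      ∀ x ∈ W, tCoord (ι 0 x) = zNormSq (ι 0 x) := fun hf x hx =>
    (isClosed_eq continuous_fst continuous_snd).mem_of_frequently_of_tendsto
      (s := {p : ℝ × ℝ | p.1 = p.2}) (hf.mono fun l hl => hl x hx) ((ht x).prodMk_nhds (hz x))
  by_cases h1 : ∃ᶠ l in 𝓝[>] (0 : ℝ), ∀ x ∈ W, tCoord (ι l x) = 0
  · by_cases h2 : ∃ᶠ l in 𝓝[>] (0 : ℝ), ∀ x ∈ W, tCoord (ι l x) = zNormSq (ι l x) + l
    · refine absurd ?_ (not_eventually_eq_zero h.limit_smooth (h.limit_immersion p))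
      filter_upwards [hW] with x hx
      have h3 := norm_sq_eq (ι 0 x)
      rw [← hu h2 x hx, hb h1 x hx] at h3
      simpa using h3
    · rw [not_frequently] at h2
      exact Or.inl ⟨hb h1, (hl.and h2).mono fun l h3 => h3.1.resolve_right h3.2⟩
  · rw [not_frequently] at h1
    have h4 := (hl.and h1).mono fun l h3 => h3.1.resolve_left h3.2
    exact Or.inr ⟨hu h4.frequently, h4⟩

/-- The two points where the limit immersion passes through the origin, one on the lower and one on
the upper part of the boundary. -/
theorem exists_two_points (h : IsPinchingFamily Λ Ω ι) :
    ∃ p q : S6, p ≠ q ∧ ι 0 p = 0 ∧ ι 0 q = 0 ∧ (∀ x, ι 0 x = 0 → x = p ∨ x = q) ∧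
      (∃ W ∈ 𝓝 p, ∀ᶠ l in 𝓝[>] (0 : ℝ), ∀ x ∈ W, tCoord (ι l x) = 0) ∧
      ∃ W ∈ 𝓝 q, ∀ᶠ l in 𝓝[>] (0 : ℝ), ∀ x ∈ W, tCoord (ι l x) = zNormSq (ι l x) + l := by
  have h0 : ∀ x y, ι 0 x = 0 → ι 0 y = 0 → (∀ᶠ w in 𝓝 x, tCoord (ι 0 w) = 0) →
      (∀ᶠ w in 𝓝 y, tCoord (ι 0 w) = 0) → x = y := fun x y hx hy hx1 hy1 =>
    eq_of_same_sheet h.limit_smooth (h.limit_immersion x) (h.limit_immersion y) hx hy (c := 0)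
      (by simpa using hx1) (by simpa using hy1) h.limit_injective
  have h1 : ∀ x y, ι 0 x = 0 → ι 0 y = 0 → (∀ᶠ w in 𝓝 x, tCoord (ι 0 w) = zNormSq (ι 0 w)) →
      (∀ᶠ w in 𝓝 y, tCoord (ι 0 w) = zNormSq (ι 0 w)) → x = y := fun x y hx hy hx1 hy1 =>
    eq_of_same_sheet h.limit_smooth (h.limit_immersion x) (h.limit_immersion y) hx hy (c := 1)
      (by simpa using hx1) (by simpa using hy1) h.limit_injective
  obtain ⟨p, q, hpq, hp, hq⟩ := h.exists_double_point
  obtain ⟨Wp, hWp, hp1⟩ := h.exists_sheet_type hp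
  obtain ⟨Wq, hWq, hq1⟩ := h.exists_sheet_type hq
  have key : ∀ a b : S6, ∀ Wa ∈ 𝓝 a, ∀ Wb ∈ 𝓝 b, a ≠ b → ι 0 a = 0 → ι 0 b = 0 →
      (∀ x ∈ Wa, tCoord (ι 0 x) = 0) → (∀ x ∈ Wb, tCoord (ι 0 x) = zNormSq (ι 0 x)) →
      ∀ x, ι 0 x = 0 → x = a ∨ x = b := by
    intro a b Wa hWa Wb hWb _ ha hb ha1 hb1 x hx
    obtain ⟨W, hW, hx1 | hx1⟩ := h.exists_sheet_type hx
    · exact Or.inl (h0 x a hx ha (mem_of_superset hW hx1.1) (mem_of_superset hWa ha1))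
    · exact Or.inr (h1 x b hx hb (mem_of_superset hW hx1.1) (mem_of_superset hWb hb1))
  rcases hp1 with hp1 | hp1 <;> rcases hq1 with hq1 | hq1
  · exact absurd (h0 p q hp hq (mem_of_superset hWp hp1.1) (mem_of_superset hWq hq1.1)) hpq
  · exact ⟨p, q, hpq, hp, hq, key p q Wp hWp Wq hWq hpq hp hq hp1.1 hq1.1, ⟨Wp, hWp, hp1.2⟩,
      Wq, hWq, hq1.2⟩
  · exact ⟨q, p, hpq.symm, hq, hp, key q p Wq hWq Wp hWp hpq.symm hq hp hq1.1 hp1.1,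
      ⟨Wq, hWq, hq1.2⟩, Wp, hWp, hp1.2⟩
  · exact absurd (h1 p q hp hq (mem_of_superset hWp hp1.1) (mem_of_superset hWq hq1.1)) hpq

end IsPinchingFamily

/-! ### Diffeomorphisms close to the identity -/

/-- A perturbation of the identity with Lipschitz constant below `1` is a homeomorphism. As `id +
de` contracts lengths by at most a factor `2`, the inverse has differential within `2c` of the
identity. -/
theorem exists_inverse_of_small {E : Type*} [NormedAddCommGroup E] [NormedSpace ℝ E]
    [CompleteSpace E] [Nontrivial E] {e : E → E} (he : ContDiff ℝ ∞ e) {c : ℝ} (hc : c ≤ 1 / 2)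
    (h0 : ∀ x, ‖e x‖ ≤ c) (h1 : ∀ x, ‖fderiv ℝ e x‖ ≤ c) :
    ∃ Φ : E → E, ContDiff ℝ ∞ Φ ∧ (∀ x, Φ (x + e x) = x) ∧
      ∀ y, ‖Φ y - y‖ ≤ c ∧ ‖fderiv ℝ Φ y - ContinuousLinearMap.id ℝ E‖ ≤ 2 * c := by
  have hc0 : 0 ≤ c := (norm_nonneg _).trans (h0 0)
  have hed : Differentiable ℝ e := he.differentiable (by simp)
  lift c to NNReal using hc0
  have hlip : LipschitzWith c e := lipschitzWith_of_nnnorm_fderiv_le hed h1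
  have happ : ApproximatesLinearOn (fun x => x + e x)
      ((ContinuousLinearEquiv.refl ℝ E : E ≃L[ℝ] E) : E →L[ℝ] E) univ c := by
    intro x _ y _
    have h2 := hlip.dist_le_mul x y
    rw [dist_eq_norm, dist_eq_norm] at h2
    have h3 : x + e x - (y + e y) - (x - y) = e x - e y := by abel
    change ‖x + e x - (y + e y) - (x - y)‖ ≤ c * ‖x - y‖
    rw [h3]
    exact h2
  have hN : c < ‖((ContinuousLinearEquiv.refl ℝ E).symm : E →L[ℝ] E)‖₊⁻¹ := by
    have : ‖((ContinuousLinearEquiv.refl ℝ E).symm : E →L[ℝ] E)‖₊ = 1 := by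
      ext
      exact ContinuousLinearMap.norm_id
    rw [this, inv_one, ← NNReal.coe_lt_coe, NNReal.coe_one]
    linarith
  let h := happ.toHomeomorph _ (Or.inr hN)
  have hh : ⇑h = fun x => x + e x := rfl
  have hD : ∀ x, HasFDerivAt h (ContinuousLinearMap.id ℝ E + fderiv ℝ e x) x := fun x =>
    (hasFDerivAt_id x).add (hed x).hasFDerivAt
  have hlow : ∀ x v, ‖v‖ ≤ 2 * ‖(ContinuousLinearMap.id ℝ E + fderiv ℝ e x) v‖ := by
    intro x v
    have h2 : ‖fderiv ℝ e x v‖ ≤ 1 / 2 * ‖v‖ :=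
      ((fderiv ℝ e x).le_of_opNorm_le ((h1 x).trans hc) v)
    have h3 := norm_sub_le (v + fderiv ℝ e x v) (fderiv ℝ e x v)
    rw [add_sub_cancel_right] at h3
    change ‖v‖ ≤ 2 * ‖v + fderiv ℝ e x v‖
    linarith
  have hsymm : ∀ y, HasFDerivAt h.symm (fderiv ℝ h.symm y) y ∧ ContDiffAt ℝ ∞ h.symm y := by
    intro y
    have hu : IsUnit (ContinuousLinearMap.id ℝ E + fderiv ℝ e (h.symm y)) := by
      have h2 : ‖-fderiv ℝ e (h.symm y)‖ < 1 := by
        rw [norm_neg]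
        exact ((h1 _).trans hc).trans_lt (by norm_num)
      have h3 := (Units.oneSub _ h2).isUnit
      rw [Units.val_oneSub, sub_neg_eq_add] at h3
      exact h3
    obtain ⟨u, hu⟩ := hu
    let f' : E ≃L[ℝ] E := ContinuousLinearEquiv.ofUnit u
    have hf' : HasFDerivAt h.toOpenPartialHomeomorph (f' : E →L[ℝ] E)
        (h.toOpenPartialHomeomorph.symm y) := by
      have h4 := hD (h.symm y)
      rw [← hu] at h4
      exact h4
    have h5 : ContDiffAt ℝ ∞ h.symm y :=
      h.toOpenPartialHomeomorph.contDiffAt_symm (n := ∞) (mem_univ y) hf'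
        ((contDiff_id.add he).contDiffAt)
    exact ⟨(h5.differentiableAt (by simp)).hasFDerivAt, h5⟩
  refine ⟨h.symm, contDiff_iff_contDiffAt.2 fun y => (hsymm y).2, fun x => h.symm_apply_apply x,
    fun y => ⟨?_, ?_⟩⟩
  · have h2 : h.symm y + e (h.symm y) = y := h.apply_symm_apply y
    have h3 : h.symm y - y = -e (h.symm y) := by
      nth_rewrite 2 [← h2]
      abel
    rw [h3, norm_neg]
    exact h0 _
  · refine ContinuousLinearMap.opNorm_le_bound _ (by positivity) fun v => ?_
    have h2 := (hD (h.symm y)).comp y (hsymm y).1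
    have h3 : (⇑h ∘ ⇑h.symm) = id := funext fun z => h.apply_symm_apply z
    rw [h3] at h2
    have h4 := congrArg (fun L : E →L[ℝ] E => L v) (h2.unique (hasFDerivAt_id y))
    set w := fderiv ℝ h.symm y v with hw
    have h5 : w + fderiv ℝ e (h.symm y) w = v := h4
    have h6 := hlow (h.symm y) w
    have h7 : (ContinuousLinearMap.id ℝ E + fderiv ℝ e (h.symm y)) w = v := h5
    rw [h7] at h6
    have h8 : (fderiv ℝ h.symm y - ContinuousLinearMap.id ℝ E) v = -fderiv ℝ e (h.symm y) w := by
      change w - v = _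
      rw [← h5]
      abel
    rw [h8, norm_neg]
    have h9 := (fderiv ℝ e (h.symm y)).le_of_opNorm_le (h1 _) w
    nlinarith [NNReal.coe_nonneg c]

/-! ### Smooth convergence away from the origin -/

theorem TendstoSmoothly.eventually_fderiv {f : ℝ → S6 → R7} {g : S6 → R7}
    (h : TendstoSmoothly f g) {e : ℝ} (he : 0 < e) :
    ∀ᶠ l in 𝓝[>] (0 : ℝ), ∀ x ∈ sphere (0 : R7) 1,
      ‖fderiv ℝ (radialExt (f l)) x - fderiv ℝ (radialExt g) x‖ ≤ e := by
  filter_upwards [Metric.tendstoUniformlyOn_iff.1 (h 1) e he] with l hl x hx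
  have h1 := (hl x hx).le
  rw [dist_comm, dist_eq_norm] at h1
  refine ContinuousLinearMap.opNorm_le_bound _ he.le fun v => ?_
  have h2 := (iteratedFDeriv ℝ 1 (radialExt (f l)) x - iteratedFDeriv ℝ 1 (radialExt g) x).le_opNorm
    fun _ => v
  rw [sub_apply, iteratedFDeriv_one_apply, iteratedFDeriv_one_apply] at h2
  simp only [Finset.prod_const, Finset.card_univ, Fintype.card_fin, pow_one] at h2
  exact h2.trans (mul_le_mul_of_nonneg_right h1 (norm_nonneg v))

/-- The extension is homogeneous of degree `0` and its differential of degree `-1`, so outside the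
ball of radius `1/4` bounds from the sphere worsen by at most the factor `4`. -/
theorem TendstoSmoothly.eventually_radialExt {f : ℝ → S6 → R7} {g : S6 → R7}
    (h : TendstoSmoothly f g) {e : ℝ} (he : 0 < e) :
    ∀ᶠ l in 𝓝[>] (0 : ℝ), ∀ x : R7, 1 / 4 ≤ ‖x‖ →
      ‖radialExt (f l) x - radialExt g x‖ < e ∧
      ‖fderiv ℝ (radialExt (f l)) x - fderiv ℝ (radialExt g) x‖ < e := by
  filter_upwards [h.eventually_dist_lt he, h.eventually_fderiv (div_pos he (by norm_num : (0:ℝ) < 5))]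
    with l h1 h2 x hx
  have hx0 : 0 < ‖x‖ := lt_of_lt_of_le (by norm_num) hx
  have hx1 : x ≠ 0 := norm_pos_iff.1 hx0
  have hm : ‖x‖⁻¹ • x ∈ sphere (0 : R7) 1 := by
    rw [mem_sphere_zero_iff_norm, norm_smul, norm_inv, norm_norm, inv_mul_cancel₀ hx0.ne']
  constructor
  · have h3 := h1 ⟨_, hm⟩
    rw [dist_eq_norm] at h3
    rw [radialExt, radialExt, dif_pos hx1, dif_pos hx1]
    exact h3
  · have h6 : ∀ (a : ℝ) (A B : R7 →L[ℝ] R7), ‖a • A - a • B‖ = ‖a‖ * ‖A - B‖ := fun a A B => by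
      have h7 : a • A - a • B = a • (A - B) := by
        ext v
        simp [mul_sub]
      rw [h7, norm_smul]
    rw [fderiv_radialExt _ hx1, fderiv_radialExt _ hx1, h6, norm_inv, norm_norm]
    have h3 := h2 _ hm
    have h4 : ‖x‖⁻¹ ≤ 4 := by
      rw [inv_le_comm₀ hx0 (by norm_num)]
      linarith
    have h5 := mul_le_mul h4 h3 (norm_nonneg _) (by norm_num)
    linarith

section Composition

variable {E : Type*} [NormedAddCommGroup E] [NormedSpace ℝ E]

theorem hasFDerivAt_graph_comp {Q : R7 × R7 → E} (hQ : ContDiff ℝ ∞ Q) {u : R7 → R7} {x : R7}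
    (hu : DifferentiableAt ℝ u x) :
    HasFDerivAt (fun y => Q (y, u y))
      ((fderiv ℝ Q (x, u x)).comp ((ContinuousLinearMap.id ℝ R7).prod (fderiv ℝ u x))) x :=
  HasFDerivAt.comp x ((hQ.differentiable (by simp)) (x, u x)).hasFDerivAt
    ((hasFDerivAt_id x).prodMk hu.hasFDerivAt)

/-- The 1-jet of the composite is a continuous function `P` of the 1-jet of the map. It is uniformly
continuous near the compact set of 1-jets of the limit over the shell. -/
theorem TendstoSmoothly.eventually_comp {f : ℝ → S6 → R7} {g : S6 → R7}
    (h : TendstoSmoothly f g) (hf : ∀ᶠ l in 𝓝[>] (0 : ℝ), ContMDiff (𝓡 6) 𝓘(ℝ, R7) ∞ (f l))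
    (hg : ContMDiff (𝓡 6) 𝓘(ℝ, R7) ∞ g) {Q : R7 × R7 → E} (hQ : ContDiff ℝ ∞ Q) (R : ℝ)
    {e : ℝ} (he : 0 < e) :
    ∀ᶠ l in 𝓝[>] (0 : ℝ), ∀ x : R7, 1 / 4 ≤ ‖x‖ → ‖x‖ ≤ R →
      ‖Q (x, radialExt (f l) x) - Q (x, radialExt g x)‖ < e ∧
      ‖fderiv ℝ (fun y => Q (y, radialExt (f l) y)) x -
        fderiv ℝ (fun y => Q (y, radialExt g y)) x‖ < e := by
  let P : R7 × R7 × (R7 →L[ℝ] R7) → E × (R7 →L[ℝ] E) := fun p =>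
    (Q (p.1, p.2.1), (fderiv ℝ Q (p.1, p.2.1)).comp ((ContinuousLinearMap.id ℝ R7).prod p.2.2))
  have hP : Continuous P := by
    have h1 : Continuous fun p : R7 × R7 × (R7 →L[ℝ] R7) => (p.1, p.2.1) := by fun_prop
    refine (hQ.continuous.comp h1).prodMk (Continuous.clm_comp
      ((hQ.continuous_fderiv (by simp)).comp h1) ?_)
    exact (ContinuousLinearMap.prodₗᵢ (𝕜 := ℝ) (E := R7) (F := R7) (G := R7) ℝ).continuous.comp
      (continuous_const.prodMk continuous_snd.snd)
  let A : Set R7 := {x | 1 / 4 ≤ ‖x‖} ∩ closedBall 0 R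
  have hA : IsCompact A := (isCompact_closedBall 0 R).inter_left
    (isClosed_le continuous_const continuous_norm)
  have hA0 : ∀ x : R7, 1 / 4 ≤ ‖x‖ → x ≠ 0 := fun x hx =>
    norm_pos_iff.1 (lt_of_lt_of_le (by norm_num) hx)
  let u : R7 → R7 × R7 × (R7 →L[ℝ] R7) := fun x => (x, radialExt g x, fderiv ℝ (radialExt g) x)
  have hu : ContinuousOn u A := by
    intro x hx
    have h1 := contDiffAt_radialExt hg (hA0 x hx.1)
    exact (continuousAt_id.prodMk (h1.continuousAt.prodMk
      (h1.fderiv_right (m := 0) (by simp)).continuousAt)).continuousWithinAt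
  have hK := (hA.image_of_continuousOn hu).uniformContinuousAt_of_continuousAt P
    (fun a _ => hP.continuousAt) (Metric.dist_mem_uniformity he)
  obtain ⟨d, hd, hdK⟩ := Metric.mem_uniformity_dist.1 hK
  filter_upwards [h.eventually_radialExt hd, hf] with l hl hfl x hx hxR
  obtain ⟨h1, h2⟩ := hl x hx
  have hxA : x ∈ A := ⟨hx, by simpa using hxR⟩
  have h3 : dist (u x) (x, radialExt (f l) x, fderiv ℝ (radialExt (f l)) x) < d := by
    simp only [u, Prod.dist_eq, dist_self]
    rw [dist_comm, dist_eq_norm, dist_comm, dist_eq_norm]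
    exact max_lt hd (max_lt h1 h2)
  have h4 : dist (P (u x)) (P (x, radialExt (f l) x, fderiv ℝ (radialExt (f l)) x)) < e :=
    hdK h3 (mem_image_of_mem _ hxA)
  rw [Prod.dist_eq, max_lt_iff, dist_comm, dist_eq_norm, dist_comm, dist_eq_norm] at h4
  rw [(hasFDerivAt_graph_comp hQ ((contDiffAt_radialExt hg (hA0 x hx)).differentiableAt
    (by simp))).fderiv, (hasFDerivAt_graph_comp hQ ((contDiffAt_radialExt hfl
    (hA0 x hx)).differentiableAt (by simp))).fderiv]
  exact h4

end Composition

/-! ### Correction of the boundary values -/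

/-- A smooth left inverse of an injective map `(i, s)` of the sphere, where `i` is an immersion. -/
theorem exists_left_inverse {i : S6 → R7} (hi : ContMDiff (𝓡 6) 𝓘(ℝ, R7) ∞ i)
    (himm : ∀ x, Function.Injective (mvfderiv (𝓡 6) i x)) {s : S6 → ℝ} (hs : Continuous s)
    (hinj : ∀ x y, i x = i y → s x = s y → x = y) :
    ∃ κ : R7 × ℝ → R7, ContDiff ℝ ∞ κ ∧ HasCompactSupport κ ∧ ∀ x : S6, κ (i x, s x) = x := by
  let j : S6 → R7 × ℝ := fun x => (i x, s x)
  have hj : Continuous j := hi.continuous.prodMk hs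
  have hjinj : Function.Injective j := fun x y h =>
    hinj x y (congrArg Prod.fst h) (congrArg Prod.snd h)
  have hje := hj.isClosedEmbedding hjinj
  -- To be a left inverse is a convex condition at each point, so local left inverses from the
  -- collars glue by a partition of unity.
  let t : R7 × ℝ → Set R7 := fun z => {v | ∀ w : S6, j w = z → v = w}
  have ht : ∀ z, Convex ℝ (t z) := by
    intro z v hv v' hv' a b _ _ hab w hw
    rw [hv w hw, hv' w hw, ← add_smul, hab, one_smul]
  have hloc : ∀ z, ∃ U ∈ 𝓝 z, ∃ g : R7 × ℝ → R7,
      ContMDiffOn 𝓘(ℝ, R7 × ℝ) 𝓘(ℝ, R7) ((⊤ : ℕ∞) : ℕ∞ω) g U ∧ ∀ y ∈ U, g y ∈ t y := by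
    intro z
    by_cases hz : z ∈ range j
    · obtain ⟨x, rfl⟩ := hz
      obtain ⟨n, hn⟩ := exists_not_mem_range hi x
      obtain ⟨e, hes, hee, hsm⟩ := exists_collar_inverse hi (himm x) hn
      have h1 : ∀ᶠ z in 𝓝 (j x), ContDiffAt ℝ ∞ (fun z : R7 × ℝ => e.symm z.1) z := by
        filter_upwards [(continuous_fst.tendsto (j x)).eventually hsm] with z hz
        exact hz.comp z contDiffAt_fst
      have h2 : ∀ᶠ z in 𝓝 (j x), ∀ w : S6, j w = z → (w : R7) ∈ e.source := by
        -- Since `j` is an embedding, a point of the sphere whose image is close to `j x` is itself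
        -- close to `x`, within the domain of the chosen collar.
        have h3 : {w : S6 | (w : R7) ∈ e.source} ∈ 𝓝 x :=
          (e.open_source.preimage continuous_subtype_val).mem_nhds hes
        rw [hje.isEmbedding.nhds_eq_comap, mem_comap] at h3
        obtain ⟨V, hV, hVs⟩ := h3
        filter_upwards [hV] with z hz w hw
        exact hVs (show j w ∈ V by rw [hw]; exact hz)
      refine ⟨_, h1.and h2, fun z => e.symm z.1, fun z hz =>
        hz.1.contDiffWithinAt.contMDiffWithinAt, ?_⟩
      rintro z ⟨-, hz⟩ w rfl
      have h3 := e.left_inv (hz w rfl)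
      rw [hee, collarMap_sphere] at h3
      exact h3
    · refine ⟨(range j)ᶜ, hje.isClosed_range.isOpen_compl.mem_nhds hz, fun _ => 0,
        contMDiffOn_const, ?_⟩
      intro y hy w hw
      exact absurd ⟨w, hw⟩ hy
  obtain ⟨κ, hκ⟩ := exists_contMDiffMap_forall_mem_convex_of_local 𝓘(ℝ, R7 × ℝ) ht hloc
  obtain ⟨R, hR⟩ := (isCompact_range hj).isBounded.subset_closedBall 0
  let b : ContDiffBump (0 : R7 × ℝ) := ⟨max R 1, max R 1 + 1, by positivity, by linarith⟩
  refine ⟨fun z => b z • κ z, b.contDiff.smul κ.contMDiff.contDiff,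
    b.hasCompactSupport.smul_right, fun x => ?_⟩
  have h1 : b (j x) = 1 := b.one_of_mem_closedBall
    (closedBall_subset_closedBall (le_max_left _ _) (hR (mem_range_self x)))
  change b (j x) • κ (j x) = x
  rw [h1, one_smul]
  exact hκ (j x) x rfl

theorem exists_bound_of_contDiff {E F : Type*} [NormedAddCommGroup E] [NormedSpace ℝ E]
    [NormedAddCommGroup F] [NormedSpace ℝ F] {f : E → F} (hf : ContDiff ℝ ∞ f)
    (hc : HasCompactSupport f) :
    ∃ C > 0, ∀ x, ‖f x‖ ≤ C ∧ ‖fderiv ℝ f x‖ ≤ C := by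
  obtain ⟨C, hC⟩ := hc.exists_bound_of_continuous hf.continuous
  obtain ⟨D, hD⟩ := (hc.fderiv ℝ).exists_bound_of_continuous (hf.continuous_fderiv (by simp))
  exact ⟨max (max C D) 1, by positivity, fun x =>
    ⟨(hC x).trans ((le_max_left _ _).trans (le_max_left _ _)),
      (hD x).trans ((le_max_right _ _).trans (le_max_left _ _))⟩⟩

/-- With `κ` a left inverse of the limit data, the map `z ↦ z + f_l (κ z)` carries limit data to the
data for `l`, and `Φ` is its inverse. In this direction `κ` depends only on the limit, and `f_l` is
small in `C¹`. -/
theorem exists_correction {ι : ℝ → S6 → R7}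
    (hι : ∀ᶠ l in 𝓝[>] (0 : ℝ), ContMDiff (𝓡 6) 𝓘(ℝ, R7) ∞ (ι l))
    (h0 : ContMDiff (𝓡 6) 𝓘(ℝ, R7) ∞ (ι 0))
    (himm : ∀ x, Function.Injective (mvfderiv (𝓡 6) (ι 0) x))
    (ht : TendstoSmoothly ι (ι 0)) {μ ξ : R7 → ℝ} (hμ : ContDiff ℝ ∞ μ) (hξ : ContDiff ℝ ∞ ξ)
    (hinj : ∀ x y : S6, ι 0 x = ι 0 y → μ x * ξ (ι 0 x) = μ y * ξ (ι 0 y) → x = y)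
    {δ : ℝ} (hδ : 0 < δ) :
    ∀ᶠ l in 𝓝[>] (0 : ℝ), ∃ Φ : R7 × ℝ → R7 × ℝ, ContDiff ℝ ∞ Φ ∧
      (∀ x : S6, Φ (ι l x, μ x * ξ (ι l x)) = (ι 0 x, μ x * ξ (ι 0 x))) ∧
      ∀ z, ‖Φ z - z‖ ≤ δ ∧ ‖fderiv ℝ Φ z - ContinuousLinearMap.id ℝ (R7 × ℝ)‖ ≤ δ := by
  obtain ⟨κ, hκ, hκc, hκx⟩ := exists_left_inverse h0 himm
    (s := fun x => μ x * ξ (ι 0 x)) ((hμ.continuous.comp continuous_subtype_val).mul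
      (hξ.continuous.comp h0.continuous)) hinj
  obtain ⟨C, hC, hκC⟩ := exists_bound_of_contDiff hκ hκc
  let b : ContDiffBump (0 : R7) := ⟨1 / 4, 1 / 2, by norm_num, by norm_num⟩
  -- The cutoff removes a neighbourhood of the origin, where radial extensions need not be smooth;
  -- `κ` may take values there.
  let ζ : R7 → ℝ := fun x => 1 - b x
  have hζ : ContDiff ℝ ∞ ζ := contDiff_const.sub b.contDiff
  have hζ1 : ∀ x : S6, ζ x = 1 := fun x => by
    have : b (x : R7) = 0 := b.zero_of_le_dist (by
      rw [dist_zero_right, mem_sphere_zero_iff_norm.1 x.2]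
      change (1 / 2 : ℝ) ≤ 1
      norm_num)
    change 1 - b (x : R7) = 1
    rw [this, sub_zero]
  have hζ0 : ∀ x : R7, ‖x‖ < 1 / 4 → ζ =ᶠ[𝓝 x] fun _ => 0 := fun x hx => by
    have : (b : R7 → ℝ) =ᶠ[𝓝 x] 1 := b.eventuallyEq_one_of_mem_ball (mem_ball_zero_iff.2 hx)
    filter_upwards [this] with y hy
    change 1 - b y = 0
    rw [hy, Pi.one_apply, sub_self]
  let Q : R7 × R7 → R7 × ℝ := fun p => ζ p.1 • (p.2, μ p.1 * ξ p.2)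
  have hQ : ContDiff ℝ ∞ Q := (hζ.comp contDiff_fst).smul
    (contDiff_snd.prodMk ((hμ.comp contDiff_fst).mul (hξ.comp contDiff_snd)))
  let f : ℝ → R7 → R7 × ℝ := fun l x => Q (x, radialExt (ι l) x) - Q (x, radialExt (ι 0) x)
  -- The bound `1/2` makes the perturbation invertible; `δ / 2` compensates the factor `2` in the
  -- estimate for the inverse.
  set c : ℝ := min (1 / 2) (δ / 2) with hc
  have hc0 : 0 < c := lt_min (by norm_num) (by linarith)
  have he : 0 < min c (c / C) := lt_min hc0 (div_pos hc0 hC)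
  filter_upwards [hι, ht.eventually_comp hι h0 hQ C he] with l hl hlQ
  have hf0 : ∀ x : R7, ‖x‖ < 1 / 4 → f l =ᶠ[𝓝 x] fun _ => 0 := fun x hx => by
    filter_upwards [hζ0 x hx] with y hy
    simp only [f, Q, hy, zero_smul, sub_zero]
  have hQd : ∀ g : S6 → R7, ContMDiff (𝓡 6) 𝓘(ℝ, R7) ∞ g → ∀ x : R7, x ≠ 0 →
      ContDiffAt ℝ ∞ (fun y => Q (y, radialExt g y)) x := fun g hg x hx =>
    hQ.contDiffAt.comp x (contDiffAt_id.prodMk (contDiffAt_radialExt hg hx))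
  have hx0 : ∀ x : R7, 1 / 4 ≤ ‖x‖ → x ≠ 0 := fun x hx =>
    norm_pos_iff.1 (lt_of_lt_of_le (by norm_num) hx)
  have hfs : ContDiff ℝ ∞ (f l) := contDiff_iff_contDiffAt.2 fun x => by
    rcases lt_or_ge ‖x‖ (1 / 4) with hx | hx
    · exact contDiffAt_const.congr_of_eventuallyEq (hf0 x hx)
    · exact (hQd _ hl x (hx0 x hx)).sub (hQd _ h0 x (hx0 x hx))
  have hfb : ∀ x : R7, ‖x‖ ≤ C → ‖f l x‖ ≤ c ∧ ‖fderiv ℝ (f l) x‖ ≤ c / C := fun x hxC => by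
    rcases lt_or_ge ‖x‖ (1 / 4) with hx | hx
    · rw [(hf0 x hx).fderiv_eq, (hf0 x hx).eq_of_nhds]
      simp only [norm_zero, fderiv_fun_const, Pi.zero_apply]
      exact ⟨hc0.le, (div_pos hc0 hC).le⟩
    · obtain ⟨h1, h2⟩ := hlQ x hx hxC
      rw [← fderiv_fun_sub ((hQd _ hl x (hx0 x hx)).differentiableAt (by simp))
        ((hQd _ h0 x (hx0 x hx)).differentiableAt (by simp))] at h2
      exact ⟨h1.le.trans (min_le_left _ _), h2.le.trans (min_le_right _ _)⟩
  obtain ⟨Φ, hΦ, hΦinv, hΦb⟩ := exists_inverse_of_small (e := fun z => f l (κ z)) (c := c)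
    (hfs.comp hκ) (min_le_left _ _) (fun z => (hfb _ (hκC z).1).1) (fun z => by
      have h1 : fderiv ℝ (fun z => f l (κ z)) z = (fderiv ℝ (f l) (κ z)).comp (fderiv ℝ κ z) :=
        fderiv_comp z ((hfs.differentiable (by simp)) _) ((hκ.differentiable (by simp)) _)
      rw [h1]
      refine (ContinuousLinearMap.opNorm_comp_le _ _).trans ?_
      have h2 := mul_le_mul (hfb _ (hκC z).1).2 (hκC z).2 (norm_nonneg _) (div_pos hc0 hC).le
      rwa [div_mul_cancel₀ _ hC.ne'] at h2)
  have hcδ : 2 * c ≤ δ := by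
    have := min_le_right (1 / 2) (δ / 2)
    linarith
  refine ⟨Φ, hΦ, fun x => ?_, fun z => ⟨(hΦb z).1.trans (by linarith), (hΦb z).2.trans hcδ⟩⟩
  have h1 := hΦinv (ι 0 x, μ x * ξ (ι 0 x))
  have h2 : (ι 0 x, μ x * ξ (ι 0 x)) + f l x = (ι l x, μ x * ξ (ι l x)) := by
    simp only [f, Q, radialExt_sphere, hζ1, one_smul]
    exact add_sub_cancel _ _
  rwa [hκx, h2] at h1

/-! ### The height function between the two sheets -/

/-- A smooth function near the sphere which is constant on the two parts of the boundary near the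
origin, with the values of `t / (|z|² + l)` there. -/
theorem IsPinchingFamily.exists_sheet_function {Λ : ℝ} {Ω : ℝ → Set R7} {ι : ℝ → S6 → R7}
    (h : IsPinchingFamily Λ Ω ι) :
    ∃ a > 0, (∀ l ∈ Ioo 0 Λ, IsSlabNear (8 * a) l (Ω l)) ∧
      ∃ μ : R7 → ℝ, ContDiff ℝ ∞ μ ∧ (∀ x y : S6, ι 0 x = 0 → ι 0 y = 0 → μ x = μ y → x = y) ∧
        (∀ x : S6, ‖ι 0 x‖ < 8 * a → ∃ c, ∀ᶠ y in 𝓝 (x : R7), μ y = c) ∧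
        ∀ᶠ l in 𝓝[>] (0 : ℝ), ∀ x : S6, ‖ι l x‖ ≤ 5 * a →
          tCoord (ι l x) / (zNormSq (ι l x) + l) = μ x := by
  obtain ⟨p, q, hpq, hp, hq, hz, ⟨Wp, hWp, hWp'⟩, ⟨Wq, hWq, hWq'⟩⟩ := h.exists_two_points
  obtain ⟨r, hr, hslab⟩ := h.near_origin
  obtain ⟨d, hd, hdW⟩ := Metric.mem_nhds_iff.1 hWq
  have hpq' : 0 < dist p q := dist_pos.2 hpq
  set s := min d (dist p q) / 4 with hs
  have hs0 : 0 < s := by positivity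
  have hsd : 2 * s < d := by have := min_le_left d (dist p q); linarith
  have hspq : 2 * s < dist p q := by have := min_le_right d (dist p q); linarith
  let μ : ContDiffBump (q : R7) := ⟨s, 2 * s, hs0, by linarith⟩
  have hμ1 : ∀ x : S6, dist x q < s → ∀ᶠ y in 𝓝 (x : R7), μ y = 1 := fun x hx =>
    μ.eventuallyEq_one_of_mem_ball (x := (x : R7)) hx
  have hμ0 : ∀ x : S6, 2 * s < dist x q → ∀ᶠ y in 𝓝 (x : R7), μ y = 0 := fun x hx => by
    have h1 : ∀ᶠ y in 𝓝 (x : R7), 2 * s < dist y (q : R7) :=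
      (isOpen_lt continuous_const (continuous_id.dist continuous_const)).mem_nhds hx
    filter_upwards [h1] with y hy
    exact μ.zero_of_le_dist hy.le
  -- Off the two regions where `μ` is known to be locally constant, `ι_0` does not vanish, hence its
  -- norm has a positive lower bound `ρ`.
  let K : Set S6 := ({x | 2 * s < dist x q} ∩ interior Wp ∪ {x | dist x q < s})ᶜ
  have hK : IsCompact K := by
    refine IsClosed.isCompact (isOpen_compl_iff.1 ?_)
    rw [compl_compl]
    exact ((isOpen_lt continuous_const (continuous_id.dist continuous_const)).inter
      isOpen_interior).union (isOpen_lt (continuous_id.dist continuous_const) continuous_const)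
  have hpos : ∀ x ∈ K, 0 < ‖ι 0 x‖ := by
    intro x hx
    rw [norm_pos_iff]
    intro h0
    rcases hz x h0 with rfl | rfl
    · exact hx (Or.inl ⟨hspq, mem_interior_iff_mem_nhds.2 hWp⟩)
    · exact hx (Or.inr (by
        change dist x x < s
        rw [dist_self]; exact hs0))
  obtain ⟨ρ, hρ, hρK⟩ := hK.exists_forall_le' h.continuous_limit.norm.continuousOn hpos
  -- The unit of length: the radii `2a, 3a` and `4a, 5a` of the later cutoffs stay below `8a`, where
  -- slab and sheets are controlled, with room for a displacement `a` from `ι_l` to `ι_0`.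
  set a := min ρ r / 8 with ha
  have ha0 : 0 < a := by positivity
  have haρ : 8 * a ≤ ρ := by have := min_le_left ρ r; linarith
  have har : 8 * a ≤ r := by have := min_le_right ρ r; linarith
  have hcase : ∀ x : S6, ‖ι 0 x‖ < 8 * a →
      (2 * s < dist x q ∧ x ∈ Wp) ∨ dist x q < s := by
    intro x hx
    by_contra hne
    refine absurd (hρK x fun hx' => hne ?_) (not_le.2 (hx.trans_le haρ))
    rcases hx' with h1 | h1
    · exact Or.inl ⟨h1.1, interior_subset h1.2⟩
    · exact Or.inr h1
  refine ⟨a, ha0, fun l hl x hx => hslab l hl x (ball_subset_ball har hx), μ, μ.contDiff,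
    ?_, ?_, ?_⟩
  · have h1 : μ (p : R7) = 0 := (hμ0 p hspq).self_of_nhds
    have h2 : μ (q : R7) = 1 := (hμ1 q (by rw [dist_self]; exact hs0)).self_of_nhds
    intro x y hx hy hxy
    rcases hz x hx with rfl | rfl <;> rcases hz y hy with rfl | rfl
    · rfl
    · exact absurd (h1.symm.trans (hxy.trans h2)) zero_ne_one
    · exact absurd (h1.symm.trans (hxy.symm.trans h2)) zero_ne_one
    · rfl
  · intro x hx
    rcases hcase x hx with h1 | h1
    · exact ⟨0, hμ0 x h1.1⟩
    · exact ⟨1, hμ1 x h1⟩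
  · filter_upwards [h.tendsto.eventually_dist_lt ha0, hWp', hWq', self_mem_nhdsWithin]
      with l hl hlp hlq hl0 x hx
    have hl0 : 0 < l := hl0
    have h1 : ‖ι 0 x‖ < 8 * a := by
      have h2 := hl x
      have h3 := norm_le_norm_add_norm_sub' (ι 0 x) (ι l x)
      rw [dist_comm, dist_eq_norm] at h2
      linarith
    rcases hcase x h1 with h2 | h2
    · rw [hlp x h2.2, zero_div, (hμ0 x h2.1).self_of_nhds]
    · have h3 : dist x q < d := by linarith
      rw [hlq x (hdW h3), (hμ1 x h2).self_of_nhds, div_self]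
      exact (add_pos_of_nonneg_of_pos (zNormSq_nonneg _) hl0).ne'

/-- The height `t / (|z|² + l)` between the two sheets, cut off away from the origin. -/
def slabHeight (ξ : R7 → ℝ) (l : ℝ) (y : R7) : ℝ := ξ y * (tCoord y / (zNormSq y + l))

section Height

variable {ξ : R7 → ℝ}

theorem contDiffAt_slabHeight (hξ : ContDiff ℝ ∞ ξ) {l : ℝ} {y : R7} (hy : zNormSq y + l ≠ 0) :
    ContDiffAt ℝ ∞ (fun p : ℝ × R7 => slabHeight ξ p.1 p.2) (l, y) := by
  refine ContDiffAt.mul (hξ.comp contDiff_snd).contDiffAt (ContDiffAt.div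
    (contDiff_tCoord.comp contDiff_snd).contDiffAt
    ((contDiff_zNormSq.comp contDiff_snd).add contDiff_fst).contDiffAt hy)

theorem contDiff_slabHeight (hξ : ContDiff ℝ ∞ ξ) {l : ℝ} (hl : 0 < l) :
    ContDiff ℝ ∞ (slabHeight ξ l) :=
  contDiff_iff_contDiffAt.2 fun y => (contDiffAt_slabHeight hξ
    (add_pos_of_nonneg_of_pos (zNormSq_nonneg y) hl).ne').comp y
      (contDiffAt_const.prodMk contDiffAt_id)

/-- The denominator vanishes in the closed slab only at the origin with `l = 0`. So the height is
smooth near a compact set which includes `l = 0`, and the bound does not deteriorate as `l → 0`. -/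
theorem exists_bound_fderiv_slabHeight (hξ : ContDiff ℝ ∞ ξ) {a : ℝ} (ha : 0 < a)
    (hξ0 : ∀ y, 5 * a ≤ ‖y‖ → ξ y = 0) :
    ∃ M, 0 ≤ M ∧ ∀ l ∈ Ioc (0 : ℝ) 1, ∀ y : R7, a ≤ ‖y‖ →
      (‖y‖ < 8 * a → 0 ≤ tCoord y ∧ tCoord y ≤ zNormSq y + l) →
      ‖fderiv ℝ (slabHeight ξ l) y‖ ≤ M := by
  let K : Set (ℝ × R7) := (Icc 0 1 ×ˢ closedBall 0 (5 * a)) ∩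
    {p | a ≤ ‖p.2‖ ∧ 0 ≤ tCoord p.2 ∧ tCoord p.2 ≤ zNormSq p.2 + p.1}
  have hK : IsCompact K := (isCompact_Icc.prod (isCompact_closedBall 0 (5 * a))).inter_right
    ((isClosed_le continuous_const continuous_snd.norm).inter
      ((isClosed_le continuous_const (continuous_tCoord.comp continuous_snd)).inter
        (isClosed_le (continuous_tCoord.comp continuous_snd)
          ((continuous_zNormSq.comp continuous_snd).add continuous_fst))))
  have hne : ∀ p ∈ K, zNormSq p.2 + p.1 ≠ 0 := by
    rintro ⟨l, y⟩ ⟨⟨hl, -⟩, hy, ht0, ht⟩ h0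
    have hl : 0 ≤ l := hl.1
    have hz := zNormSq_nonneg y
    simp only at hy ht0 ht h0
    have hn := norm_sq_eq y
    have h1 : tCoord y = 0 := by linarith
    have h2 : zNormSq y = 0 := by linarith
    rw [h1, h2] at hn
    have : ‖y‖ = 0 := by simpa using hn
    linarith
  have hc : ContinuousOn (fun p => ‖fderiv ℝ (fun p : ℝ × R7 => slabHeight ξ p.1 p.2) p‖) K :=
    fun p hp => ((contDiffAt_slabHeight hξ (hne p hp)).fderiv_right (m := 0)
      (by simp)).continuousAt.norm.continuousWithinAt
  obtain ⟨M, hM⟩ := (hK.image_of_continuousOn hc).bddAbove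
  refine ⟨max M 0, le_max_right _ _, fun l hl y hy hslab => ?_⟩
  rcases lt_or_ge (5 * a) ‖y‖ with h5 | h5
  · have h1 : slabHeight ξ l =ᶠ[𝓝 y] fun _ => 0 := by
      filter_upwards [(isOpen_lt continuous_const continuous_norm).mem_nhds h5] with w hw
      rw [slabHeight, hξ0 w (le_of_lt hw), zero_mul]
    rw [h1.fderiv_eq]
    simp
  · obtain ⟨ht0, ht⟩ := hslab (by linarith)
    have hmem : (l, y) ∈ K := ⟨⟨⟨hl.1.le, hl.2⟩, by simpa using h5⟩, hy, ht0, ht⟩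
    have h1 := hM (mem_image_of_mem _ hmem)
    have h2 : HasFDerivAt (slabHeight ξ l) ((fderiv ℝ (fun p : ℝ × R7 => slabHeight ξ p.1 p.2)
        (l, y)).comp (ContinuousLinearMap.inr ℝ ℝ R7)) y :=
      HasFDerivAt.comp y (((contDiffAt_slabHeight hξ (hne _ hmem)).differentiableAt
        (by simp)).hasFDerivAt) (hasFDerivAt_prodMk_right l y)
    rw [h2.fderiv]
    refine (ContinuousLinearMap.opNorm_comp_le _ _).trans ?_
    have h3 : ‖ContinuousLinearMap.inr ℝ ℝ R7‖ ≤ 1 := ContinuousLinearMap.norm_inr_le_one ℝ ℝ R7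
    have h4 := mul_le_mul h1 h3 (norm_nonneg _) ((norm_nonneg _).trans h1)
    rw [mul_one] at h4
    exact h4.trans (le_max_left _ _)

end Height

/-! ### Thickened flat forms -/

theorem isOpen_setOf_isPositive : IsOpen {φ : Form 3 | IsPositive φ} := by
  rw [Metric.isOpen_iff]
  intro φ hφ
  obtain ⟨δ, hδ, c, hc, D, h⟩ := exists_uniform_positive (isCompact_singleton (x := φ))
    (by rintro ψ rfl; exact hφ)
  refine ⟨δ, hδ, fun ψ hψ u hu => ?_⟩
  rw [Metric.thickening_singleton] at h
  have := norm_pos_iff.2 hu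
  exact lt_of_lt_of_le (by positivity) ((h ψ hψ).1 u)

theorem isPositive_of_comp {φ : Form 3} {B : R7 →L[ℝ] R7} (hB : 0 < B.det)
    (h : IsPositive (φ.compContinuousLinearMap B)) : IsPositive φ := by
  intro v hv
  obtain ⟨C, hC, -⟩ := exists_inverse_of_det_pos hB
  have h1 := h (C v) (fun h0 => hv (by rw [← hC v, h0, map_zero]))
  rw [conformalForm_comp, hC] at h1
  exact (mul_pos_iff_of_pos_left hB).1 h1

/-- The form `ω₀ ∧ dt`. -/
def omegaT : Form 3 := coordForm ![0, 1, 6] + coordForm ![2, 3, 6] + coordForm ![4, 5, 6]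

theorem omegaT_apply (u v w : R7) : omegaT ![u, v, w] =
    coordForm ![0, 1, 6] ![u, v, w] + coordForm ![2, 3, 6] ![u, v, w]
      + coordForm ![4, 5, 6] ![u, v, w] := rfl

theorem phi0_apply (u v w : R7) : phi0 ![u, v, w] = omegaT ![u, v, w] +
    coordForm ![0, 2, 4] ![u, v, w] - coordForm ![0, 3, 5] ![u, v, w]
      - coordForm ![1, 2, 5] ![u, v, w] - coordForm ![1, 3, 4] ![u, v, w] := rfl

theorem form3_ext {E : Type*} [AddCommGroup E] [Module ℝ E] [TopologicalSpace E]
    {φ ψ : E [⋀^Fin 3]→L[ℝ] ℝ} (h : ∀ u v w, φ ![u, v, w] = ψ ![u, v, w]) : φ = ψ := by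
  ext x
  have : x = ![x 0, x 1, x 2] := by
    ext i; fin_cases i <;> rfl
  rw [this]
  exact h _ _ _

theorem add_smul_tVec_apply_six (u : R7) (a : ℝ) : (u + a • tVec) 6 = u 6 + a :=
  tCoord_add_smul_tVec u a

theorem add_smul_tVec_apply (u : R7) (a : ℝ) {i : Fin 7} (hi : i ≠ 6) :
    (u + a • tVec) i = u i := by
  have : (6 : Fin 7) ≠ i := fun h => hi h.symm
  simp [tVec, stdVec_apply, this]

/-- The form is affine in `dt`, which enters only through `ω₀ ∧ dt`. -/
theorem phi0_add_smul_tVec (ε : ℝ) (u v w p q r : R7) (hp : ∀ i, i ≠ 6 → p i = u i)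
    (hq : ∀ i, i ≠ 6 → q i = v i) (hr : ∀ i, i ≠ 6 → r i = w i) :
    phi0 ![u + (ε * p 6) • tVec, v + (ε * q 6) • tVec, w + (ε * r 6) • tVec] =
      phi0 ![u, v, w] + ε * omegaT ![p, q, r] := by
  have h : ∀ i : Fin 7, i ≠ 6 → ∀ (x : R7) (a : ℝ), (x + a • tVec) i = x i :=
    fun i hi x a => add_smul_tVec_apply x a hi
  simp only [phi0_apply, omegaT_apply, coordForm_fin3, add_smul_tVec_apply_six,
    h 0 (by decide), h 1 (by decide), h 2 (by decide), h 3 (by decide), h 4 (by decide),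
    h 5 (by decide), hp 0 (by decide), hp 1 (by decide), hp 2 (by decide), hp 3 (by decide),
    hp 4 (by decide), hp 5 (by decide), hq 0 (by decide), hq 1 (by decide), hq 2 (by decide),
    hq 3 (by decide), hq 4 (by decide), hq 5 (by decide), hr 0 (by decide), hr 1 (by decide),
    hr 2 (by decide), hr 3 (by decide), hr 4 (by decide), hr 5 (by decide)]
  ring

/-- A linear map killing `dt`, or all the `dx_j`, pulls `ω₀ ∧ dt` back to zero. -/
theorem omegaT_comp_eq_zero {E : Type*} [AddCommGroup E] [Module ℝ E] [TopologicalSpace E]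
    {A : E →L[ℝ] R7} (h : (∀ v, A v 6 = 0) ∨ ∀ v, A v 0 = 0 ∧ A v 2 = 0 ∧ A v 4 = 0) :
    omegaT.compContinuousLinearMap A = 0 := by
  refine form3_ext fun u v w => ?_
  rw [comp_fin3, omegaT_apply, coordForm_fin3, coordForm_fin3, coordForm_fin3]
  rcases h with h | h
  · simp [h]
  · simp [(h u).1, (h u).2.1, (h u).2.2, (h v).1, (h v).2.1, (h v).2.2, (h w).1, (h w).2.1,
      (h w).2.2]

/-- The part `(x₁, 0, x₂, 0, x₃, 0, 0)` of a vector. -/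
def realPart : R7 →L[ℝ] R7 :=
  (EuclideanSpace.proj (0 : Fin 7) : R7 →L[ℝ] ℝ).smulRight (stdVec 0) +
    (EuclideanSpace.proj (2 : Fin 7) : R7 →L[ℝ] ℝ).smulRight (stdVec 2) +
    (EuclideanSpace.proj (4 : Fin 7) : R7 →L[ℝ] ℝ).smulRight (stdVec 4)

/-- The part `(0, y₁, 0, y₂, 0, y₃, 0)` of a vector. -/
def imagPart : R7 →L[ℝ] R7 :=
  (EuclideanSpace.proj (1 : Fin 7) : R7 →L[ℝ] ℝ).smulRight (stdVec 1) +
    (EuclideanSpace.proj (3 : Fin 7) : R7 →L[ℝ] ℝ).smulRight (stdVec 3) +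
    (EuclideanSpace.proj (5 : Fin 7) : R7 →L[ℝ] ℝ).smulRight (stdVec 5)

theorem realPart_apply (v : R7) (i : Fin 7) :
    realPart v i = if i = 0 ∨ i = 2 ∨ i = 4 then v i else 0 := by
  fin_cases i <;> simp [realPart, stdVec_apply]

theorem imagPart_apply (v : R7) (i : Fin 7) :
    imagPart v i = if i = 1 ∨ i = 3 ∨ i = 5 then v i else 0 := by
  fin_cases i <;> simp [imagPart, stdVec_apply]

/-- The map `(y, s) ↦ (χ x₁, y₁, χ x₂, y₂, χ x₃, y₃, s)`. -/
def mixMap (χ : R7 → ℝ) (z : R7 × ℝ) : R7 := χ z.1 • realPart z.1 + (imagPart z.1 + z.2 • tVec)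

/-- The map `mixMap` for the constant function `1`. -/
def mixLin : R7 × ℝ →L[ℝ] R7 :=
  (realPart + imagPart).comp (ContinuousLinearMap.fst ℝ R7 ℝ) +
    (ContinuousLinearMap.snd ℝ R7 ℝ).smulRight tVec

theorem mixLin_apply_six (z : R7 × ℝ) : mixLin z 6 = z.2 := by
  have : mixLin z = (realPart z.1 + imagPart z.1) + z.2 • tVec := rfl
  rw [this, add_smul_tVec_apply_six]
  simp [realPart_apply, imagPart_apply]

theorem mixLin_apply (z : R7 × ℝ) {i : Fin 7} (hi : i ≠ 6) : mixLin z i = z.1 i := by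
  have : mixLin z = (realPart z.1 + imagPart z.1) + z.2 • tVec := rfl
  rw [this, add_smul_tVec_apply _ _ hi, PiLp.add_apply, realPart_apply, imagPart_apply]
  fin_cases i <;> simp at hi ⊢

theorem mixMap_apply_six (χ : R7 → ℝ) (z : R7 × ℝ) : mixMap χ z 6 = z.2 := by
  rw [mixMap, ← add_assoc, add_smul_tVec_apply_six]
  simp [realPart_apply, imagPart_apply]

theorem mixMap_apply_real {χ : R7 → ℝ} {z : R7 × ℝ} (h : χ z.1 = 0) {i : Fin 7}
    (hi : i = 0 ∨ i = 2 ∨ i = 4) : mixMap χ z i = 0 := by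
  rw [mixMap, h, zero_smul, zero_add, add_smul_tVec_apply _ _ (by rcases hi with rfl | rfl | rfl <;> decide), imagPart_apply]
  rcases hi with rfl | rfl | rfl <;> simp

theorem contDiff_mixMap {χ : R7 → ℝ} (hχ : ContDiff ℝ ∞ χ) : ContDiff ℝ ∞ (mixMap χ) :=
  ((hχ.comp contDiff_fst).smul (realPart.contDiff.comp contDiff_fst)).add
    ((imagPart.contDiff.comp contDiff_fst).add (contDiff_snd.smul contDiff_const))

theorem fderiv_mixMap {χ : R7 → ℝ} {z : R7 × ℝ} (h : ∀ᶠ y in 𝓝 z.1, χ y = 1) :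
    fderiv ℝ (mixMap χ) z = mixLin := by
  have h1 : mixMap χ =ᶠ[𝓝 z] mixLin := by
    filter_upwards [(continuous_fst.tendsto z).eventually h] with w hw
    have : mixLin w = (realPart w.1 + imagPart w.1) + w.2 • tVec := rfl
    rw [mixMap, hw, one_smul, this, add_assoc]
  rw [h1.fderiv_eq, ContinuousLinearMap.fderiv]

theorem exists_bound_fderiv_mixMap {χ : R7 → ℝ} (hχ : ContDiff ℝ ∞ χ) (hc : HasCompactSupport χ) :
    ∃ C, ∀ z, ‖fderiv ℝ (mixMap χ) z‖ ≤ C := by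
  obtain ⟨C, hC, hCb⟩ := exists_bound_of_contDiff (f := fun y => χ y • realPart y)
    (hχ.smul realPart.contDiff) hc.smul_right
  let T : R7 × ℝ →L[ℝ] R7 := imagPart.comp (ContinuousLinearMap.fst ℝ R7 ℝ) +
    (ContinuousLinearMap.snd ℝ R7 ℝ).smulRight tVec
  refine ⟨C + ‖T‖, fun z => ?_⟩
  have h1 : HasFDerivAt (mixMap χ) ((fderiv ℝ (fun y => χ y • realPart y) z.1).comp
      (ContinuousLinearMap.fst ℝ R7 ℝ) + T) z :=
    HasFDerivAt.add (HasFDerivAt.comp z (((hχ.smul realPart.contDiff).differentiable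
      (by simp)) z.1).hasFDerivAt hasFDerivAt_fst) T.hasFDerivAt
  rw [h1.fderiv]
  refine (norm_add_le _ _).trans (add_le_add_left ?_ _)
  refine (ContinuousLinearMap.opNorm_comp_le _ _).trans ?_
  have h2 := mul_le_mul (hCb z.1).2 (ContinuousLinearMap.norm_fst_le ℝ R7 ℝ) (norm_nonneg _) hC.le
  rwa [mul_one] at h2

section Thick

variable {m : R7 × ℝ → R7} {ε : ℝ}

/-- The form `pr₁^* φ₀ + ε m^* (ω₀ ∧ dt)` at the point `z`, pulled back by `L`. -/
def thickForm (m : R7 × ℝ → R7) (ε : ℝ) (z : R7 × ℝ) (L : R7 →L[ℝ] R7 × ℝ) : Form 3 :=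
  phi0.compContinuousLinearMap ((ContinuousLinearMap.fst ℝ R7 ℝ).comp L) +
    ε • omegaT.compContinuousLinearMap ((fderiv ℝ m z).comp L)

theorem thickForm_comp (z : R7 × ℝ) (L : R7 →L[ℝ] R7 × ℝ) (A : R7 →L[ℝ] R7) :
    (thickForm m ε z L).compContinuousLinearMap A = thickForm m ε z (L.comp A) := rfl

theorem continuous_thickForm (hm : ContDiff ℝ ∞ m) {X : Type*} [TopologicalSpace X]
    {z : X → R7 × ℝ} (hz : Continuous z) {L : X → R7 →L[ℝ] R7 × ℝ} (hL : Continuous L) :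
    Continuous fun x => thickForm m ε (z x) (L x) := by
  have h1 : Continuous fun x => (fderiv ℝ m (z x)).comp (L x) :=
    ((hm.continuous_fderiv (by simp)).comp hz).clm_comp hL
  refine continuous_form fun I => ?_
  change Continuous fun x => phi0 (fun j => (L x (stdVec (I j))).1) +
    ε * omegaT (fun j => (fderiv ℝ m (z x)).comp (L x) (stdVec (I j)))
  have h2 : Continuous fun x => phi0 (fun j => (L x (stdVec (I j))).1) :=
    phi0.cont.comp (continuous_pi fun j => (hL.clm_apply continuous_const).fst)
  have h3 : Continuous fun x => omegaT (fun j => (fderiv ℝ m (z x)).comp (L x) (stdVec (I j))) :=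
    omegaT.cont.comp (continuous_pi fun j => h1.clm_apply continuous_const)
  exact h2.add (h3.const_mul ε)

theorem exists_isPositive_of_near_id :
    ∃ η > 0, ∀ (A : R7 →L[ℝ] R7) (T : Form 3), ‖A - ContinuousLinearMap.id ℝ R7‖ < η → ‖T‖ < η →
      IsPositive (phi0.compContinuousLinearMap A + T) := by
  let f : (R7 →L[ℝ] R7) × Form 3 → Form 3 := fun p => phi0.compContinuousLinearMap p.1 + p.2
  have h1 : Continuous fun p : (R7 →L[ℝ] R7) × Form 3 => phi0.compContinuousLinearMap p.1 := by
    refine continuous_form fun I => ?_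
    change Continuous fun p : (R7 →L[ℝ] R7) × Form 3 => phi0 (fun j => p.1 (stdVec (I j)))
    exact phi0.cont.comp (continuous_pi fun j => continuous_fst.clm_apply continuous_const)
  have hf : Continuous f := h1.add continuous_snd
  have h0 : f (ContinuousLinearMap.id ℝ R7, 0) = phi0 := by
    simp only [f, add_zero]
    rfl
  have h2 : f ⁻¹' {φ | IsPositive φ} ∈ 𝓝 (ContinuousLinearMap.id ℝ R7, (0 : Form 3)) :=
    (isOpen_setOf_isPositive.preimage hf).mem_nhds (by
      change IsPositive (f _)
      rw [h0]; exact isPositive_phi0)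
  obtain ⟨η, hη, hηs⟩ := Metric.mem_nhds_iff.1 h2
  refine ⟨η, hη, fun A T hA hT => hηs (a := (A, T)) ?_⟩
  rw [Metric.mem_ball, Prod.dist_eq, dist_eq_norm, dist_zero_right]
  exact max_lt hA hT

/-- The differential of `(z, t) ↦ (z, t')` at constant height between the sheets, where `D` is the
distance of the sheets. -/
def slabShear (y : R7) (s D : ℝ) : R7 →L[ℝ] R7 :=
  ContinuousLinearMap.id ℝ R7 +
    (s • fderiv ℝ zNormSq y + (D - 1) • tCoordL).smulRight tVec

theorem fderiv_zNormSq_tVec (y : R7) : fderiv ℝ zNormSq y tVec = 0 := by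
  refine fderiv_tVec (contDiff_zNormSq.differentiable (by simp) y) ?_
  simp only [zNormSq_add_smul_tVec]
  exact hasDerivAt_const _ _

theorem tCoordL_tVec : tCoordL tVec = 1 := by
  have := tCoord_smul_tVec 1
  rwa [one_smul] at this

theorem det_slabShear (y : R7) (s D : ℝ) : (slabShear y s D).det = D := by
  rw [slabShear, det_id_add_smulRight]
  simp [fderiv_zNormSq_tVec, tCoordL_tVec]

theorem slabShear_apply (y : R7) (s D : ℝ) (v : R7) :
    slabShear y s D v = v + (s * fderiv ℝ zNormSq y v + (D - 1) * tCoordL v) • tVec := rfl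

theorem continuous_slabShear : Continuous fun p : R7 × ℝ × ℝ => slabShear p.1 p.2.1 p.2.2 := by
  have h1 : Continuous fun p : R7 × ℝ × ℝ => p.2.1 • fderiv ℝ zNormSq p.1 +
      (p.2.2 - 1) • tCoordL := by
    have h2 := (contDiff_zNormSq.continuous_fderiv (by simp)).comp
      (continuous_fst : Continuous fun p : R7 × ℝ × ℝ => p.1)
    exact (continuous_snd.fst.smul h2).add ((continuous_snd.snd.sub continuous_const).smul
      continuous_const)
  exact continuous_const.add
    (((ContinuousLinearMap.smulRightL ℝ R7 R7).flip tVec).continuous.comp h1)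

theorem continuous_prod_clm {X E F G : Type*} [TopologicalSpace X] [NormedAddCommGroup E]
    [NormedSpace ℝ E] [NormedAddCommGroup F] [NormedSpace ℝ F] [NormedAddCommGroup G]
    [NormedSpace ℝ G] {A : X → E →L[ℝ] F} {B : X → E →L[ℝ] G} (hA : Continuous A)
    (hB : Continuous B) : Continuous fun x => (A x).prod (B x) :=
  (ContinuousLinearMap.prodₗᵢ (𝕜 := ℝ) (E := E) (F := F) (G := G) ℝ).continuous.comp
    (hA.prodMk hB)

/-- In the coordinates `(z, s)` one has `dt = s d|z|² + D ds`, so adding `ε ω₀ ∧ ds` turns `D` into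
`D + ε`. -/
theorem thickForm_slabShear {z : R7 × ℝ} (hm : fderiv ℝ m z = mixLin) (y : R7) (s D : ℝ) :
    thickForm m ε z ((slabShear y s D).prod tCoordL) =
      phi0.compContinuousLinearMap (slabShear y s (D + ε)) := by
  refine form3_ext fun u v w => ?_
  rw [comp_fin3, thickForm, hm, ContinuousAlternatingMap.add_apply,
    ContinuousAlternatingMap.smul_apply, comp_fin3, comp_fin3, smul_eq_mul]
  have h1 : ∀ u : R7, slabShear y s (D + ε) u = slabShear y s D u +
      (ε * (mixLin.comp ((slabShear y s D).prod tCoordL) u) 6) • tVec := by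
    intro u
    rw [ContinuousLinearMap.comp_apply, mixLin_apply_six, slabShear_apply, slabShear_apply,
      add_assoc, ← add_smul]
    congr 2
    change _ = _ + ε * tCoordL u
    ring
  have h2 : ∀ u : R7, ∀ i, i ≠ 6 → (mixLin.comp ((slabShear y s D).prod tCoordL) u) i =
      (slabShear y s D u) i := by
    intro u i hi
    rw [ContinuousLinearMap.comp_apply, mixLin_apply _ hi]
    rfl
  rw [h1 u, h1 v, h1 w, phi0_add_smul_tVec ε _ _ _ _ _ _ (h2 u) (h2 v) (h2 w)]
  rfl

/-- The thickened form on a sheared slab, composed with a linear map of the target. -/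
def shearedForm (m : R7 × ℝ → R7) (ε : ℝ)
    (p : (R7 × ℝ) × (R7 × ℝ →L[ℝ] R7 × ℝ) × (R7 × ℝ × ℝ)) : Form 3 :=
  thickForm m ε p.1 (p.2.1.comp ((slabShear p.2.2.1 p.2.2.2.1 p.2.2.2.2).prod tCoordL))

theorem continuous_shearedForm (hm : ContDiff ℝ ∞ m) : Continuous (shearedForm m ε) := by
  have h1 : Continuous fun p : (R7 × ℝ) × (R7 × ℝ →L[ℝ] R7 × ℝ) × (R7 × ℝ × ℝ) =>
      slabShear p.2.2.1 p.2.2.2.1 p.2.2.2.2 := continuous_slabShear.comp continuous_snd.snd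
  exact continuous_thickForm hm continuous_fst
    (continuous_snd.fst.clm_comp (continuous_prod_clm h1 continuous_const))

theorem shearedForm_id {y : R7} {s : ℝ} (hm : fderiv ℝ m (y, s) = mixLin) (D : ℝ) :
    shearedForm m ε ((y, s), ContinuousLinearMap.id ℝ (R7 × ℝ), (y, s, D)) =
      phi0.compContinuousLinearMap (slabShear y s (D + ε)) := by
  rw [shearedForm, ContinuousLinearMap.id_comp]
  exact thickForm_slabShear hm y s D

/-- Pulling back by the shear rescales the collapsing direction. The resulting forms extend
continuously to `D = 0` and are positive there, having determinant `D + ε ≥ ε`; compactness gives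
one `δ` for all thicknesses, and positivity passes back through the shear as `D > 0`. -/
theorem exists_isPositive_thickForm (hm : ContDiff ℝ ∞ m) {a : ℝ}
    (hma : ∀ z : R7 × ℝ, ‖z.1‖ ≤ a → fderiv ℝ m z = mixLin) (hε : 0 < ε) (R : ℝ) :
    ∃ δ > 0, ∀ (y : R7) (s D : ℝ), ‖y‖ ≤ a → s ∈ Icc 0 1 → D ∈ Ioc 0 R →
      ∀ (z : R7 × ℝ) (A : R7 × ℝ →L[ℝ] R7 × ℝ), ‖z - (y, s)‖ < δ →
        ‖A - ContinuousLinearMap.id ℝ (R7 × ℝ)‖ < δ → ∀ L : R7 →L[ℝ] R7 × ℝ,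
          L.comp (slabShear y s D) = A.comp ((slabShear y s D).prod tCoordL) →
          IsPositive (thickForm m ε z L) := by
  let g : R7 × ℝ × ℝ → (R7 × ℝ) × (R7 × ℝ →L[ℝ] R7 × ℝ) × (R7 × ℝ × ℝ) :=
    fun p => ((p.1, p.2.1), ContinuousLinearMap.id ℝ (R7 × ℝ), p)
  have hg : Continuous g := (continuous_fst.prodMk continuous_snd.fst).prodMk
    (continuous_const.prodMk continuous_id)
  let K : Set (R7 × ℝ × ℝ) := closedBall 0 a ×ˢ Icc 0 1 ×ˢ Icc 0 R
  have hK : IsCompact (g '' K) :=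
    ((isCompact_closedBall 0 a).prod (isCompact_Icc.prod isCompact_Icc)).image hg
  have hpos : g '' K ⊆ shearedForm m ε ⁻¹' {φ | IsPositive φ} := by
    rintro _ ⟨⟨y, s, D⟩, ⟨hy, -, hD⟩, rfl⟩
    change IsPositive (shearedForm m ε ((y, s), ContinuousLinearMap.id ℝ (R7 × ℝ), (y, s, D)))
    rw [shearedForm_id (hma (y, s) (mem_closedBall_zero_iff.1 hy))]
    refine isPositive_comp isPositive_phi0 ?_
    rw [det_slabShear]
    exact add_pos_of_nonneg_of_pos hD.1 hε
  obtain ⟨δ, hδ, hδK⟩ := hK.exists_thickening_subset_open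
    (isOpen_setOf_isPositive.preimage (continuous_shearedForm hm)) hpos
  refine ⟨δ, hδ, fun y s D hy hs hD z A hz hA L hL => ?_⟩
  refine isPositive_of_comp (B := slabShear y s D) (by rw [det_slabShear]; exact hD.1) ?_
  rw [thickForm_comp, hL]
  have h1 : (z, A, y, s, D) ∈ thickening δ (g '' K) := by
    refine Metric.mem_thickening_iff.2 ⟨g (y, s, D), mem_image_of_mem _
      ⟨mem_closedBall_zero_iff.2 hy, hs, hD.1.le, hD.2⟩, ?_⟩
    rw [← dist_eq_norm] at hz hA
    have h2 : dist (y, s, D) (y, s, D) < δ := by rw [dist_self]; exact hδ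
    exact max_lt hz (max_lt hA h2)
  have h3 : shearedForm m ε (z, A, y, s, D) ∈ {φ | IsPositive φ} := hδK h1
  exact h3

end Thick

/-! ### The closed filling of the limit -/

/-- Where the height has bounded differential the thickened form is a small perturbation of `phi0`:
`ε` controls the added term and `δ` the change of the flat part. -/
theorem exists_isPositive_thickForm_far {M : ℝ} (hM : 0 ≤ M) (C : ℝ) :
    ∃ ε > 0, ∃ δ > 0, ∀ (m : R7 × ℝ → R7) (z : R7 × ℝ) (A : R7 × ℝ →L[ℝ] R7 × ℝ) (T : R7 →L[ℝ] ℝ),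
      ‖fderiv ℝ m z‖ ≤ C → ‖A - ContinuousLinearMap.id ℝ (R7 × ℝ)‖ ≤ δ → ‖T‖ ≤ M →
        IsPositive (thickForm m ε z (A.comp ((ContinuousLinearMap.id ℝ R7).prod T))) := by
  obtain ⟨η, hη, hpos⟩ := exists_isPositive_of_near_id
  set B := max C 0 * (2 * (1 + M)) with hB
  have hB0 : 0 ≤ B := by positivity
  set N := ‖omegaT‖ * B ^ 3 + 1 with hN
  have hN0 : 0 < N := by positivity
  -- The bound `1` gives `‖A‖ ≤ 2`, used in `B`; the other one makes the flat part deviate from the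
  -- identity by at most `η / 2`.
  refine ⟨η / N, div_pos hη hN0, min 1 (η / (2 * (1 + M))), lt_min one_pos (by positivity),
    fun m z A T hm hA hT => ?_⟩
  have hP : ‖(ContinuousLinearMap.id ℝ R7).prod T‖ ≤ 1 + M := by
    refine ContinuousLinearMap.opNorm_le_bound _ (by positivity) fun v => ?_
    have h1 := T.le_of_opNorm_le hT v
    have h2 := norm_nonneg v
    rw [ContinuousLinearMap.prod_apply, Prod.norm_def]
    refine max_le ?_ ?_
    · change ‖v‖ ≤ (1 + M) * ‖v‖
      nlinarith
    · change ‖T v‖ ≤ (1 + M) * ‖v‖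
      nlinarith
  have hA2 : ‖A‖ ≤ 2 := by
    have h1 := norm_le_norm_add_norm_sub' A (ContinuousLinearMap.id ℝ (R7 × ℝ))
    have h2 := ContinuousLinearMap.norm_id_le (𝕜 := ℝ) (E := R7 × ℝ)
    have h3 := hA.trans (min_le_left _ _)
    linarith
  refine hpos _ _ ?_ ?_
  · have h1 : (ContinuousLinearMap.fst ℝ R7 ℝ).comp (A.comp ((ContinuousLinearMap.id ℝ R7).prod T)) -
        ContinuousLinearMap.id ℝ R7 = (ContinuousLinearMap.fst ℝ R7 ℝ).comp
          ((A - ContinuousLinearMap.id ℝ (R7 × ℝ)).comp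
            ((ContinuousLinearMap.id ℝ R7).prod T)) := by
      ext1 v
      rfl
    rw [h1]
    have h2 : ‖(A - ContinuousLinearMap.id ℝ (R7 × ℝ)).comp
        ((ContinuousLinearMap.id ℝ R7).prod T)‖ ≤ η / (2 * (1 + M)) * (1 + M) :=
      (ContinuousLinearMap.opNorm_comp_le _ _).trans
        (mul_le_mul (hA.trans (min_le_right _ _)) hP (norm_nonneg _) (by positivity))
    have h3 : η / (2 * (1 + M)) * (1 + M) = η / 2 := by
      field_simp
    rw [h3] at h2
    have h4 := mul_le_mul (ContinuousLinearMap.norm_fst_le ℝ R7 ℝ) h2 (norm_nonneg _) zero_le_one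
    have h5 := (ContinuousLinearMap.opNorm_comp_le (ContinuousLinearMap.fst ℝ R7 ℝ) _).trans h4
    linarith
  · have h1 : ‖(fderiv ℝ m z).comp (A.comp ((ContinuousLinearMap.id ℝ R7).prod T))‖ ≤ B :=
      (ContinuousLinearMap.opNorm_comp_le _ _).trans (mul_le_mul (hm.trans (le_max_left _ _))
        ((ContinuousLinearMap.opNorm_comp_le _ _).trans
          (mul_le_mul hA2 hP (norm_nonneg _) zero_le_two)) (norm_nonneg _) (le_max_right _ _))
    have h2 := ContinuousAlternatingMap.norm_compContinuousLinearMap_le omegaT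
      ((fderiv ℝ m z).comp (A.comp ((ContinuousLinearMap.id ℝ R7).prod T)))
    rw [Fintype.card_fin] at h2
    have h3 := h2.trans (mul_le_mul_of_nonneg_left (pow_le_pow_left₀ (norm_nonneg _) h1 3)
      (norm_nonneg _))
    rw [norm_smul, Real.norm_of_nonneg (by positivity), div_mul_eq_mul_div, div_lt_iff₀ hN0]
    exact mul_lt_mul_of_pos_left (lt_of_le_of_lt h3 (lt_add_one _)) hη

/-- Obtained by differentiating `s (|z|² + l) = t` along a sheared vector; the terms with `d|z|²`
cancel. -/
theorem fderiv_slabHeight_slabShear {ξ : R7 → ℝ} (hξ : ContDiff ℝ ∞ ξ) {l : ℝ} (hl : 0 < l) {y : R7}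
    (hy : ∀ᶠ w in 𝓝 y, ξ w = 1) :
    (fderiv ℝ (slabHeight ξ l) y).comp (slabShear y (slabHeight ξ l y) (zNormSq y + l)) =
      tCoordL := by
  have hD : ∀ w, 0 < zNormSq w + l := fun w => add_pos_of_nonneg_of_pos (zNormSq_nonneg w) hl
  have h1 : (fun w => slabHeight ξ l w * (zNormSq w + l)) =ᶠ[𝓝 y] tCoordL := by
    filter_upwards [hy] with w hw
    rw [slabHeight, hw, one_mul, div_mul_cancel₀ _ (hD w).ne']
    rfl
  have hz : HasFDerivAt zNormSq (fderiv ℝ zNormSq y) y :=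
    (contDiff_zNormSq.differentiable (by simp) y).hasFDerivAt
  have hS : HasFDerivAt (slabHeight ξ l) (fderiv ℝ (slabHeight ξ l) y) y :=
    ((contDiff_slabHeight hξ hl).differentiable (by simp) y).hasFDerivAt
  have h2 := (hS.mul (hz.add_const l)).unique (tCoordL.hasFDerivAt.congr_of_eventuallyEq h1)
  ext1 v
  set s := slabHeight ξ l y
  set w := slabShear y s (zNormSq y + l) v with hw
  have h3 : s * fderiv ℝ zNormSq y w + (zNormSq y + l) * fderiv ℝ (slabHeight ξ l) y w =
      tCoordL w := congrArg (fun L : R7 →L[ℝ] ℝ => L w) h2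
  have h4 : fderiv ℝ zNormSq y w = fderiv ℝ zNormSq y v := by
    rw [hw, slabShear_apply, map_add, map_smul, fderiv_zNormSq_tVec, smul_zero, add_zero]
  have h5 : tCoordL w = s * fderiv ℝ zNormSq y v + (zNormSq y + l) * tCoordL v := by
    rw [hw, slabShear_apply, map_add, map_smul, tCoordL_tVec, smul_eq_mul]
    ring
  rw [h4, h5] at h3
  exact mul_left_cancel₀ (hD y).ne' (add_left_cancel h3)

theorem fderiv_coord_eq_zero {G : R7 → R7} {x : R7} (hG : DifferentiableAt ℝ G x) {i : Fin 7} {c : ℝ}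
    (h : ∀ᶠ y in 𝓝 x, G y i = c) (v : R7) : fderiv ℝ G x v i = 0 := by
  have h1 : HasFDerivAt (fun y => G y i)
      ((EuclideanSpace.proj i : R7 →L[ℝ] ℝ).comp (fderiv ℝ G x)) x :=
    (EuclideanSpace.proj i : R7 →L[ℝ] ℝ).hasFDerivAt.comp x hG.hasFDerivAt
  have h2 : HasFDerivAt (fun y => G y i) (0 : R7 →L[ℝ] ℝ) x :=
    (hasFDerivAt_const c x).congr_of_eventuallyEq h
  exact congrArg (fun L : R7 →L[ℝ] ℝ => L v) (h1.unique h2)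

theorem isClosedG2_of_thickForm {m : R7 × ℝ → R7} (hm : ContDiff ℝ ∞ m) {ε : ℝ}
    {H : R7 → R7 × ℝ} (hH : ContDiffOn ℝ ∞ H B7)
    (hpos : ∀ x ∈ B7, IsPositive (thickForm m ε (H x) (fderivWithin ℝ H B7 x))) :
    IsClosedG2 (fun x => pullback phi0 (fun y => (H y).1) x +
      ε • pullback omegaT (fun y => m (H y)) x) where
  smooth := (contDiffOn_pullback phi0 (contDiff_fst.comp_contDiffOn hH)).add
    ((contDiffOn_pullback omegaT (hm.comp_contDiffOn hH)).const_smul ε)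
  positive x hx := by
    have hd : HasFDerivWithinAt H (fderivWithin ℝ H B7 x) B7 x :=
      ((hH x hx).differentiableWithinAt (by simp)).hasFDerivWithinAt
    have h1 : fderivWithin ℝ (fun y => (H y).1) B7 x =
        (ContinuousLinearMap.fst ℝ R7 ℝ).comp (fderivWithin ℝ H B7 x) :=
      hd.fst.fderivWithin (uniqueDiffOn_B7 x hx)
    have h2 : fderivWithin ℝ (fun y => m (H y)) B7 x =
        (fderiv ℝ m (H x)).comp (fderivWithin ℝ H B7 x) :=
      ((hm.differentiable (by simp) (H x)).hasFDerivAt.comp_hasFDerivWithinAt x hd).fderivWithin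
        (uniqueDiffOn_B7 x hx)
    have h3 := hpos x hx
    rw [thickForm, ← h1, ← h2] at h3
    exact h3
  closed x hx := by
    have h1 := contDiff_fst.comp_contDiffOn hH
    have h2 := hm.comp_contDiffOn hH
    have d1 := ((contDiffOn_pullback phi0 h1) x hx).differentiableWithinAt (by simp)
    have d2 := ((contDiffOn_pullback omegaT h2) x hx).differentiableWithinAt (by simp)
    have e1 := extDerivWithin_pullback_const phi0 h1 hx
    have e2 := extDerivWithin_pullback_const omegaT h2 hx
    refine (extDerivWithin_add (uniqueDiffOn_B7 x hx) d1 (d2.const_smul ε)).trans ?_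
    rw [e1, zero_add]
    refine (extDerivWithin_smul ε _ (uniqueDiffOn_B7 x hx)).trans ?_
    rw [e2, smul_zero]

/-- On the sphere `m ∘ H` agrees with `G`, whose differential annihilates `dt` or all `dx_j`. So `ω₀
∧ dt` contributes nothing and `ι^* φ₀` remains. -/
theorem isBoundaryValue_of_thickForm {m : R7 × ℝ → R7} (hm : ContDiff ℝ ∞ m) {ε : ℝ}
    {H : R7 → R7 × ℝ} (hH : ContDiffOn ℝ ∞ H B7) {i : S6 → R7} {G : R7 → R7}
    (hHi : ∀ x : S6, (H x).1 = i x) (hHG : ∀ x : S6, m (H x) = G x)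
    (hG : ∀ x : S6, DifferentiableAt ℝ G x)
    (hω : ∀ x : S6, (∀ v, fderiv ℝ G x v 6 = 0) ∨
      ∀ v, fderiv ℝ G x v 0 = 0 ∧ fderiv ℝ G x v 2 = 0 ∧ fderiv ℝ G x v 4 = 0) :
    IsBoundaryValue (boundaryForm i) (fun x => pullback phi0 (fun y => (H y).1) x +
      ε • pullback omegaT (fun y => m (H y)) x) := by
  intro x
  have h1 := mvfderiv_comp_coe_sphere (contDiff_fst.comp_contDiffOn hH) hHi x
  have h2 := mvfderiv_comp_coe_sphere (hm.comp_contDiffOn hH) (h := fun x : S6 => G x) hHG x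
  rw [mvfderiv_eq_fderiv_comp (H := G) (fun _ => rfl) (hG x)] at h2
  have h3 : omegaT.compContinuousLinearMap ((fderivWithin ℝ (m ∘ H) B7 x).comp
      (mvfderiv (𝓡 6) (Subtype.val : S6 → R7) x)) = 0 := by
    rw [← h2]
    exact omegaT_comp_eq_zero ((hω x).imp (fun h v => h _) fun h v => h _)
  rw [boundaryForm, h1]
  change _ = phi0.compContinuousLinearMap ((fderivWithin ℝ (Prod.fst ∘ H) B7 x).comp
      (mvfderiv (𝓡 6) (Subtype.val : S6 → R7) x)) +
    ε • omegaT.compContinuousLinearMap ((fderivWithin ℝ (m ∘ H) B7 x).comp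
      (mvfderiv (𝓡 6) (Subtype.val : S6 → R7) x))
  rw [h3, smul_zero, add_zero]

theorem IsPinchingFamily.eventually_contMDiff {Λ : ℝ} {Ω : ℝ → Set R7} {ι : ℝ → S6 → R7}
    (h : IsPinchingFamily Λ Ω ι) :
    ∀ᶠ l in 𝓝[>] (0 : ℝ), ContMDiff (𝓡 6) 𝓘(ℝ, R7) ∞ (ι l) := by
  filter_upwards [h.eventually_mem] with l hl
  obtain ⟨F, hF, hFi⟩ := h.boundary l hl
  have h1 : ι l = fun x : S6 => F x := funext fun x => (hFi x).symm
  rw [h1]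
  exact contMDiff_of_contDiffOn_B7 hF.smooth

theorem IsPinchingFamily.exists_closed_filling {Λ : ℝ} {Ω : ℝ → Set R7} {ι : ℝ → S6 → R7}
    (h : IsPinchingFamily Λ Ω ι) :
    ∃ φ : R7 → Form 3, IsClosedG2 φ ∧ IsBoundaryValue (boundaryForm (ι 0)) φ := by
  obtain ⟨a, ha, hslab, μ, hμ, hμinj, hμloc, hμl⟩ := h.exists_sheet_function
  let χ : ContDiffBump (0 : R7) := ⟨2 * a, 3 * a, by linarith, by linarith⟩
  let ξ : ContDiffBump (0 : R7) := ⟨4 * a, 5 * a, by linarith, by linarith⟩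
  have hξ : ContDiff ℝ ∞ ξ := ξ.contDiff
  have hξ1 : ∀ y : R7, ‖y‖ < 4 * a → ∀ᶠ w in 𝓝 y, ξ w = 1 := fun y hy =>
    ξ.eventuallyEq_one_of_mem_ball (mem_ball_zero_iff.2 hy)
  have hξ0 : ∀ y : R7, 5 * a ≤ ‖y‖ → ξ y = 0 := fun y hy =>
    ξ.zero_of_le_dist (by rw [dist_zero_right]; exact hy)
  have hχ0 : ∀ y : R7, 3 * a ≤ ‖y‖ → χ y = 0 := fun y hy =>
    χ.zero_of_le_dist (by rw [dist_zero_right]; exact hy)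
  have hm : ContDiff ℝ ∞ (mixMap χ) := contDiff_mixMap χ.contDiff
  have hma : ∀ z : R7 × ℝ, ‖z.1‖ ≤ a → fderiv ℝ (mixMap χ) z = mixLin := fun z hz =>
    fderiv_mixMap (χ.eventuallyEq_one_of_mem_ball (mem_ball_zero_iff.2 (by
      change ‖z.1‖ < 2 * a
      linarith)))
  obtain ⟨M, hM, hMS⟩ := exists_bound_fderiv_slabHeight hξ ha hξ0
  obtain ⟨C, hC⟩ := exists_bound_fderiv_mixMap χ.contDiff χ.hasCompactSupport
  -- The constants `M` and `C` do not involve `ε` or `l`. They determine `ε`, then `ε` determines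
  -- both tolerances, and only then is `l` chosen. The number `a ^ 2 + 1` bounds the thickness for
  -- `|y| ≤ a` and `l ≤ 1`.
  obtain ⟨ε, hε, δ₁, hδ₁, hfar⟩ := exists_isPositive_thickForm_far hM C
  obtain ⟨δ₂, hδ₂, hnear⟩ := exists_isPositive_thickForm hm hma hε (a ^ 2 + 1)
  set δ := min δ₁ (δ₂ / 2) with hδ
  have hδ0 : 0 < δ := lt_min hδ₁ (half_pos hδ₂)
  have hδlt : δ < δ₂ := (min_le_right _ _).trans_lt (half_lt_self hδ₂)
  -- Double points of `ι_0` lie over the origin, where `ξ = 1`, and `μ` tells them apart.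
  have hinj : ∀ x y : S6, ι 0 x = ι 0 y → μ x * ξ (ι 0 x) = μ y * ξ (ι 0 y) → x = y := by
    intro x y hxy hs
    rcases h.limit_injective x y hxy with h1 | h1
    · exact h1
    · have h2 : ξ (0 : R7) = 1 := (hξ1 0 (by rw [norm_zero]; linarith)).self_of_nhds
      rw [← hxy, h1, h2, mul_one, mul_one] at hs
      exact hμinj x y h1 (hxy ▸ h1) hs
  have hl1 : ∀ᶠ l in 𝓝[>] (0 : ℝ), l ∈ Ioc (0 : ℝ) 1 := Ioc_mem_nhdsGT one_pos
  obtain ⟨l, hl, hl1, ⟨Φ, hΦ, hΦι, hΦδ⟩, hμl⟩ := (h.eventually_mem.and (hl1.and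
    ((exists_correction h.eventually_contMDiff h.limit_smooth h.limit_immersion h.tendsto hμ hξ
      hinj hδ0).and hμl))).exists
  obtain ⟨F, hF, hFι⟩ := h.boundary l hl
  let J : R7 → R7 × ℝ := fun y => (y, slabHeight ξ l y)
  have hS := contDiff_slabHeight hξ hl.1
  have hJ : ContDiff ℝ ∞ J := contDiff_id.prodMk hS
  let H : R7 → R7 × ℝ := fun x => Φ (J (F x))
  have hH : ContDiffOn ℝ ∞ H B7 := (hΦ.comp hJ).comp_contDiffOn hF.smooth
  have hHS : ∀ x : S6, H x = (ι 0 x, μ x * ξ (ι 0 x)) := by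
    intro x
    rw [← hΦι]
    change Φ (F x, slabHeight ξ l (F x)) = _
    rw [hFι, slabHeight, mul_comm (μ x)]
    rcases le_or_gt ‖ι l x‖ (5 * a) with h1 | h1
    · rw [hμl x h1]
    · rw [hξ0 _ h1.le, zero_mul, zero_mul]
  -- An extension of the boundary values of `mixMap χ ∘ H` off the sphere, so that local constancy
  -- of its coordinates can be differentiated in `ℝ⁷`.
  let G : R7 → R7 := fun y => mixMap χ (radialExt (ι 0) y, μ y * ξ (radialExt (ι 0) y))
  have hG : ∀ x : S6, DifferentiableAt ℝ G x := fun x => by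
    have h1 := contDiffAt_radialExt h.limit_smooth (sphere_ne_zero x)
    have h2 : ContDiffAt ℝ ∞ G x :=
      hm.contDiffAt.comp (x : R7) (h1.prodMk (hμ.contDiffAt.mul (hξ.contDiffAt.comp _ h1)))
    exact h2.differentiableAt (by simp)
  refine ⟨_, isClosedG2_of_thickForm hm (ε := ε) hH fun x hx => ?_,
    isBoundaryValue_of_thickForm hm hH (G := G) (fun x => congrArg Prod.fst (hHS x))
      (fun x => ?_) hG fun x => ?_⟩
  · have hFx : F x ∈ closure (Ω l) := by
      rw [← hF.image_closedBall]
      exact mem_image_of_mem F hx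
    have hsl : ‖F x‖ < 8 * a → 0 ≤ tCoord (F x) ∧ tCoord (F x) ≤ zNormSq (F x) + l :=
      fun h1 => (hslab l hl).of_mem_closure h1 hFx
    have hd : fderivWithin ℝ H B7 x = ((fderiv ℝ Φ (J (F x))).comp
        ((ContinuousLinearMap.id ℝ R7).prod (fderiv ℝ (slabHeight ξ l) (F x)))).comp
          (fderivWithin ℝ F B7 x) := by
      have h1 : HasFDerivAt J ((ContinuousLinearMap.id ℝ R7).prod
          (fderiv ℝ (slabHeight ξ l) (F x))) (F x) :=
        (hasFDerivAt_id _).prodMk (hS.differentiable (by simp) _).hasFDerivAt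
      have h2 := ((hΦ.differentiable (by simp) (J (F x))).hasFDerivAt.comp (F x) h1)
      exact (h2.comp_hasFDerivWithinAt x
        ((hF.smooth x hx).differentiableWithinAt (by simp)).hasFDerivWithinAt).fderivWithin
          (uniqueDiffOn_B7 x hx)
    rw [hd, ← thickForm_comp]
    refine isPositive_comp ?_ (hF.orientation x hx)
    rcases le_or_gt a ‖F x‖ with h1 | h1
    · exact hfar _ _ _ _ (hC _) ((hΦδ _).2.trans (min_le_left _ _)) (hMS l hl1 _ h1 hsl)
    · obtain ⟨ht0, ht⟩ := hsl (by linarith)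
      have hz := zNormSq_nonneg (F x)
      have hD : 0 < zNormSq (F x) + l := by linarith [hl.1]
      have hξx := hξ1 (F x) (by linarith)
      have hs : slabHeight ξ l (F x) ∈ Icc (0 : ℝ) 1 := by
        rw [slabHeight, hξx.self_of_nhds, one_mul]
        exact ⟨div_nonneg ht0 hD.le, div_le_one_of_le₀ ht hD.le⟩
      have hR : zNormSq (F x) + l ≤ a ^ 2 + 1 := by
        have h2 := norm_sq_eq (F x)
        have h3 := sq_nonneg (tCoord (F x))
        have h4 : ‖F x‖ ^ 2 ≤ a ^ 2 := pow_le_pow_left₀ (norm_nonneg _) h1.le 2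
        linarith [hl1.2]
      refine hnear (F x) _ _ h1.le hs ⟨hD, hR⟩ (H x) (fderiv ℝ Φ (J (F x)))
        ((hΦδ _).1.trans_lt hδlt) ((hΦδ _).2.trans_lt hδlt) _ ?_
      rw [ContinuousLinearMap.comp_assoc]
      congr 1
      rw [← fderiv_slabHeight_slabShear hξ hl.1 hξx]
      rfl
  · rw [hHS x]
    simp only [G, radialExt_sphere]
  · have hc : ContinuousAt (radialExt (ι 0)) (x : R7) :=
      (contDiffAt_radialExt h.limit_smooth (sphere_ne_zero x)).continuousAt
    -- The regions overlap: the height is constant on each sheet where `ξ = 1`, up to radius `4a`,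
    -- and `χ` vanishes already from radius `3a` on.
    rcases lt_or_ge ‖ι 0 x‖ (4 * a) with h1 | h1
    · left
      obtain ⟨c, hcx⟩ := hμloc x (by linarith)
      refine fderiv_coord_eq_zero (c := c) (hG x) ?_
      have h2 : ∀ᶠ y in 𝓝 (x : R7), ‖radialExt (ι 0) y‖ < 4 * a :=
        hc.norm.eventually_lt continuousAt_const (by rw [radialExt_sphere]; exact h1)
      filter_upwards [hcx, h2] with y hy1 hy2
      simp only [G]
      rw [mixMap_apply_six, hy1, (hξ1 _ hy2).self_of_nhds, mul_one]
    · right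
      have h2 : ∀ᶠ y in 𝓝 (x : R7), 3 * a < ‖radialExt (ι 0) y‖ :=
        continuousAt_const.eventually_lt hc.norm (by rw [radialExt_sphere]; linarith)
      have h3 : ∀ i : Fin 7, i = 0 ∨ i = 2 ∨ i = 4 → ∀ᶠ y in 𝓝 (x : R7), G y i = 0 := by
        intro i hi
        filter_upwards [h2] with y hy
        have h4 : χ (radialExt (ι 0) y) = 0 := hχ0 _ hy.le
        exact mixMap_apply_real (z := (radialExt (ι 0) y, μ y * ξ (radialExt (ι 0) y))) h4 hi
      exact fun v => ⟨fderiv_coord_eq_zero (hG x) (h3 0 (by simp)) v,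
        fderiv_coord_eq_zero (hG x) (h3 2 (by simp)) v,
        fderiv_coord_eq_zero (hG x) (h3 4 (by simp)) v⟩

end G2Ball

end

theorem mainTheorem11 :
    -- such families exist
    (∃ (Λ : ℝ) (Ω : ℝ → Set G2Ball.R7) (ι : ℝ → G2Ball.S6 → G2Ball.R7),
      G2Ball.IsPinchingFamily Λ Ω ι) ∧
    ∀ (Λ : ℝ) (Ω : ℝ → Set G2Ball.R7) (ι : ℝ → G2Ball.S6 → G2Ball.R7),
      G2Ball.IsPinchingFamily Λ Ω ι →
      -- in the limit two parts of the boundary touch at the origin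
      (∃ p q : G2Ball.S6, p ≠ q ∧ ι 0 p = 0 ∧ ι 0 q = 0) ∧
      -- for `λ > 0` the form `ρ^(λ)` has a torsion-free filling, namely the flat one
      (∀ l ∈ Set.Ioo 0 Λ,
        (∃ F : G2Ball.R7 → G2Ball.R7,
          G2Ball.IsBallDiffeo F (Ω l) ∧ ∀ x : G2Ball.S6, F (x : G2Ball.R7) = ι l x) ∧
        ∀ F : G2Ball.R7 → G2Ball.R7, G2Ball.IsBallDiffeo F (Ω l) →
          (∀ x : G2Ball.S6, F (x : G2Ball.R7) = ι l x) →
          G2Ball.IsTorsionFreeG2 (G2Ball.flatPullback F) ∧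
          G2Ball.IsBoundaryValue (G2Ball.boundaryForm (ι l)) (G2Ball.flatPullback F)) ∧
      -- these fillings have no limit as `λ → 0`, not even a uniform one along a sequence
      (∀ (s : ℕ → ℝ) (F : ℕ → G2Ball.R7 → G2Ball.R7),
        (∀ n, s n ∈ Set.Ioo 0 Λ) → Filter.Tendsto s Filter.atTop (nhds 0) →
        (∀ n, G2Ball.IsBallDiffeo (F n) (Ω (s n)) ∧
          ∀ x : G2Ball.S6, F n (x : G2Ball.R7) = ι (s n) x) →
        ¬ ∃ ψ : G2Ball.R7 → G2Ball.Form 3,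
          (∀ x ∈ G2Ball.B7, G2Ball.IsPositive (ψ x)) ∧
          TendstoUniformlyOn (fun n => G2Ball.flatPullback (F n)) ψ Filter.atTop G2Ball.B7) ∧
      -- `ρ^(0)` is the boundary value of a closed `G₂`-structure
      ∃ φ : G2Ball.R7 → G2Ball.Form 3,
        G2Ball.IsClosedG2 φ ∧ G2Ball.IsBoundaryValue (G2Ball.boundaryForm (ι 0)) φ :=
  ⟨G2Ball.exists_isPinchingFamily, fun _ _ _ h => ⟨h.exists_double_point,
    fun l hl => ⟨h.boundary l hl, fun _ hF hFi => ⟨G2Ball.isTorsionFreeG2_flatPullback hF,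
      G2Ball.isBoundaryValue_pullback_phi0 hF.smooth hFi⟩⟩,
    fun _ _ hs hs0 hF => h.not_exists_limit hs hs0 hF, h.exists_closed_filling⟩⟩
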